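/- Let $n\ge 3$ be an integer. For $\epsilon>0$ let $Q=Q_\epsilon$ be the connected component of $\{(x,y)\in\mathbb{R}^2 : x^2+y^2+\epsilon y^n=1\}$ that tends to the unit circle as $\epsilon\to0^+$, that is, the component containing $(1,0)$. For all sufficiently small $\epsilon>0$, $Q$ is a simple closed curve with positive curvature. For such $\epsilon$, let $l$ be the length of $Q$, let $\kappa(s)$ be the curvature of $Q$ in some arc-length parameter $s\in\mathbb{R}/l\mathbb{Z}$, and let $\xi\in\mathbb{R}/\mathbb{Z}$ be the angular variable defined by $$C\,\frac{d\xi}{ds}=\kappa^{2/3}(s),\qquad C=\int_Q\kappa^{2/3}\,ds,\qquad \xi(0)=0.$$ Let $\kappa(\xi)$ be the curvature written as a ($1$-periodic, real analytic, positive) function of $\xi\in\mathbb{R}$. Let $\delta=\delta(\epsilon)$ be the distance to the real axis of the set of singularities and zeros of $\kappa(\xi)$, that is, the number $\delta>0$ such that $\kappa(\xi)$ extends to an analytic function without zeros on the open strip $\{|\operatorname{Im}\xi|<\delta\}$ and has a singularity or a zero on the boundary of this strip. Then $\delta$ exists for all sufficiently small $\epsilon>0$, it does not depend on the choice of the arc-length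 parameter, and there is a constant $\eta_n\in\mathbb{R}$, depending only on $n$, such that $$2\pi\delta=\frac{|\log\epsilon|}{n}+\eta_n+O\!\left(\epsilon^{2/n}\log\epsilon\right)\qquad\text{as }\epsilon\to0^+ .$$ -/

import Mathlib

open Filter Topology Asymptotics

noncomputable section

namespace PerturbedCircle

/-- The Euclidean plane. -/
abbrev Plane : Type := EuclideanSpace ℝ (Fin 2)

/-- The perturbed circle `x² + y² + ε yⁿ = 1`. For odd `n` the algebraic curve has further
components; the relevant one is the one that tends to the unit circle as `ε → 0⁺`, that is,
the component of the point `(1, 0)`, which lies on the curve for every `ε`. -/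
def perturbedCircle (n : ℕ) (ε : ℝ) : Set Plane :=
  connectedComponentIn {v : Plane | v 0 ^ 2 + v 1 ^ 2 + ε * v 1 ^ n = 1} !₂[1, 0]

/-- `γ` is an arc-length parametrization, with the parameter in `ℝ / l ℤ`, of the simple closed
curve `Q` of length `l`. -/
structure IsArcLengthParam (Q : Set Plane) (γ : ℝ → Plane) (l : ℝ) : Prop where
  length_pos : 0 < l
  contDiff : ContDiff ℝ 2 γ
  unit_speed : ∀ s, ‖deriv γ s‖ = 1
  periodic : Function.Periodic γ l
  injOn : Set.InjOn γ (Set.Ico 0 l)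
  range_eq : Set.range γ = Q

/-- The curvature, at the arc-length parameter `s`, of a curve of unit speed. -/
def curvature (γ : ℝ → Plane) (s : ℝ) : ℝ := ‖deriv (deriv γ) s‖

/-- The constant `C = ∫_Q κ^{2/3} ds`. -/
def xiConst (γ : ℝ → Plane) (l : ℝ) : ℝ :=
  ∫ s in (0 : ℝ)..l, curvature γ s ^ (2 / 3 : ℝ)

/-- The angular variable `ξ`, as a function of `s`: the solution of `C dξ/ds = κ^{2/3}(s)` with
`ξ(0) = 0`, lifted to a function from `ℝ` to `ℝ`. -/
def xi (γ : ℝ → Plane) (l : ℝ) (s : ℝ) : ℝ :=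
  (∫ t in (0 : ℝ)..s, curvature γ t ^ (2 / 3 : ℝ)) / xiConst γ l

/-- The curvature as a function of `ξ`: the composition of `κ(s)` with the inverse function of
`s ↦ ξ(s)`, which is a bijection of `ℝ` when the curvature is positive. -/
def curvatureXi (γ : ℝ → Plane) (l : ℝ) (ξ : ℝ) : ℝ :=
  curvature γ (Function.invFun (xi γ l) ξ)

/-- The open complex strip `|Im z| < a`. -/
def strip (a : ℝ) : Set ℂ := {z : ℂ | |z.im| < a}

/-- `F` is the analytic continuation of `k` from the real axis to the open strip `|Im z| < a`,
and it has no zeros there. -/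
structure IsNonvanishingExtension (k : ℝ → ℝ) (a : ℝ) (F : ℂ → ℂ) : Prop where
  differentiableOn : DifferentiableOn ℂ F (strip a)
  ne_zero : ∀ z ∈ strip a, F z ≠ 0
  eq_on_real : ∀ x : ℝ, F (x : ℂ) = (k x : ℂ)

/-- The boundary point `z` of the strip `|Im z| < a` is a singularity or a zero of the function
`F` given on the strip: `F` has no analytic continuation to a neighbourhood of `z`, or the
continuation vanishes at `z`. -/
def IsSingularityOrZero (F : ℂ → ℂ) (a : ℝ) (z : ℂ) : Prop :=
  ¬ ∃ G : ℂ → ℂ, AnalyticAt ℂ G z ∧ G z ≠ 0 ∧ F =ᶠ[𝓝[strip a] z] G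

/-- `δ > 0` is the distance to the real axis of the set of singularities and zeros of the real
analytic function `k`: the function is analytic and does not vanish on the open strip
`|Im z| < δ`, and it has a singularity or a zero on the boundary of this strip. -/
def IsSingularityDistance (k : ℝ → ℝ) (δ : ℝ) : Prop :=
  0 < δ ∧ ∃ F : ℂ → ℂ, IsNonvanishingExtension k δ F ∧
    ∃ z : ℂ, |z.im| = δ ∧ IsSingularityOrZero F δ z

end PerturbedCircle

end

/-! Put `τ = ε^{1/n}`, and let `c < 0 < a` be the heights of the two points of the curve on the
`y`-axis near the circle. Dividing `1 - y² - ε yⁿ` by `(a - y)(y - c)` leaves a polynomial `Q` close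
to 1. With `y = (a + c)/2 + (a - c)/2 · sin θ` the curve is parametrized `2π`-periodically, `κ = P
R^{-3/2}` and `κ^{2/3} ds = P^{2/3} R^{-1/2} Q^{-1/2} dθ`, where `P` and `R` too are polynomials in
`y`. All arc-length parameters give the same `κ(ξ)` up to translation and reflection of `ξ`
(`curvatureXi_eq`), and `δ` is the supremum of the half-widths of the strips to which `κ(ξ)` extends
without zeros (`isSingularityDistance_sSup`). It remains to bound these widths from both sides.

In the complex domain the action takes place at height about `log (1/τ)`, where `ε yⁿ` has order 1.
A further coordinate `φ` is introduced by `thetaC`, together with `p = (n-1)/2 · fⁿ`, `f = (iτ/2)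
e^{-iφ}`, whose modulus depends on `Im φ` only. It is chosen so that `(n-1)/2 · ε yⁿ = p/(1-p) +
O(τ²)`. Then `C dξ/dφ` is close to `(1-(n-1)p)^{2/3} (1+p)^{-1/2} (1-p)^{-7/6}` (`exists_approx`,
`exists_estimates`). The zero `p = 1/(n-1)` is closer to the origin than the singularities `p = ±1`;
in the variable `p/(1-p)` this fails for `n = 3`. Moreover minus the logarithm of the modulus is the
real part of a power series in `p` with nonnegative coefficients, so on each circle `|p| = r` the
modulus is least at `p = r` (`limitNorm_norm_le`).

Lower bound for the widths: a holomorphic function whose derivative has modulus at least `m(|Im φ|)`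
has a right inverse on the strip of half-width `∫ m` (`exists_right_inverse_on_strip`); the
curvature, as a function of `φ`, is composed with it. Upper bound: on the line `Re φ = π/2` the
coordinate `p` is positive and everything is real, so `ξ` moves vertically, at the least speed that
the lower bound allows up to the error, until `P` changes sign and the curvature vanishes
(`width_le`).

Both bounds are governed by one integral, up to the critical height `L` with `(n-1)|p| = 1`, that
is, `L = |log ε|/n + const`. The integrand tends to 1 exponentially away from `L`, so the integral
is `L + c` up to an exponentially small term (`exists_integral_profile`). The relative error `K
τ²/(1-(n-1)|p|)` stays integrable against a density that vanishes with exponent `2/3`, and costs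
`O(τ² L)`. Finally `C = 2π + O(ε)`. -/

noncomputable section

/-! ### Inverting a holomorphic function on a strip by a flow. -/

namespace PerturbedCircle

open Set Metric in
/-- A bounded Lipschitz vector field has integral curves on every bounded interval. -/
theorem exists_integralCurve {E : Type*} [NormedAddCommGroup E] [NormedSpace ℝ E]
    [CompleteSpace E] {v : E → E} {L M : NNReal} (hv : LipschitzWith L v) (hM : ∀ x, ‖v x‖ ≤ M)
    {T : ℝ} (hT : 0 < T) (x : E) :
    ∃ α : ℝ → E, α 0 = x ∧ ∀ t ∈ Ioo (-T) T, HasDerivAt α (v (α t)) t := by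
  have h0 : (0 : ℝ) ∈ Icc (-T) T := ⟨by linarith, hT.le⟩
  -- The ball of radius `M T` cannot be left within time `T`, so the local theorem already gives the
  -- whole interval.
  have hp : IsPicardLindelof (fun _ => v) (tmin := -T) (tmax := T) ⟨0, h0⟩ x
      (M * T.toNNReal) 0 M L := by
    refine IsPicardLindelof.of_time_independent (fun y _ => hM y) hv.lipschitzOnWith ?_
    simp [Real.coe_toNNReal T hT.le]
  obtain ⟨α, h1, h2⟩ := hp.exists_eq_forall_mem_Icc_hasDerivWithinAt₀
  exact ⟨α, h1, fun t ht => (h2 t (Ioo_subset_Icc_self ht)).hasDerivAt (Icc_mem_nhds ht.1 ht.2)⟩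

open Set Metric in
/-- Integral curves of a Lipschitz vector field depend continuously on the initial point. -/
theorem dist_integralCurve_le {E : Type*} [NormedAddCommGroup E] [NormedSpace ℝ E]
    {v : E → E} {L : NNReal} (hv : LipschitzWith L v) {T : ℝ}
    {α β : ℝ → E} (hα : ∀ t ∈ Ioo (-T) T, HasDerivAt α (v (α t)) t)
    (hβ : ∀ t ∈ Ioo (-T) T, HasDerivAt β (v (β t)) t) {t : ℝ} (ht : t ∈ Ioo (-T) T) :
    dist (α t) (β t) ≤ dist (α 0) (β 0) * Real.exp (L * |t|) := by
  have key : ∀ {w : E → E}, LipschitzWith L w → ∀ {α β : ℝ → E},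
      (∀ t ∈ Ioo (-T) T, HasDerivAt α (w (α t)) t) →
      (∀ t ∈ Ioo (-T) T, HasDerivAt β (w (β t)) t) → ∀ t ∈ Ioo (-T) T, 0 ≤ t →
      dist (α t) (β t) ≤ dist (α 0) (β 0) * Real.exp (L * t) := by
    intro w hw α β hα hβ t ht h0
    have hmem : ∀ s ∈ Icc 0 t, s ∈ Ioo (-T) T := fun s hs =>
      ⟨by linarith [hs.1, ht.1, ht.2], by linarith [hs.2, ht.2]⟩
    have := dist_le_of_trajectories_ODE (v := fun _ => w) (K := L) (f := α) (g := β) (a := 0)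
      (b := t) (δ := dist (α 0) (β 0)) (fun _ => hw)
      (fun s hs => (hα s (hmem s hs)).continuousAt.continuousWithinAt)
      (fun s hs => (hα s (hmem s (Ico_subset_Icc_self hs))).hasDerivWithinAt)
      (fun s hs => (hβ s (hmem s hs)).continuousAt.continuousWithinAt)
      (fun s hs => (hβ s (hmem s (Ico_subset_Icc_self hs))).hasDerivWithinAt)
      le_rfl t ⟨h0, le_rfl⟩
    simpa using this
  rcases le_total 0 t with h0 | h0
  · rw [abs_of_nonneg h0]; exact key hv hα hβ t ht h0
  · rw [abs_of_nonpos h0]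
    -- Negative times follow by time reversal: `s ↦ α (-s)` is an integral curve of `-v`.
    have hw : LipschitzWith L (fun x => -v x) := hv.neg
    have hneg : ∀ {α : ℝ → E}, (∀ t ∈ Ioo (-T) T, HasDerivAt α (v (α t)) t) →
        ∀ t ∈ Ioo (-T) T, HasDerivAt (fun s => α (-s)) (-v (α (-t))) t := by
      intro α hα t ht
      have := (hα (-t) ⟨by linarith [ht.2], by linarith [ht.1]⟩).scomp t (hasDerivAt_neg t)
      simpa [Function.comp_def] using this
    have := key hw (hneg hα) (hneg hβ) (-t) ⟨by linarith [ht.2], by linarith [ht.1]⟩ (by linarith)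
    simpa using this

/-- The projection of the plane to the closed strip `|Im z| ≤ σ`. -/
def clampIm (σ : ℝ) (z : ℂ) : ℂ := ⟨z.re, max (-σ) (min z.im σ)⟩

theorem clampIm_abs_le {σ : ℝ} (hσ : 0 ≤ σ) (z : ℂ) : |(clampIm σ z).im| ≤ σ := by
  simp only [clampIm, abs_le]
  exact ⟨le_max_left _ _, max_le (by linarith) (min_le_right _ _)⟩

theorem clampIm_eq {σ : ℝ} {z : ℂ} (hz : |z.im| ≤ σ) : clampIm σ z = z := by
  rw [abs_le] at hz
  apply Complex.ext <;> simp [clampIm, hz.1, hz.2]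

theorem abs_clampIm_im {σ : ℝ} (hσ : 0 ≤ σ) (z : ℂ) :
    |(clampIm σ z).im| = min |z.im| σ := by
  simp only [clampIm]
  rcases le_total z.im σ with h | h
  · rcases le_total (-σ) z.im with h' | h'
    · rw [min_eq_left h, max_eq_right h', min_eq_left (abs_le.2 ⟨h', h⟩)]
    · rw [min_eq_left h, max_eq_left h', abs_neg, abs_of_nonneg hσ, min_eq_right]
      exact le_abs.2 (Or.inr (by linarith))
  · rw [min_eq_right h, max_eq_right (by linarith), abs_of_nonneg hσ, min_eq_right]
    exact le_abs.2 (Or.inl h)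

theorem lipschitzWith_clampIm (σ : ℝ) : LipschitzWith 1 (clampIm σ) := by
  refine LipschitzWith.of_dist_le_mul fun z w => ?_
  rw [NNReal.coe_one, one_mul, Complex.dist_eq_re_im, Complex.dist_eq_re_im]
  apply Real.sqrt_le_sqrt
  have h : |max (-σ) (min z.im σ) - max (-σ) (min w.im σ)| ≤ |z.im - w.im| := by
    refine (abs_max_sub_max_le_max _ _ _ _).trans ?_
    rw [sub_self, abs_zero, max_eq_right (abs_nonneg _)]
    refine (abs_min_sub_min_le_max _ _ _ _).trans ?_
    rw [sub_self, abs_zero, max_eq_left (abs_nonneg _)]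
  have := sq_le_sq.2 h
  simp only [clampIm]
  linarith

open Set in
/-- A holomorphic function `X` on a closed strip whose derivative `H` satisfies `m(|Im z|) ≤ |H z|`
has a holomorphic right inverse on the strip of half-width `∫ m`. -/
theorem exists_right_inverse_on_strip {H X : ℂ → ℂ} {σ : ℝ} {L : NNReal} {m φ₀ : ℝ → ℝ}
    (hσ : 0 < σ) (hX : ∀ z : ℂ, |z.im| ≤ σ → HasDerivAt X (H z) z)
    (hL : LipschitzOnWith L (fun z => (H z)⁻¹) {z : ℂ | |z.im| ≤ σ})
    (hm : ContinuousOn m (Icc 0 σ)) (hm0 : ∀ t ∈ Icc 0 σ, 0 < m t)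
    (hmH : ∀ z : ℂ, |z.im| ≤ σ → m |z.im| ≤ ‖H z‖)
    (hφ : Continuous φ₀) (hφX : ∀ s : ℝ, X (φ₀ s) = s) :
    ∃ Θ : ℂ → ℂ, (∀ s : ℝ, Θ s = φ₀ s) ∧ ∀ z ∈ strip (∫ t in (0 : ℝ)..σ, m t),
      |(Θ z).im| < σ ∧ X (Θ z) = z ∧ HasDerivAt Θ (H (Θ z))⁻¹ z := by
  classical
  set a := ∫ t in (0 : ℝ)..σ, m t with ha
  -- the extended lower bound and its primitive
  set μ : ℝ → ℝ := fun x => m (min |x| σ) with hμ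
  have hmem : ∀ x : ℝ, min |x| σ ∈ Icc 0 σ := fun x =>
    ⟨le_min (abs_nonneg _) hσ.le, min_le_right _ _⟩
  have hμc : Continuous μ := hm.comp_continuous (by fun_prop) hmem
  have hμ0 : ∀ x, 0 < μ x := fun x => hm0 _ (hmem x)
  obtain ⟨c, hc, hcm⟩ : ∃ c > 0, ∀ x, c ≤ μ x := by
    obtain ⟨x, hx, hmin⟩ := isCompact_Icc.exists_isMinOn (nonempty_Icc.2 hσ.le) hm
    exact ⟨m x, hm0 x hx, fun y => hmin (hmem y)⟩
  set J : ℝ → ℝ := fun x => ∫ t in (0 : ℝ)..x, μ t with hJ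
  have hJd : ∀ x, HasDerivAt J (μ x) x := fun x =>
    intervalIntegral.integral_hasDerivAt_right (hμc.intervalIntegrable _ _)
      (hμc.stronglyMeasurableAtFilter _ _) hμc.continuousAt
  have hJmono : StrictMono J := strictMono_of_deriv_pos fun x => by
    rw [(hJd x).deriv]; exact hμ0 x
  have hJσ : J σ = a := by
    rw [hJ, ha]
    apply intervalIntegral.integral_congr
    intro t ht
    rw [uIcc_of_le hσ.le] at ht
    simp [hμ, abs_of_nonneg ht.1, min_eq_left ht.2]
  have hJneg : ∀ x, J (-x) = -J x := by
    intro x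
    have h := intervalIntegral.integral_comp_neg (f := μ) (a := 0) (b := x)
    have h2 : ∀ t, μ (-t) = μ t := fun t => by simp [hμ]
    simp only [h2, neg_zero] at h
    simp only [hJ, h]
    rw [intervalIntegral.integral_symm]
  have hJ0 : J 0 = 0 := by simp [hJ]
  -- the vector field
  set v : ℂ → ℂ := fun z => Complex.I * (H (clampIm σ z))⁻¹ with hv
  have hvL : LipschitzWith L v := by
    have h1 : LipschitzWith (L * 1) (fun z => (H (clampIm σ z))⁻¹) := by
      rw [← lipschitzOnWith_univ]
      exact hL.comp (lipschitzWith_clampIm σ).lipschitzOnWith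
        (fun z _ => clampIm_abs_le hσ.le z)
    refine LipschitzWith.of_dist_le_mul fun z w => ?_
    have := h1.dist_le_mul z w
    simp only [hv, dist_eq_norm, ← mul_sub, norm_mul, Complex.norm_I, one_mul] at this ⊢
    simpa using this
  have hvμ : ∀ z, ‖v z‖ ≤ (μ z.im)⁻¹ := by
    intro z
    have h1 := hmH _ (clampIm_abs_le hσ.le z)
    rw [abs_clampIm_im hσ.le] at h1
    simp only [hv, norm_mul, Complex.norm_I, one_mul, norm_inv]
    exact inv_anti₀ (hμ0 z.im) h1
  have hvM : ∀ z, ‖v z‖ ≤ (⟨c⁻¹, by positivity⟩ : NNReal) := fun z =>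
    (hvμ z).trans (inv_anti₀ hc (hcm _))
  have hapos : 0 < a := by rw [← hJσ, ← hJ0]; exact hJmono hσ
  choose α hα0 hα using fun x : ℂ => exists_integralCurve hvL hvM hapos x
  -- Along a trajectory `J (Im)` has derivative at most 1 in modulus, because `‖v‖ ≤ 1 / μ (Im)`,
  -- and it starts at 0. As `J` is odd, increasing and `J σ = a`, the trajectory stays in `|Im| < σ`
  -- for `|t| < a`, where the clamping of the field has no effect.
  have him : ∀ s : ℝ, ∀ t ∈ Ioo (-a) a, |(α (φ₀ s) t).im| < σ := by
    intro s t ht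
    set β := fun t => (α (φ₀ s) t).im with hβ
    have hβd : ∀ t ∈ Ioo (-a) a, HasDerivAt β (v (α (φ₀ s) t)).im t := fun t ht =>
      (Complex.imCLM.hasFDerivAt.comp_hasDerivAt t (hα (φ₀ s) t ht))
    have hd : ∀ t ∈ Ioo (-a) a, HasDerivAt (fun t => J (β t))
        (μ (β t) * (v (α (φ₀ s) t)).im) t := fun t ht => (hJd _).comp t (hβd t ht)
    have hb : ∀ t ∈ Ioo (-a) a, ‖μ (β t) * (v (α (φ₀ s) t)).im‖ ≤ 1 := by
      intro t ht
      rw [norm_mul, Real.norm_of_nonneg (hμ0 _).le, ← mul_inv_cancel₀ (hμ0 (β t)).ne']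
      exact mul_le_mul_of_nonneg_left ((Complex.abs_im_le_norm _).trans (hvμ _)) (hμ0 _).le
    have h0 : (0 : ℝ) ∈ Ioo (-a) a := ⟨by linarith, hapos⟩
    have hle := (convex_Ioo (-a) a).norm_image_sub_le_of_norm_hasDerivWithin_le
      (fun t ht => (hd t ht).hasDerivWithinAt) hb h0 ht
    have hb0 : β 0 = 0 := by simp [hβ, hα0]
    simp only [hb0, hJ0, sub_zero, one_mul, Real.norm_eq_abs] at hle
    have hlt : |J (β t)| < J σ := by
      rw [hJσ]; exact hle.trans_lt (abs_lt.2 ht)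
    rw [abs_lt] at hlt ⊢
    rw [← hJneg] at hlt
    exact ⟨hJmono.lt_iff_lt.1 hlt.1, hJmono.lt_iff_lt.1 hlt.2⟩
  -- On a trajectory `dX/dt = H · i H⁻¹ = i`, so `X` moves vertically with speed 1.
  have hXα : ∀ s : ℝ, ∀ t ∈ Ioo (-a) a, X (α (φ₀ s) t) = s + t * Complex.I := by
    intro s t ht
    have hd : ∀ t ∈ Ioo (-a) a, HasDerivAt (fun t : ℝ => X (α (φ₀ s) t) - t * Complex.I) 0 t := by
      intro t ht
      have h1 := (him s t ht).le
      have hne : H (α (φ₀ s) t) ≠ 0 := by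
        rw [← norm_pos_iff]
        refine lt_of_lt_of_le ?_ (hmH _ h1)
        exact hm0 _ ⟨abs_nonneg _, h1⟩
      have h2 := (hX _ h1).comp t (hα (φ₀ s) t ht)
      have h3 := h2.sub ((Complex.ofRealCLM.hasDerivAt (x := t)).mul_const Complex.I)
      refine h3.congr_deriv ?_
      simp only [hv, clampIm_eq h1, Complex.ofRealCLM_apply, Complex.ofReal_one]
      field_simp
      ring
    have h0 : (0 : ℝ) ∈ Ioo (-a) a := ⟨by linarith, hapos⟩
    have hle := (convex_Ioo (-a) a).norm_image_sub_le_of_norm_hasDerivWithin_le (C := 0)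
      (fun t ht => (hd t ht).hasDerivWithinAt) (by simp) h0 ht
    simp only [hα0, hφX, zero_mul, norm_le_zero_iff, Complex.ofReal_zero, sub_zero] at hle
    linear_combination hle
  refine ⟨fun z => α (φ₀ z.re) z.im, fun s => by simp [hα0], fun z hz => ?_⟩
  have hz' : ∀ z ∈ strip a, z.im ∈ Ioo (-a) a := fun z hz => abs_lt.1 hz
  have hright : ∀ z ∈ strip a, X (α (φ₀ z.re) z.im) = z := fun z hz => by
    rw [hXα _ _ (hz' z hz)]; simp
  have hz1 := him z.re z.im (hz' z hz)
  refine ⟨hz1, hright z hz, ?_⟩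
  have hopen : IsOpen (strip a) := by
    have : Continuous fun z : ℂ => |z.im| := by fun_prop
    exact this.isOpen_preimage _ isOpen_Iio
  have hne : H (α (φ₀ z.re) z.im) ≠ 0 := by
    rw [← norm_pos_iff]
    exact lt_of_lt_of_le (hm0 _ ⟨abs_nonneg _, hz1.le⟩) (hmH _ hz1.le)
  -- Continuity of the inverse suffices for its differentiability, so the flow need not be
  -- differentiated in the initial point.
  refine HasDerivAt.of_local_left_inverse ?_ (hX _ hz1.le) hne
    (eventually_of_mem (hopen.mem_nhds hz) hright)
  -- continuity
  have hc1 : ContinuousAt (fun w : ℂ => α (φ₀ z.re) w.im) z :=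
    ContinuousAt.comp (f := fun w : ℂ => w.im) (hα (φ₀ z.re) z.im (hz' z hz)).continuousAt
      Complex.continuous_im.continuousAt
  rw [ContinuousAt, tendsto_iff_dist_tendsto_zero]
  have hbd : ∀ᶠ w in 𝓝 z, dist (α (φ₀ w.re) w.im) (α (φ₀ z.re) z.im) ≤
      dist (φ₀ w.re) (φ₀ z.re) * Real.exp (L * |w.im|) +
        dist (α (φ₀ z.re) w.im) (α (φ₀ z.re) z.im) := by
    filter_upwards [hopen.mem_nhds hz] with w hw
    refine (dist_triangle _ (α (φ₀ z.re) w.im) _).trans (add_le_add ?_ le_rfl)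
    have := dist_integralCurve_le hvL (hα (φ₀ w.re)) (hα (φ₀ z.re)) (hz' w hw)
    simpa [hα0, Complex.dist_of_im_eq] using this
  refine squeeze_zero' (Eventually.of_forall fun _ => dist_nonneg) hbd ?_
  have h1 : Tendsto (fun w : ℂ => dist (φ₀ w.re) (φ₀ z.re) * Real.exp (L * |w.im|)) (𝓝 z)
      (𝓝 (dist (φ₀ z.re) (φ₀ z.re) * Real.exp (L * |z.im|))) := by
    apply Continuous.tendsto
    fun_prop
  have h2 := tendsto_iff_dist_tendsto_zero.1 hc1.tendsto
  simpa using h1.add h2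

end PerturbedCircle

/-! ### Extension widths, and why their supremum is the singularity distance. -/

namespace PerturbedCircle

theorem isOpen_strip (a : ℝ) : IsOpen (strip a) := by
  have : Continuous fun z : ℂ => |z.im| := by fun_prop
  exact this.isOpen_preimage _ isOpen_Iio

theorem convex_strip (a : ℝ) : Convex ℝ (strip a) := by
  have h : strip a = {z : ℂ | -a < z.im} ∩ {z : ℂ | z.im < a} := by
    ext z; simp [strip, abs_lt]
  rw [h]
  exact (convex_halfSpace_im_gt _).inter (convex_halfSpace_im_lt _)

theorem strip_mono {a b : ℝ} (h : a ≤ b) : strip a ⊆ strip b := fun _ hz => lt_of_lt_of_le hz h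

theorem ofReal_mem_strip {a : ℝ} (h : 0 < a) (x : ℝ) : (x : ℂ) ∈ strip a := by
  simpa [strip] using h

/-- Two functions that agree at the real points near `x` agree at points arbitrarily close to `x`. -/
theorem frequently_eq_of_real {F G : ℂ → ℂ} {x : ℝ} (h : ∀ᶠ y : ℝ in 𝓝 x, F y = G y) :
    ∃ᶠ z in 𝓝[≠] (x : ℂ), F z = G z := by
  have ht : Tendsto (fun y : ℝ => (y : ℂ)) (𝓝[≠] x) (𝓝[≠] (x : ℂ)) := by
    refine tendsto_nhdsWithin_of_tendsto_nhds_of_eventually_within _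
      (Complex.continuous_ofReal.continuousAt.tendsto.mono_left nhdsWithin_le_nhds) ?_
    filter_upwards [self_mem_nhdsWithin] with y hy
    simpa using hy
  exact ht.frequently (h.filter_mono nhdsWithin_le_nhds).frequently

theorem IsNonvanishingExtension.mono {k : ℝ → ℝ} {a b : ℝ} {F : ℂ → ℂ}
    (hF : IsNonvanishingExtension k b F) (h : a ≤ b) : IsNonvanishingExtension k a F :=
  ⟨hF.differentiableOn.mono (strip_mono h), fun z hz => hF.ne_zero z (strip_mono h hz),
    hF.eq_on_real⟩

/-- The identity theorem on the connected strip, started from the real axis; for `a ≤ 0` the strip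
is empty. -/
theorem IsNonvanishingExtension.eqOn {k : ℝ → ℝ} {a : ℝ} {F G : ℂ → ℂ}
    (hF : IsNonvanishingExtension k a F) (hG : IsNonvanishingExtension k a G) :
    Set.EqOn F G (strip a) := by
  rcases le_or_gt a 0 with ha | ha
  · intro z hz
    exact absurd (lt_of_lt_of_le (lt_of_le_of_lt (abs_nonneg z.im) hz) ha) (lt_irrefl _)
  refine AnalyticOnNhd.eqOn_of_preconnected_of_frequently_eq
    (hF.differentiableOn.analyticOnNhd (isOpen_strip a))
    (hG.differentiableOn.analyticOnNhd (isOpen_strip a))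
    (convex_strip a).isPreconnected (ofReal_mem_strip ha 0) ?_
  exact frequently_eq_of_real (Eventually.of_forall fun y => by
    rw [hF.eq_on_real, hG.eq_on_real])

/-- The half-widths of the strips to which `k` extends as a nonvanishing analytic function. -/
def extensionWidths (k : ℝ → ℝ) : Set ℝ :=
  {a | 0 < a ∧ ∃ F : ℂ → ℂ, IsNonvanishingExtension k a F}

theorem extensionWidths_subset_comp (k : ℝ → ℝ) {e : ℝ} (he : e = 1 ∨ e = -1) (c : ℝ) :
    extensionWidths k ⊆ extensionWidths (fun x => k (e * x + c)) := by
  rintro a ⟨ha, F, hF⟩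
  have hmaps : Set.MapsTo (fun z : ℂ => (e : ℂ) * z + c) (strip a) (strip a) := by
    intro z hz
    rcases he with rfl | rfl <;> simpa [strip] using hz
  refine ⟨ha, fun z => F (e * z + c), ?_, fun z hz => hF.ne_zero _ (hmaps hz), fun x => ?_⟩
  · exact hF.differentiableOn.comp (by fun_prop) hmaps
  · have := hF.eq_on_real (e * x + c)
    push_cast at this
    exact this

/-- The widths do not change under translations and reflections of the real line. -/
theorem extensionWidths_comp (k : ℝ → ℝ) {e : ℝ} (he : e = 1 ∨ e = -1) (c : ℝ) :
    extensionWidths (fun x => k (e * x + c)) = extensionWidths k := by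
  refine Set.Subset.antisymm ?_ (extensionWidths_subset_comp k he c)
  -- As `e² = 1`, the map `x ↦ e x - e c` is the inverse of `x ↦ e x + c`.
  have h := extensionWidths_subset_comp (fun x => k (e * x + c)) he (-e * c)
  have h2 : (fun x => (fun x => k (e * x + c)) (e * x + -e * c)) = k := by
    funext x
    rcases he with rfl | rfl <;> · simp only []; congr 1; ring
  rwa [h2] at h

/-- The continuation of `k` to the union of the strips to which it extends. -/
theorem exists_maximal_extension {k : ℝ → ℝ} (hne : (extensionWidths k).Nonempty)
    (hbdd : BddAbove (extensionWidths k)) :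
    ∃ F, IsNonvanishingExtension k (sSup (extensionWidths k)) F := by
  classical
  set δ := sSup (extensionWidths k) with hδ
  have hex : ∀ z ∈ strip δ, ∃ a F, z ∈ strip a ∧ IsNonvanishingExtension k a F := by
    intro z hz
    obtain ⟨a, ⟨-, F, hF⟩, hlt⟩ := exists_lt_of_lt_csSup hne hz
    exact ⟨a, F, hlt, hF⟩
  choose! a F hza hF using hex
  have hδ0 : 0 < δ := by
    obtain ⟨b, hb⟩ := hne
    exact hb.1.trans_le (le_csSup hbdd hb)
  -- Two chosen extensions agree on the smaller of their strips; hence the diagonal choice `z ↦ F z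
  -- z` coincides near each point with a single extension.
  have hloc : ∀ z ∈ strip δ, ∀ w ∈ strip δ, w ∈ strip (a z) → F w w = F z w := by
    intro z hz w hw hwz
    exact ((hF w hw).mono (min_le_left (a w) (a z))).eqOn ((hF z hz).mono (min_le_right _ _))
      (show |w.im| < min (a w) (a z) from lt_min (hza w hw) hwz)
  refine ⟨fun z => F z z, fun z hz => ?_, fun z hz => (hF z hz).ne_zero _ (hza z hz),
    fun x => (hF x (ofReal_mem_strip hδ0 x)).eq_on_real x⟩
  have hd := (hF z hz).differentiableOn.differentiableAt ((isOpen_strip (a z)).mem_nhds (hza z hz))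
  refine (hd.congr_of_eventuallyEq ?_).differentiableWithinAt
  filter_upwards [(isOpen_strip δ).mem_nhds hz, (isOpen_strip (a z)).mem_nhds (hza z hz)]
    with w h1 h2
  exact hloc z hz w h1 h2

open Metric in
/-- If `F` continues across every boundary point of the strip, the continuations live on balls of a
uniform radius. -/
theorem exists_uniform_continuation {k : ℝ → ℝ} (hper : ∀ x, k (x + 1) = k x) {δ : ℝ}
    {F : ℂ → ℂ} (hF : IsNonvanishingExtension k δ F)
    (hns : ∀ z : ℂ, |z.im| = δ → ¬ IsSingularityOrZero F δ z) :
    ∃ ρ > 0, ∀ z : ℂ, |z.im| = δ → ∃ G : ℂ → ℂ, DifferentiableOn ℂ G (ball z ρ) ∧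
      (∀ w ∈ ball z ρ, G w ≠ 0) ∧ ∀ w ∈ ball z ρ, w ∈ strip δ → F w = G w := by
  -- A translate of `F` by an integer extends the same function, so uniqueness makes `F` periodic.
  have hFper : ∀ (m : ℤ), ∀ w ∈ strip δ, F (w - m) = F w := by
    intro m
    have hk : ∀ x, k (x - m) = k x := fun x => by
      have : Function.Periodic k 1 := hper
      simpa using this.sub_int_mul_eq (x := x) m
    have hmaps : Set.MapsTo (fun z : ℂ => z - m) (strip δ) (strip δ) := by
      intro z hz; simpa [strip] using hz
    have : IsNonvanishingExtension k δ (fun z => F (z - m)) :=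
      ⟨hF.differentiableOn.comp (by fun_prop) hmaps, fun z hz => hF.ne_zero _ (hmaps hz),
        fun x => by
          have := hF.eq_on_real (x - m)
          rw [hk] at this
          push_cast at this
          exact this⟩
    exact this.eqOn hF
  have hloc : ∀ z : ℂ, |z.im| = δ → ∃ r > 0, ∃ G : ℂ → ℂ, DifferentiableOn ℂ G (ball z r) ∧
      (∀ w ∈ ball z r, G w ≠ 0) ∧ ∀ w ∈ ball z r, w ∈ strip δ → F w = G w := by
    intro z hz
    obtain ⟨G, hG1, hG2, hG3⟩ := not_not.1 (hns z hz)
    have h1 := hG1.eventually_analyticAt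
    have h2 := hG1.continuousAt.eventually_ne hG2
    have h3 := eventually_nhdsWithin_iff.1 hG3
    obtain ⟨r, hr, h⟩ := eventually_nhds_iff_ball.1 (h1.and (h2.and h3))
    exact ⟨r, hr, G, fun w hw => (h w hw).1.differentiableAt.differentiableWithinAt,
      fun w hw => (h w hw).2.1, fun w hw => (h w hw).2.2⟩
  choose! r hr G hG1 hG2 hG3 using hloc
  -- By periodicity it is enough to treat one period of the two boundary lines, which is compact;
  -- `ρ` is a Lebesgue number of the cover by balls of continuation.
  set S : Set ℂ := Set.Icc (0 : ℝ) 1 ×ℂ {y | |y| = δ} with hS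
  have hScomp : IsCompact S := by
    refine isCompact_Icc.reProdIm (isCompact_of_isClosed_isBounded
      (isClosed_eq continuous_abs continuous_const) ?_)
    refine (Metric.isBounded_closedBall (x := (0 : ℝ)) (r := δ)).subset fun y hy => ?_
    simpa using (le_of_eq hy)
  obtain ⟨ρ, hρ, hcov⟩ := lebesgue_number_lemma_of_metric (ι := S) (c := fun z => ball (z : ℂ) (r z))
    hScomp (fun _ => isOpen_ball) (fun z hz => Set.mem_iUnion.2 ⟨⟨z, hz⟩, mem_ball_self (hr z hz.2)⟩)
  refine ⟨ρ, hρ, fun z hz => ?_⟩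
  have hz' : z - ⌊z.re⌋ ∈ S := by
    refine ⟨?_, by simpa using hz⟩
    simp only [Set.mem_preimage, Complex.sub_re, Complex.intCast_re]
    exact ⟨by linarith [Int.floor_le z.re], by linarith [Int.lt_floor_add_one z.re]⟩
  obtain ⟨⟨z₁, hz₁⟩, hsub⟩ := hcov _ hz'
  have hmaps : Set.MapsTo (fun w : ℂ => w - ⌊z.re⌋) (ball z ρ) (ball z₁ (r z₁)) := by
    intro w hw
    apply hsub
    simpa using hw
  refine ⟨fun w => G z₁ (w - ⌊z.re⌋), (hG1 z₁ hz₁.2).comp (by fun_prop) hmaps,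
    fun w hw => hG2 z₁ hz₁.2 _ (hmaps hw), fun w hw hws => ?_⟩
  rw [← hFper ⌊z.re⌋ w hws]
  exact hG3 z₁ hz₁.2 _ (hmaps hw) (by simpa [strip] using hws)

open Metric in
/-- A nonvanishing extension that continues across every boundary point of its strip extends to a
larger strip. -/
theorem exists_larger_extension {k : ℝ → ℝ} (hper : ∀ x, k (x + 1) = k x) {δ : ℝ} (hδ : 0 < δ)
    {F : ℂ → ℂ} (hF : IsNonvanishingExtension k δ F)
    (hns : ∀ z : ℂ, |z.im| = δ → ¬ IsSingularityOrZero F δ z) :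
    ∃ b > δ, ∃ F', IsNonvanishingExtension k b F' := by
  classical
  obtain ⟨ρ₀, hρ₀, hG₀⟩ := exists_uniform_continuation hper hF hns
  -- With `ρ ≤ δ`, a boundary point moved inwards by `ρ / 2` remains on its side of the real axis.
  set ρ := min ρ₀ δ with hρdef
  have hρ : 0 < ρ := lt_min hρ₀ hδ
  have hG : ∀ z : ℂ, |z.im| = δ → ∃ G : ℂ → ℂ, DifferentiableOn ℂ G (ball z ρ) ∧
      (∀ w ∈ ball z ρ, G w ≠ 0) ∧ ∀ w ∈ ball z ρ, w ∈ strip δ → F w = G w := by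
    intro z hz
    obtain ⟨G, h1, h2, h3⟩ := hG₀ z hz
    have hs : ball z ρ ⊆ ball z ρ₀ := ball_subset_ball (min_le_left _ _)
    exact ⟨G, h1.mono hs, fun w hw => h2 w (hs hw), fun w hw => h3 w (hs hw)⟩
  choose! G hG1 hG2 hG3 using hG
  set pr : ℂ → ℂ := fun w => ⟨w.re, if 0 ≤ w.im then δ else -δ⟩ with hpr
  have hprim : ∀ w, |(pr w).im| = δ := by
    intro w
    simp only [hpr]
    split_ifs <;> simp [abs_of_pos hδ]
  have hprball : ∀ w : ℂ, δ ≤ |w.im| → |w.im| < δ + ρ → w ∈ ball (pr w) ρ := by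
    intro w h1 h2
    rw [mem_ball, Complex.dist_of_re_eq (show w.re = (pr w).re from rfl), Real.dist_eq]
    simp only [hpr]
    split_ifs with h
    · rw [abs_of_nonneg h] at h1 h2
      rw [abs_of_nonneg (by linarith)]; linarith
    · push Not at h
      rw [abs_of_neg h] at h1 h2
      rw [abs_of_nonpos (by linarith)]; linarith
  have hloc : ∀ w₀ : ℂ, δ ≤ |w₀.im| → |w₀.im| < δ + ρ →
      ∀ᶠ w in 𝓝 w₀, (if |w.im| < δ then F w else G (pr w) w) = G (pr w₀) w := by
    intro w₀ h1 h2
    have hcont : ContinuousAt (fun w : ℂ => w.im) w₀ := Complex.continuous_im.continuousAt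
    have hsign : ∀ᶠ w in 𝓝 w₀, (pr w).im = (pr w₀).im := by
      rcases lt_or_ge w₀.im 0 with h | h
      · filter_upwards [hcont.eventually_lt_const h] with w hw
        simp [hpr, not_le.2 h, not_le.2 hw]
      · have h' : 0 < w₀.im := by rw [abs_of_nonneg h] at h1; linarith
        filter_upwards [hcont.eventually_const_lt h'] with w hw
        simp [hpr, h, hw.le]
    have hre : ∀ᶠ w in 𝓝 w₀, |w.re - w₀.re| < ρ / 2 := by
      have : ContinuousAt (fun w : ℂ => |w.re - w₀.re|) w₀ := by fun_prop
      exact this.eventually_lt_const (by simpa using half_pos hρ)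
    have habs : ∀ᶠ w in 𝓝 w₀, |w.im| < δ + ρ := by
      have : ContinuousAt (fun w : ℂ => |w.im|) w₀ := by fun_prop
      exact this.eventually_lt_const h2
    filter_upwards [hsign, hre, habs, isOpen_ball.mem_nhds (hprball w₀ h1 h2)]
      with w hs hr ha hb
    split_ifs with hlt
    · exact hG3 _ (hprim w₀) w hb hlt
    · push Not at hlt
      set B := ball (pr w) ρ ∩ ball (pr w₀) ρ with hB
      -- A point inside the strip at distance `ρ / 2` from `pr w`, and so in both balls. Near it
      -- both continuations equal `F`, hence they agree on the convex intersection of the balls.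
      set w₁ : ℂ := ⟨w.re, (pr w).im * (1 - ρ / (2 * δ))⟩ with hw₁
      have hρδ : ρ ≤ δ := min_le_right _ _
      have hfac : 0 < 1 - ρ / (2 * δ) := by
        rw [sub_pos, div_lt_one (by positivity)]; linarith
      have hd1 : dist w₁ (pr w) = ρ / 2 := by
        rw [Complex.dist_of_re_eq (show w₁.re = (pr w).re from rfl), Real.dist_eq]
        have : (w₁.im - (pr w).im) = - ((pr w).im * (ρ / (2 * δ))) := by simp [hw₁]; ring
        rw [this, abs_neg, abs_mul, hprim, abs_of_pos (by positivity)]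
        field_simp
      have hd2 : dist (pr w) (pr w₀) < ρ / 2 := by
        rw [Complex.dist_of_im_eq hs, Real.dist_eq]
        exact hr
      have hw₁B : w₁ ∈ B := by
        refine ⟨?_, ?_⟩
        · rw [mem_ball, hd1]; linarith
        · rw [mem_ball]
          linarith [dist_triangle w₁ (pr w) (pr w₀)]
      have hw₁s : w₁ ∈ strip δ := by
        change |(pr w).im * (1 - ρ / (2 * δ))| < δ
        rw [abs_mul, hprim, abs_of_pos hfac]
        have : 0 < ρ / (2 * δ) := by positivity
        nlinarith
      have hev : G (pr w) =ᶠ[𝓝 w₁] G (pr w₀) := by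
        filter_upwards [(isOpen_ball.inter isOpen_ball).mem_nhds hw₁B,
          (isOpen_strip δ).mem_nhds hw₁s] with u hu hus
        rw [← hG3 _ (hprim w) u hu.1 hus, ← hG3 _ (hprim w₀) u hu.2 hus]
      have hBo : IsOpen B := isOpen_ball.inter isOpen_ball
      have heq := AnalyticOnNhd.eqOn_of_preconnected_of_eventuallyEq
        (((hG1 _ (hprim w)).mono Set.inter_subset_left).analyticOnNhd hBo)
        (((hG1 _ (hprim w₀)).mono Set.inter_subset_right).analyticOnNhd hBo)
        ((convex_ball _ _).inter (convex_ball _ _)).isPreconnected hw₁B hev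
      exact heq ⟨hprball w hlt ha, hb⟩
  refine ⟨δ + ρ, by linarith, fun w => if |w.im| < δ then F w else G (pr w) w,
    fun w hw => ?_, fun w hw => ?_, fun x => ?_⟩
  · apply DifferentiableAt.differentiableWithinAt
    rcases lt_or_ge |w.im| δ with h | h
    · refine (hF.differentiableOn.differentiableAt
        ((isOpen_strip δ).mem_nhds h)).congr_of_eventuallyEq ?_
      filter_upwards [(isOpen_strip δ).mem_nhds h] with u hu
      exact if_pos hu
    · exact ((hG1 _ (hprim w)).differentiableAt
        (isOpen_ball.mem_nhds (hprball w h hw))).congr_of_eventuallyEq (hloc w h hw)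
  · rcases lt_or_ge |w.im| δ with h | h
    · simp only [if_pos h]; exact hF.ne_zero w h
    · simp only [if_neg (not_lt.2 h)]
      exact hG2 _ (hprim w) w (hprball w h hw)
  · simp [hδ, hF.eq_on_real]

/-- A periodic function with a bounded nonempty set of extension widths has a singularity
distance, the supremum of the widths. -/
theorem isSingularityDistance_sSup {k : ℝ → ℝ} (hper : ∀ x, k (x + 1) = k x)
    (hne : (extensionWidths k).Nonempty) (hbdd : BddAbove (extensionWidths k)) :
    IsSingularityDistance k (sSup (extensionWidths k)) := by
  have hδ : 0 < sSup (extensionWidths k) := by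
    obtain ⟨b, hb⟩ := hne
    exact hb.1.trans_le (le_csSup hbdd hb)
  obtain ⟨F, hF⟩ := exists_maximal_extension hne hbdd
  refine ⟨hδ, F, hF, ?_⟩
  by_contra! hns
  obtain ⟨b, hb, F', hF'⟩ := exists_larger_extension hper hδ hF hns
  exact absurd (le_csSup hbdd ⟨hδ.trans hb, F', hF'⟩) (not_le.2 hb)

end PerturbedCircle

/-! ### Real inverses, lifted angles, and the polynomials of the curve. -/

namespace PerturbedCircle

/-- A real function with derivative bounded below by a positive constant is a diffeomorphism of
the line. -/
theorem exists_inverse_of_hasDerivAt {F f : ℝ → ℝ} (hF : ∀ x, HasDerivAt F (f x) x) {c : ℝ}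
    (hc : 0 < c) (hf : ∀ x, c ≤ f x) :
    StrictMono F ∧ ∃ g : ℝ → ℝ, (∀ x, g (F x) = x) ∧ (∀ y, F (g y) = y) ∧
      ∀ y, HasDerivAt g (f (g y))⁻¹ y := by
  have hmono : StrictMono F := strictMono_of_deriv_pos fun x => by
    rw [(hF x).deriv]; exact hc.trans_le (hf x)
  have hcont : Continuous F := continuous_iff_continuousAt.2 fun x => (hF x).continuousAt
  have hmono2 : Monotone fun x => F x - c * x := by
    refine monotone_of_hasDerivAt_nonneg (f' := fun x => f x - c) (fun x => ?_) (fun x => ?_)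
    · exact ((hF x).sub ((hasDerivAt_id x).const_mul c)).congr_deriv (by simp)
    · simpa using hf x
  have hlin : Tendsto (fun x : ℝ => F 0 + c * x) atTop atTop :=
    tendsto_atTop_add_const_left _ _ (tendsto_id.const_mul_atTop hc)
  have hlin' : Tendsto (fun x : ℝ => F 0 + c * x) atBot atBot :=
    tendsto_atBot_add_const_left _ _ (tendsto_id.const_mul_atBot hc)
  have hsurj : Function.Surjective F := by
    refine hcont.surjective (tendsto_atTop_mono' _ ?_ hlin) (tendsto_atBot_mono' _ ?_ hlin')
    · filter_upwards [eventually_ge_atTop 0] with x hx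
      have := hmono2 hx
      simp only [mul_zero, sub_zero] at this
      linarith
    · filter_upwards [eventually_le_atBot 0] with x hx
      have := hmono2 hx
      simp only [mul_zero, sub_zero] at this
      linarith
  let e := hmono.orderIsoOfSurjective F hsurj
  have h1 : ∀ y, F (e.symm y) = y := fun y => e.apply_symm_apply y
  refine ⟨hmono, e.symm, fun x => e.symm_apply_apply x, h1, fun y => ?_⟩
  exact HasDerivAt.of_local_left_inverse e.symm.continuous.continuousAt (hF _)
    (hc.trans_le (hf _)).ne' (Eventually.of_forall h1)

theorem exists_angle {x y : ℝ} (h : x ^ 2 + y ^ 2 = 1) :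
    ∃ θ : ℝ, x = Real.cos θ ∧ y = Real.sin θ := by
  have hn : ‖(⟨x, y⟩ : ℂ)‖ = 1 := by
    rw [Complex.norm_def, Complex.normSq_mk, ← sq, ← sq, h, Real.sqrt_one]
  have hne : (⟨x, y⟩ : ℂ) ≠ 0 := by
    intro h0; rw [h0] at hn; simp at hn
  refine ⟨Complex.arg ⟨x, y⟩, ?_, ?_⟩
  · rw [Complex.cos_arg hne, hn]; simp
  · rw [Complex.sin_arg, hn]; simp

/-- A `C¹` map to the unit circle lifts to a `C¹` angle. -/
theorem exists_angle_lift {u v u' v' : ℝ → ℝ} (hu : ∀ s, HasDerivAt u (u' s) s)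
    (hv : ∀ s, HasDerivAt v (v' s) s) (hu' : Continuous u') (hv' : Continuous v')
    (h : ∀ s, u s ^ 2 + v s ^ 2 = 1) :
    ∃ θ : ℝ → ℝ, (∀ s, HasDerivAt θ (u s * v' s - v s * u' s) s) ∧
      (∀ s, u s = Real.cos (θ s)) ∧ ∀ s, v s = Real.sin (θ s) := by
  have huc : Continuous u := continuous_iff_continuousAt.2 fun s => (hu s).continuousAt
  have hvc : Continuous v := continuous_iff_continuousAt.2 fun s => (hv s).continuousAt
  obtain ⟨θ₀, hθu, hθv⟩ := exists_angle (h 0)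
  -- The angular velocity of a point on the unit circle.
  set f : ℝ → ℝ := fun s => u s * v' s - v s * u' s with hf
  have hfc : Continuous f := by fun_prop
  set θ : ℝ → ℝ := fun s => θ₀ + ∫ t in (0 : ℝ)..s, f t with hθ
  have hθd : ∀ s, HasDerivAt θ (f s) s := fun s =>
    (intervalIntegral.integral_hasDerivAt_right (hfc.intervalIntegrable _ _)
      (hfc.stronglyMeasurableAtFilter _ _) hfc.continuousAt).const_add _
  have hort : ∀ s, u s * u' s + v s * v' s = 0 := by
    intro s
    have h1 := ((hu s).pow 2).add ((hv s).pow 2)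
    have h2 : HasDerivAt (u ^ 2 + v ^ 2) 0 s := by
      have : u ^ 2 + v ^ 2 = fun _ => 1 := by funext t; exact h t
      rw [this]; exact hasDerivAt_const _ _
    have := h1.unique h2
    norm_num at this
    linarith
  have hθ0 : θ 0 = θ₀ := by simp [hθ]
  -- the products with the rotated frame are constant
  have hA : ∀ s, HasDerivAt (fun s => u s * Real.cos (θ s) + v s * Real.sin (θ s)) 0 s := by
    intro s
    have := ((hu s).mul ((hθd s).cos)).add ((hv s).mul ((hθd s).sin))
    refine this.congr_deriv ?_
    simp only [hf]
    linear_combination (Real.cos (θ s) * u s + Real.sin (θ s) * v s) * hort s -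
      (Real.cos (θ s) * u' s + Real.sin (θ s) * v' s) * h s
  have hB : ∀ s, HasDerivAt (fun s => v s * Real.cos (θ s) - u s * Real.sin (θ s)) 0 s := by
    intro s
    have := ((hv s).mul ((hθd s).cos)).sub ((hu s).mul ((hθd s).sin))
    refine this.congr_deriv ?_
    simp only [hf]
    linear_combination (Real.cos (θ s) * v s - Real.sin (θ s) * u s) * hort s -
      (Real.cos (θ s) * v' s - Real.sin (θ s) * u' s) * (h s)
  have hA1 : ∀ s, u s * Real.cos (θ s) + v s * Real.sin (θ s) = 1 := by
    intro s
    have := is_const_of_deriv_eq_zero (fun t => (hA t).differentiableAt)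
      (fun t => (hA t).deriv) s 0
    rw [this, hθ0, ← hθu, ← hθv]
    linarith [h 0]
  have hB0 : ∀ s, v s * Real.cos (θ s) - u s * Real.sin (θ s) = 0 := by
    intro s
    have := is_const_of_deriv_eq_zero (fun t => (hB t).differentiableAt)
      (fun t => (hB t).deriv) s 0
    rw [this, hθ0, ← hθu, ← hθv]
    ring
  refine ⟨θ, hθd, fun s => ?_, fun s => ?_⟩
  · linear_combination Real.cos (θ s) * hA1 s - Real.sin (θ s) * hB0 s -
      u s * Real.sin_sq_add_cos_sq (θ s)
  · linear_combination Real.sin (θ s) * hA1 s + Real.cos (θ s) * hB0 s -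
      v s * Real.sin_sq_add_cos_sq (θ s)

section Algebra

variable {𝕜 : Type*} [Field 𝕜]

/-- On the curve, `curveP` and `curveR` express the curvature as `curveP / curveR ^ (3 / 2)`. -/
def curveP (n : ℕ) (ε y : 𝕜) : 𝕜 :=
  1 + n * (n - 1) / 2 * ε * y ^ (n - 2) - (n - 1) * (n - 2) / 2 * ε * y ^ n -
    n * (n - 2) / 4 * ε ^ 2 * y ^ (2 * n - 2)

/-- A quarter of the squared norm of the gradient of the equation, on the curve. -/
def curveR (n : ℕ) (ε y : 𝕜) : 𝕜 :=
  1 + (n - 1) * ε * y ^ n + n ^ 2 / 4 * ε ^ 2 * y ^ (2 * n - 2)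

/-- The quotient of `1 - y² - ε yⁿ` by `(a - y) (y - c)`, for roots `a ≠ c`. -/
def curveQ (n : ℕ) (ε a c y : 𝕜) : 𝕜 :=
  1 + ε * ∑ i ∈ Finset.range n, a ^ (n - 1 - i) * ∑ j ∈ Finset.range i, y ^ j * c ^ (i - 1 - j)

/-- Half of the `y`-derivative of the equation of the curve. -/
def curveE (n : ℕ) (ε y : 𝕜) : 𝕜 := y + n / 2 * ε * y ^ (n - 1)

/-- Division twice by geometric sums: `B` is the cofactor of `y - a` in `y² + ε yⁿ - 1`, it vanishes
at `c` because `c ≠ a`, and its difference quotient at `c` is `Q`. The identity is polynomial. -/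
theorem curveQ_factor {n : ℕ} {ε a c : 𝕜} (ha : a ^ 2 + ε * a ^ n = 1)
    (hc : c ^ 2 + ε * c ^ n = 1) (hac : a ≠ c) (y : 𝕜) :
    1 - y ^ 2 - ε * y ^ n = (a - y) * (y - c) * curveQ n ε a c y := by
  set B : 𝕜 → 𝕜 := fun y => y + a + ε * ∑ i ∈ Finset.range n, y ^ i * a ^ (n - 1 - i) with hB
  have h1 : ∀ y, (y - a) * B y = y ^ 2 + ε * y ^ n - 1 := by
    intro y
    have := (Commute.all y a).mul_geom_sum₂ n
    simp only [hB]
    linear_combination ε * this - ha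
  have hBc : B c = 0 := by
    have := h1 c
    rw [hc, sub_self] at this
    exact (mul_eq_zero.1 this).resolve_left (sub_ne_zero.2 hac.symm)
  have h2 : B y - B c = (y - c) * curveQ n ε a c y := by
    simp only [hB, curveQ]
    have : ∑ i ∈ Finset.range n, y ^ i * a ^ (n - 1 - i) -
        ∑ i ∈ Finset.range n, c ^ i * a ^ (n - 1 - i) =
        (y - c) * ∑ i ∈ Finset.range n, a ^ (n - 1 - i) *
          ∑ j ∈ Finset.range i, y ^ j * c ^ (i - 1 - j) := by
      rw [← Finset.sum_sub_distrib, Finset.mul_sum]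
      refine Finset.sum_congr rfl fun i _ => ?_
      have := (Commute.all y c).mul_geom_sum₂ i
      linear_combination (-a ^ (n - 1 - i)) * this
    linear_combination ε * this
  linear_combination h1 y + (a - y) * h2 + (a - y) * hBc

/-- On the curve the bracket is `x²`, and `(2x, 2E)` is the gradient, so the right side is a quarter
of its squared length. Eliminating `x` leaves a polynomial in `y` that can be continued
analytically. -/
theorem curveR_eq [CharZero 𝕜] {n : ℕ} (hn : 3 ≤ n) (ε y : 𝕜) :
    curveR n ε y = (1 - y ^ 2 - ε * y ^ n) + curveE n ε y ^ 2 := by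
  obtain ⟨k, rfl⟩ := Nat.exists_eq_add_of_le hn
  have e1 : 3 + k - 1 = k + 2 := by omega
  have e2 : 2 * (3 + k) - 2 = 2 * k + 4 := by omega
  simp only [curveR, curveE, e1, e2]
  push_cast
  field_simp
  ring

/-- With `x²` for the bracket this is `x² E' + E²`, the numerator in the curvature formula for a
level curve, where `E'` is the derivative of `E` in `y`. -/
theorem curveP_eq [CharZero 𝕜] {n : ℕ} (hn : 3 ≤ n) (ε y : 𝕜) :
    curveP n ε y = (1 - y ^ 2 - ε * y ^ n) * (1 + n * (n - 1) / 2 * ε * y ^ (n - 2)) +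
      curveE n ε y ^ 2 := by
  obtain ⟨k, rfl⟩ := Nat.exists_eq_add_of_le hn
  have e1 : 3 + k - 1 = k + 2 := by omega
  have e2 : 2 * (3 + k) - 2 = 2 * k + 4 := by omega
  have e3 : 3 + k - 2 = k + 1 := by omega
  simp only [curveP, curveE, e1, e2, e3]
  push_cast
  field_simp
  ring

end Algebra

end PerturbedCircle

/-! ### The parametrization by `θ`, its tangent and its curvature. -/

namespace PerturbedCircle

theorem hasDerivAt_vec {u v : ℝ → ℝ} {u' v' s : ℝ} (hu : HasDerivAt u u' s)
    (hv : HasDerivAt v v' s) :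
    HasDerivAt (fun t => (!₂[u t, v t] : Plane)) !₂[u', v'] s := by
  have h : HasDerivAt (fun t => ![u t, v t]) ![u', v'] s := by
    rw [hasDerivAt_pi]
    intro i
    fin_cases i
    · exact hu
    · exact hv
  exact ((PiLp.continuousLinearEquiv 2 ℝ (fun _ : Fin 2 => ℝ)).symm.hasFDerivAt).comp_hasDerivAt s h

theorem norm_vec (u v : ℝ) : ‖(!₂[u, v] : Plane)‖ = Real.sqrt (u ^ 2 + v ^ 2) := by
  simp [EuclideanSpace.norm_eq, Fin.sum_univ_two]

/-- The parameter `ε` is so small that the curve, with vertices at the heights `c < a`, is regular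
and strictly convex. -/
structure RegularCurve (n : ℕ) (ε a c : ℝ) : Prop where
  three_le : 3 ≤ n
  pos : 0 < ε
  root_a : a ^ 2 + ε * a ^ n = 1
  root_c : c ^ 2 + ε * c ^ n = 1
  a_mem : a ∈ Set.Icc (1 / 2 : ℝ) (3 / 2)
  c_mem : c ∈ Set.Icc (-(3 / 2) : ℝ) (-(1 / 2))
  P_pos : ∀ y : ℝ, |y| ≤ 2 → 0 < curveP n ε y
  R_pos : ∀ y : ℝ, |y| ≤ 2 → 0 < curveR n ε y
  Q_pos : ∀ y : ℝ, |y| ≤ 2 → 0 < curveQ n ε a c y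
  outside : ∀ y : ℝ, 3 / 2 < |y| → |y| ≤ 2 → 1 - y ^ 2 - ε * y ^ n < 0

/-- The height of the point of the curve with parameter `θ`. -/
def height (a c θ : ℝ) : ℝ := (a + c) / 2 + (a - c) / 2 * Real.sin θ

/-- The abscissa of the point of the curve with parameter `θ`. -/
def absc (n : ℕ) (ε a c θ : ℝ) : ℝ :=
  (a - c) / 2 * Real.cos θ * Real.sqrt (curveQ n ε a c (height a c θ))

/-- The parametrization of the curve by the angle `θ`. -/
def curvePt (n : ℕ) (ε a c θ : ℝ) : Plane := !₂[absc n ε a c θ, height a c θ]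

/-- The speed of `curvePt`. -/
def speed (n : ℕ) (ε a c θ : ℝ) : ℝ :=
  Real.sqrt (curveR n ε (height a c θ)) / Real.sqrt (curveQ n ε a c (height a c θ))

/-- The unit tangent vector of `curvePt`. -/
def tangent (n : ℕ) (ε a c θ : ℝ) : Plane :=
  !₂[-curveE n ε (height a c θ) / Real.sqrt (curveR n ε (height a c θ)),
    absc n ε a c θ / Real.sqrt (curveR n ε (height a c θ))]

/-- The curvature at the parameter `θ`. -/
def curv (n : ℕ) (ε a c θ : ℝ) : ℝ :=
  curveP n ε (height a c θ) / Real.sqrt (curveR n ε (height a c θ)) ^ 3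

namespace RegularCurve

variable {n : ℕ} {ε a c : ℝ}

theorem ne (h : RegularCurve n ε a c) : a ≠ c := by
  intro hac
  have h1 := h.a_mem.1
  have h2 := h.c_mem.2
  rw [hac] at h1
  linarith

theorem abs_height_le (h : RegularCurve n ε a c) (θ : ℝ) : |height a c θ| ≤ 3 / 2 := by
  have h1 := h.a_mem
  have h2 := h.c_mem
  have h3 := Real.sin_le_one θ
  have h4 := Real.neg_one_le_sin θ
  rw [abs_le, height]
  constructor <;> nlinarith [h1.1, h1.2, h2.1, h2.2]

theorem abs_height_le_two (h : RegularCurve n ε a c) (θ : ℝ) : |height a c θ| ≤ 2 :=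
  (h.abs_height_le θ).trans (by norm_num)

theorem hasDerivAt_height (a c θ : ℝ) :
    HasDerivAt (height a c) ((a - c) / 2 * Real.cos θ) θ :=
  ((Real.hasDerivAt_sin θ).const_mul _).const_add _

/-- Differentiating the factorization of `curveQ_factor` gives a linear relation for the derivative
of `Q`, which replaces its explicit formula. -/
theorem hasDerivAt_curveQ (h : RegularCurve n ε a c) (y : ℝ) :
    ∃ q', HasDerivAt (curveQ n ε a c) q' y ∧
      -2 * curveE n ε y = (a + c - 2 * y) * curveQ n ε a c y + (a - y) * (y - c) * q' := by
  have hd : DifferentiableAt ℝ (curveQ n ε a c) y := by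
    unfold curveQ; fun_prop
  refine ⟨_, hd.hasDerivAt, ?_⟩
  have h1 : HasDerivAt (fun y : ℝ => 1 - y ^ 2 - ε * y ^ n) (-2 * curveE n ε y) y := by
    have := (((hasDerivAt_id y).pow 2).const_sub 1).sub (((hasDerivAt_id y).pow n).const_mul ε)
    refine this.congr_deriv ?_
    simp [curveE]
    ring
  have h2 : HasDerivAt (fun y : ℝ => (a - y) * (y - c) * curveQ n ε a c y) _ y :=
    (((hasDerivAt_id y).const_sub a).mul ((hasDerivAt_id y).sub_const c)).mul hd.hasDerivAt
  have h3 : (fun y : ℝ => 1 - y ^ 2 - ε * y ^ n) =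
      fun y : ℝ => (a - y) * (y - c) * curveQ n ε a c y :=
    funext (curveQ_factor h.root_a h.root_c h.ne)
  rw [h3] at h1
  have := h1.unique h2
  simp at this
  linarith

theorem sq_absc (h : RegularCurve n ε a c) (θ : ℝ) :
    absc n ε a c θ ^ 2 = 1 - height a c θ ^ 2 - ε * height a c θ ^ n := by
  rw [curveQ_factor h.root_a h.root_c h.ne, absc, mul_pow,
    Real.sq_sqrt (h.Q_pos _ (h.abs_height_le_two θ)).le]
  simp only [height]
  linear_combination (a - c) ^ 2 / 4 * curveQ n ε a c ((a + c) / 2 + (a - c) / 2 * Real.sin θ) *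
    Real.sin_sq_add_cos_sq θ

theorem hasDerivAt_height' (h : RegularCurve n ε a c) (θ : ℝ) :
    HasDerivAt (height a c)
      (absc n ε a c θ / Real.sqrt (curveQ n ε a c (height a c θ))) θ := by
  refine (hasDerivAt_height a c θ).congr_deriv ?_
  have := (Real.sqrt_pos.2 (h.Q_pos _ (h.abs_height_le_two θ))).ne'
  rw [absc]
  field_simp

/-- Together with `hasDerivAt_height'`, the velocity is `(-E, x) / √Q`: it is orthogonal to the
gradient `(2x, 2E)`, and its length is `√(R / Q)` since `x² + E² = R`. Unlike a formula with
`dx/dy`, it is regular at the points `x = 0`. -/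
theorem hasDerivAt_absc (h : RegularCurve n ε a c) (θ : ℝ) :
    HasDerivAt (absc n ε a c)
      (-curveE n ε (height a c θ) / Real.sqrt (curveQ n ε a c (height a c θ))) θ := by
  have hQ := h.Q_pos _ (h.abs_height_le_two θ)
  obtain ⟨q', hq, hE⟩ := h.hasDerivAt_curveQ (height a c θ)
  have h1 := (hq.comp θ (hasDerivAt_height a c θ)).sqrt hQ.ne'
  have h2 := ((Real.hasDerivAt_cos θ).const_mul ((a - c) / 2)).mul h1
  refine h2.congr_deriv ?_
  have hs := (Real.sqrt_pos.2 hQ).ne'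
  have hsq := Real.sq_sqrt hQ.le
  simp only [Function.comp_apply]
  set S := Real.sqrt (curveQ n ε a c (height a c θ))
  field_simp
  rw [hsq]
  have hy : height a c θ = (a + c) / 2 + (a - c) / 2 * Real.sin θ := rfl
  rw [hy] at hE ⊢
  linear_combination (-4) * hE + (a - c) ^ 2 * q' * Real.sin_sq_add_cos_sq θ

theorem R_eq (h : RegularCurve n ε a c) (θ : ℝ) :
    curveR n ε (height a c θ) = absc n ε a c θ ^ 2 + curveE n ε (height a c θ) ^ 2 := by
  rw [curveR_eq h.three_le, h.sq_absc]

theorem speed_pos (h : RegularCurve n ε a c) (θ : ℝ) : 0 < speed n ε a c θ :=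
  div_pos (Real.sqrt_pos.2 (h.R_pos _ (h.abs_height_le_two θ)))
    (Real.sqrt_pos.2 (h.Q_pos _ (h.abs_height_le_two θ)))

theorem curv_pos (h : RegularCurve n ε a c) (θ : ℝ) : 0 < curv n ε a c θ :=
  div_pos (h.P_pos _ (h.abs_height_le_two θ))
    (pow_pos (Real.sqrt_pos.2 (h.R_pos _ (h.abs_height_le_two θ))) 3)

theorem norm_tangent (h : RegularCurve n ε a c) (θ : ℝ) : ‖tangent n ε a c θ‖ = 1 := by
  have hR := h.R_pos _ (h.abs_height_le_two θ)
  rw [tangent, norm_vec, div_pow, div_pow, Real.sq_sqrt hR.le, ← add_div, neg_sq, add_comm,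
    ← h.R_eq, div_self hR.ne', Real.sqrt_one]

theorem hasDerivAt_curvePt (h : RegularCurve n ε a c) (θ : ℝ) :
    HasDerivAt (curvePt n ε a c) (speed n ε a c θ • tangent n ε a c θ) θ := by
  refine (hasDerivAt_vec (h.hasDerivAt_absc θ) (h.hasDerivAt_height' θ)).congr_deriv ?_
  have h1 := (Real.sqrt_pos.2 (h.R_pos _ (h.abs_height_le_two θ))).ne'
  have h2 := (Real.sqrt_pos.2 (h.Q_pos _ (h.abs_height_le_two θ))).ne'
  ext i
  fin_cases i <;> simp [speed, tangent] <;> field_simp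

/-- The derivative of the unit tangent vector. -/
theorem hasDerivAt_tangent (h : RegularCurve n ε a c) (θ : ℝ) :
    HasDerivAt (tangent n ε a c) (-(speed n ε a c θ * curv n ε a c θ) •
      !₂[absc n ε a c θ / Real.sqrt (curveR n ε (height a c θ)),
        curveE n ε (height a c θ) / Real.sqrt (curveR n ε (height a c θ))]) θ := by
  have hR := h.R_pos _ (h.abs_height_le_two θ)
  have hQ := h.Q_pos _ (h.abs_height_le_two θ)
  have hx := h.hasDerivAt_absc θ
  have hE : HasDerivAt (fun θ => curveE n ε (height a c θ))
      ((1 + n * (n - 1) / 2 * ε * height a c θ ^ (n - 2)) *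
        (absc n ε a c θ / Real.sqrt (curveQ n ε a c (height a c θ)))) θ := by
    have hy := h.hasDerivAt_height' θ
    have := hy.add ((hy.pow (n - 1)).const_mul (n / 2 * ε))
    refine this.congr_deriv ?_
    have e1 : n - 1 - 1 = n - 2 := by omega
    have e2 : ((n - 1 : ℕ) : ℝ) = n - 1 := by
      rw [Nat.cast_sub (by linarith [h.three_le]), Nat.cast_one]
    rw [e1, e2]
    ring
  have hRd := (hx.pow 2).add (hE.pow 2)
  have e : absc n ε a c ^ 2 + (fun θ => curveE n ε (height a c θ)) ^ 2 =
      fun θ => curveR n ε (height a c θ) := funext fun θ => (h.R_eq θ).symm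
  rw [e] at hRd
  have hs := hRd.sqrt hR.ne'
  have h1 := (Real.sqrt_pos.2 hR).ne'
  have h2 := (Real.sqrt_pos.2 hQ).ne'
  refine (hasDerivAt_vec (hE.neg.div hs h1) (hx.div hs h1)).congr_deriv ?_
  have hP := curveP_eq h.three_le ε (height a c θ)
  rw [← h.sq_absc] at hP
  have hW : Real.sqrt (curveR n ε (height a c θ)) ^ 2 = _ := (Real.sq_sqrt hR.le).trans (h.R_eq θ)
  simp only [speed, curv]
  rw [hP]
  set W := Real.sqrt (curveR n ε (height a c θ))
  set S := Real.sqrt (curveQ n ε a c (height a c θ))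
  set x := absc n ε a c θ
  set E := curveE n ε (height a c θ)
  set e := 1 + n * (n - 1) / 2 * ε * height a c θ ^ (n - 2)
  ext i
  fin_cases i
  · simp
    field_simp
    linear_combination (-x * e) * hW
  · simp
    field_simp
    linear_combination (-E) * hW

end RegularCurve

end PerturbedCircle

/-! ### The variable `ξ`, the component of the level set, and an arc-length parameter. -/

namespace PerturbedCircle

/-- The density of `κ^{2/3} ds` with respect to the angle `θ`. -/
def density (n : ℕ) (ε a c θ : ℝ) : ℝ := speed n ε a c θ * curv n ε a c θ ^ (2 / 3 : ℝ)

/-- The integral of `density` from `0`. -/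
def densityInt (n : ℕ) (ε a c θ : ℝ) : ℝ := ∫ t in (0 : ℝ)..θ, density n ε a c t

/-- The variable `ξ` as a function of the angle `θ`. -/
def xiAngle (n : ℕ) (ε a c θ : ℝ) : ℝ :=
  densityInt n ε a c θ / densityInt n ε a c (2 * Real.pi)

/-- The curvature as a function of `ξ`, with `ξ = 0` at `θ = 0`. -/
def curvXi (n : ℕ) (ε a c ξ : ℝ) : ℝ :=
  curv n ε a c (Function.invFun (xiAngle n ε a c) ξ)

theorem exists_pos_le_of_periodic {f : ℝ → ℝ} (hf : Continuous f) {T : ℝ} (hT : 0 < T)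
    (hp : Function.Periodic f T) (h0 : ∀ x, 0 < f x) : ∃ c > 0, ∀ x, c ≤ f x := by
  obtain ⟨x, -, hx⟩ := isCompact_Icc.exists_isMinOn (Set.nonempty_Icc.2 hT.le) hf.continuousOn
  refine ⟨f x, h0 x, fun y => ?_⟩
  obtain ⟨z, hz, hyz⟩ := hp.exists_mem_Ico₀ hT y
  rw [hyz]
  exact hx (Set.Ico_subset_Icc_self hz)

theorem hasDerivAt_integral {f : ℝ → ℝ} (hf : Continuous f) (x : ℝ) :
    HasDerivAt (fun x => ∫ t in (0 : ℝ)..x, f t) (f x) x :=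
  intervalIntegral.integral_hasDerivAt_right (hf.intervalIntegrable _ _)
    (hf.stronglyMeasurableAtFilter _ _) hf.continuousAt

theorem integral_add_period {f : ℝ → ℝ} (hf : Continuous f) {T : ℝ} (hp : Function.Periodic f T)
    (x : ℝ) : ∫ t in (0 : ℝ)..x + T, f t = (∫ t in (0 : ℝ)..x, f t) + ∫ t in (0 : ℝ)..T, f t := by
  rw [← intervalIntegral.integral_add_adjacent_intervals (hf.intervalIntegrable 0 x)
    (hf.intervalIntegrable x (x + T)), hp.intervalIntegral_add_eq x 0, zero_add]

theorem height_add_two_pi (a c θ : ℝ) : height a c (θ + 2 * Real.pi) = height a c θ := by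
  simp [height]

namespace RegularCurve

variable {n : ℕ} {ε a c : ℝ}

theorem continuous_height (a c : ℝ) : Continuous (height a c) := by
  unfold height; fun_prop

theorem continuous_curveQ (n : ℕ) (ε a c : ℝ) : Continuous (curveQ n ε a c) := by
  unfold curveQ; fun_prop

theorem continuous_curveR (n : ℕ) (ε : ℝ) : Continuous (curveR n ε) := by
  unfold curveR; fun_prop

theorem continuous_curveP (n : ℕ) (ε : ℝ) : Continuous (curveP n ε) := by
  unfold curveP; fun_prop

theorem continuous_speed (h : RegularCurve n ε a c) : Continuous (speed n ε a c) :=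
  (((continuous_curveR n ε).comp (continuous_height a c)).sqrt).div
    (((continuous_curveQ n ε a c).comp (continuous_height a c)).sqrt)
    fun θ => (Real.sqrt_pos.2 (h.Q_pos _ (h.abs_height_le_two θ))).ne'

theorem continuous_curv (h : RegularCurve n ε a c) : Continuous (curv n ε a c) :=
  ((continuous_curveP n ε).comp (continuous_height a c)).div
    ((((continuous_curveR n ε).comp (continuous_height a c)).sqrt).pow 3)
    fun θ => (pow_pos (Real.sqrt_pos.2 (h.R_pos _ (h.abs_height_le_two θ))) 3).ne'

theorem density_pos (h : RegularCurve n ε a c) (θ : ℝ) : 0 < density n ε a c θ :=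
  mul_pos (h.speed_pos θ) (Real.rpow_pos_of_pos (h.curv_pos θ) _)

theorem continuous_density (h : RegularCurve n ε a c) : Continuous (density n ε a c) :=
  h.continuous_speed.mul (h.continuous_curv.rpow_const fun θ => Or.inl (h.curv_pos θ).ne')

theorem periodic_speed (n : ℕ) (ε a c : ℝ) : Function.Periodic (speed n ε a c) (2 * Real.pi) :=
  fun θ => by simp [speed, height_add_two_pi]

theorem periodic_curv (n : ℕ) (ε a c : ℝ) : Function.Periodic (curv n ε a c) (2 * Real.pi) :=
  fun θ => by simp [curv, height_add_two_pi]

theorem periodic_density (n : ℕ) (ε a c : ℝ) :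
    Function.Periodic (density n ε a c) (2 * Real.pi) :=
  fun θ => by simp [density, periodic_speed n ε a c θ, periodic_curv n ε a c θ]

theorem hasDerivAt_densityInt (h : RegularCurve n ε a c) (θ : ℝ) :
    HasDerivAt (densityInt n ε a c) (density n ε a c θ) θ :=
  hasDerivAt_integral h.continuous_density θ

theorem densityInt_two_pi_pos (h : RegularCurve n ε a c) :
    0 < densityInt n ε a c (2 * Real.pi) :=
  intervalIntegral.intervalIntegral_pos_of_pos (h.continuous_density.intervalIntegrable _ _)
    h.density_pos Real.two_pi_pos

theorem densityInt_add (h : RegularCurve n ε a c) (θ : ℝ) :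
    densityInt n ε a c (θ + 2 * Real.pi) =
      densityInt n ε a c θ + densityInt n ε a c (2 * Real.pi) :=
  integral_add_period h.continuous_density (periodic_density n ε a c) θ

theorem hasDerivAt_xiAngle (h : RegularCurve n ε a c) (θ : ℝ) :
    HasDerivAt (xiAngle n ε a c) (density n ε a c θ / densityInt n ε a c (2 * Real.pi)) θ :=
  (h.hasDerivAt_densityInt θ).div_const _

theorem exists_inverse_xiAngle (h : RegularCurve n ε a c) :
    StrictMono (xiAngle n ε a c) ∧ ∃ g : ℝ → ℝ, (∀ x, g (xiAngle n ε a c x) = x) ∧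
      (∀ y, xiAngle n ε a c (g y) = y) ∧ Continuous g := by
  obtain ⟨d, hd, hle⟩ := exists_pos_le_of_periodic h.continuous_density Real.two_pi_pos
    (periodic_density n ε a c) h.density_pos
  obtain ⟨h1, g, h2, h3, h4⟩ := exists_inverse_of_hasDerivAt h.hasDerivAt_xiAngle
    (div_pos hd h.densityInt_two_pi_pos)
    (fun x => div_le_div_of_nonneg_right (hle x) h.densityInt_two_pi_pos.le)
  exact ⟨h1, g, h2, h3, continuous_iff_continuousAt.2 fun y => (h4 y).continuousAt⟩

theorem curvXi_xiAngle (h : RegularCurve n ε a c) (θ : ℝ) :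
    curvXi n ε a c (xiAngle n ε a c θ) = curv n ε a c θ := by
  rw [curvXi, Function.leftInverse_invFun h.exists_inverse_xiAngle.1.injective]

theorem xiAngle_add (h : RegularCurve n ε a c) (θ : ℝ) :
    xiAngle n ε a c (θ + 2 * Real.pi) = xiAngle n ε a c θ + 1 := by
  rw [xiAngle, h.densityInt_add, add_div, div_self h.densityInt_two_pi_pos.ne', xiAngle]

theorem curvXi_periodic (h : RegularCurve n ε a c) (ξ : ℝ) :
    curvXi n ε a c (ξ + 1) = curvXi n ε a c ξ := by
  obtain ⟨-, g, -, hg, -⟩ := h.exists_inverse_xiAngle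
  rw [← hg ξ, ← h.xiAngle_add, h.curvXi_xiAngle, h.curvXi_xiAngle, periodic_curv n ε a c]

/-- A point of the level set near the unit circle has an angle. -/
theorem exists_eq_curvePt (h : RegularCurve n ε a c) {v : Plane}
    (hv : v 0 ^ 2 + v 1 ^ 2 + ε * v 1 ^ n = 1) (hy : |v 1| ≤ 3 / 2) :
    (v 0 / ((a - c) / 2 * Real.sqrt (curveQ n ε a c (v 1)))) ^ 2 +
      ((v 1 - (a + c) / 2) / ((a - c) / 2)) ^ 2 = 1 := by
  have hQ := h.Q_pos _ (hy.trans (by norm_num : (3 / 2 : ℝ) ≤ 2))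
  have hac : a - c ≠ 0 := sub_ne_zero.2 h.ne
  have hf := curveQ_factor h.root_a h.root_c h.ne (v 1)
  rw [div_pow, mul_pow, Real.sq_sqrt hQ.le]
  field_simp
  linear_combination (4 : ℝ) * hv + 4 * hf

theorem eq_curvePt_of_angle (h : RegularCurve n ε a c) {v : Plane} (hy : |v 1| ≤ 3 / 2) {θ : ℝ}
    (h1 : v 0 / ((a - c) / 2 * Real.sqrt (curveQ n ε a c (v 1))) = Real.cos θ)
    (h2 : (v 1 - (a + c) / 2) / ((a - c) / 2) = Real.sin θ) : v = curvePt n ε a c θ := by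
  have hQ := Real.sqrt_pos.2 (h.Q_pos _ (hy.trans (by norm_num : (3 / 2 : ℝ) ≤ 2)))
  have hac : a - c ≠ 0 := sub_ne_zero.2 h.ne
  have hv1 : v 1 = height a c θ := by
    rw [height, ← h2]; field_simp; ring
  have hv0 : v 0 = absc n ε a c θ := by
    rw [absc, ← hv1, ← h1]; field_simp
  ext i
  fin_cases i
  · exact hv0
  · exact hv1

theorem curvePt_mem_level (h : RegularCurve n ε a c) (θ : ℝ) :
    (curvePt n ε a c θ) 0 ^ 2 + (curvePt n ε a c θ) 1 ^ 2 + ε * (curvePt n ε a c θ) 1 ^ n = 1 := by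
  have := h.sq_absc θ
  change absc n ε a c θ ^ 2 + height a c θ ^ 2 + ε * height a c θ ^ n = 1
  linarith

theorem base_mem (h : RegularCurve n ε a c) :
    (!₂[1, 0] : Plane) ∈ {v : Plane | v 0 ^ 2 + v 1 ^ 2 + ε * v 1 ^ n = 1} := by
  have : n ≠ 0 := by have := h.three_le; omega
  simp [this]

/-- The level set has no point with `3/2 < |y| ≤ 2`, since `x²` would be negative there. A connected
subset through `(1, 0)` therefore cannot cross `|y| = 7/4`, and the remote components for odd `n`
are excluded. -/
theorem mem_perturbedCircle (h : RegularCurve n ε a c) {v : Plane}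
    (hv : v ∈ perturbedCircle n ε) :
    v 0 ^ 2 + v 1 ^ 2 + ε * v 1 ^ n = 1 ∧ |v 1| ≤ 3 / 2 := by
  have hlev : ∀ w ∈ perturbedCircle n ε, w 0 ^ 2 + w 1 ^ 2 + ε * w 1 ^ n = 1 := fun w hw =>
    connectedComponentIn_subset {v : Plane | v 0 ^ 2 + v 1 ^ 2 + ε * v 1 ^ n = 1} !₂[1, 0] hw
  have hout : ∀ w ∈ perturbedCircle n ε, |w 1| ≤ 2 → |w 1| ≤ 3 / 2 := by
    intro w hw h2
    by_contra! h3
    have := h.outside _ h3 h2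
    nlinarith [hlev w hw, sq_nonneg (w 0)]
  refine ⟨hlev v hv, ?_⟩
  have hc : Continuous fun w : Plane => |w 1| := by fun_prop
  have hsub : perturbedCircle n ε ⊆ {w : Plane | |w 1| < 7 / 4} := by
    refine isPreconnected_connectedComponentIn.subset_left_of_subset_union
      (isOpen_lt hc continuous_const) (isOpen_lt continuous_const hc) (v := {w : Plane | 7 / 4 < |w 1|})
      ?_ ?_ ⟨_, mem_connectedComponentIn h.base_mem, by simp⟩
    · exact Set.disjoint_left.2 fun w h1 h2 => lt_asymm (a := |w 1|) h1 h2
    · intro w hw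
      rcases lt_trichotomy (|w 1|) (7 / 4) with h1 | h1 | h1
      · exact Or.inl h1
      · have := hout w hw (by rw [h1]; norm_num)
        rw [h1] at this
        norm_num at this
      · exact Or.inr h1
  exact hout v hv (le_trans (le_of_lt (hsub hv)) (by norm_num))

theorem continuous_curvePt (h : RegularCurve n ε a c) : Continuous (curvePt n ε a c) :=
  continuous_iff_continuousAt.2 fun θ => (h.hasDerivAt_curvePt θ).continuousAt

/-- The image is connected, lies in the level set and contains `(1, 0)`, so it lies in the
component. Conversely, a point of the level set with `|y| ≤ 3/2` has an angle, because its
normalized coordinates lie on the unit circle. -/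
theorem range_curvePt (h : RegularCurve n ε a c) :
    Set.range (curvePt n ε a c) = perturbedCircle n ε := by
  have hex : ∀ v : Plane, v 0 ^ 2 + v 1 ^ 2 + ε * v 1 ^ n = 1 → |v 1| ≤ 3 / 2 →
      v ∈ Set.range (curvePt n ε a c) := by
    intro v hv hy
    obtain ⟨θ, h1, h2⟩ := exists_angle (h.exists_eq_curvePt hv hy)
    exact ⟨θ, (h.eq_curvePt_of_angle hy h1 h2).symm⟩
  refine Set.Subset.antisymm ?_ fun v hv => ?_
  · refine (isPreconnected_range h.continuous_curvePt).subset_connectedComponentIn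
      (hex _ h.base_mem (by norm_num)) ?_
    rintro _ ⟨θ, rfl⟩
    exact h.curvePt_mem_level θ
  · obtain ⟨h1, h2⟩ := h.mem_perturbedCircle hv
    exact hex v h1 h2

theorem curvePt_add (n : ℕ) (ε a c θ : ℝ) :
    curvePt n ε a c (θ + 2 * Real.pi) = curvePt n ε a c θ := by
  simp [curvePt, absc, height]

theorem curvePt_eq_iff (h : RegularCurve n ε a c) {θ θ' : ℝ} :
    curvePt n ε a c θ = curvePt n ε a c θ' ↔ Real.cos θ = Real.cos θ' ∧ Real.sin θ = Real.sin θ' := by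
  constructor
  · intro he
    have h0 : absc n ε a c θ = absc n ε a c θ' := congrArg (fun v : Plane => v 0) he
    have h1 : height a c θ = height a c θ' := congrArg (fun v : Plane => v 1) he
    have hac : (a - c) / 2 ≠ 0 := div_ne_zero (sub_ne_zero.2 h.ne) two_ne_zero
    have hs : Real.sin θ = Real.sin θ' := by
      simpa [height, hac] using h1
    refine ⟨?_, hs⟩
    rw [absc, absc, h1] at h0
    have hQ := (Real.sqrt_pos.2 (h.Q_pos _ (h.abs_height_le_two θ'))).ne'
    exact mul_left_cancel₀ hac (mul_right_cancel₀ hQ h0)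
  · rintro ⟨h1, h2⟩
    simp [curvePt, absc, height, h1, h2]

theorem exists_int_of_curvePt_eq (h : RegularCurve n ε a c) {θ θ' : ℝ}
    (he : curvePt n ε a c θ = curvePt n ε a c θ') : ∃ k : ℤ, θ = θ' + k * (2 * Real.pi) := by
  obtain ⟨h1, h2⟩ := h.curvePt_eq_iff.1 he
  have : (θ : Real.Angle) = θ' := Real.Angle.cos_sin_inj h1 h2
  obtain ⟨k, hk⟩ := Real.Angle.angle_eq_iff_two_pi_dvd_sub.1 this
  exact ⟨k, by linarith⟩

/-- The curve has an arc-length parametrization. -/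
theorem exists_arcLengthParam (h : RegularCurve n ε a c) :
    ∃ (γ : ℝ → Plane) (l : ℝ), IsArcLengthParam (perturbedCircle n ε) γ l := by
  obtain ⟨d, hd, hle⟩ := exists_pos_le_of_periodic h.continuous_speed Real.two_pi_pos
    (periodic_speed n ε a c) h.speed_pos
  set S : ℝ → ℝ := fun θ => ∫ t in (0 : ℝ)..θ, speed n ε a c t with hS
  obtain ⟨hmono, ϑ, hϑ1, hϑ2, hϑ3⟩ := exists_inverse_of_hasDerivAt
    (fun θ => hasDerivAt_integral h.continuous_speed θ) hd hle
  have hϑc : Continuous ϑ := continuous_iff_continuousAt.2 fun y => (hϑ3 y).continuousAt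
  have hSadd : ∀ θ, S (θ + 2 * Real.pi) = S θ + S (2 * Real.pi) :=
    integral_add_period h.continuous_speed (periodic_speed n ε a c)
  have hS0 : S 0 = 0 := by simp [hS]
  have hl : 0 < S (2 * Real.pi) := by rw [← hS0]; exact hmono Real.two_pi_pos
  have hϑadd : ∀ s, ϑ (s + S (2 * Real.pi)) = ϑ s + 2 * Real.pi := by
    intro s
    rw [← hϑ1 (ϑ s + 2 * Real.pi)]
    congr 1
    change _ = S (ϑ s + 2 * Real.pi)
    rw [hSadd]
    congr 1
    exact (hϑ2 s).symm
  have hϑmono : StrictMono ϑ := fun x y hxy => by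
    have h1 : S (ϑ x) < S (ϑ y) := by
      have e1 : S (ϑ x) = x := hϑ2 x
      have e2 : S (ϑ y) = y := hϑ2 y
      rwa [e1, e2]
    exact hmono.lt_iff_lt.1 h1
  have hγ : ∀ s, HasDerivAt (fun s => curvePt n ε a c (ϑ s)) (tangent n ε a c (ϑ s)) s := by
    intro s
    refine ((h.hasDerivAt_curvePt (ϑ s)).scomp s (hϑ3 s)).congr_deriv ?_
    rw [smul_smul, inv_mul_cancel₀ (h.speed_pos _).ne', one_smul]
  have hγ' : deriv (fun s => curvePt n ε a c (ϑ s)) = fun s => tangent n ε a c (ϑ s) :=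
    funext fun s => (hγ s).deriv
  have hT := fun s => (h.hasDerivAt_tangent (ϑ s)).scomp s (hϑ3 s)
  refine ⟨fun s => curvePt n ε a c (ϑ s), S (2 * Real.pi), hl, ?_, fun s => ?_, fun s => ?_,
    ?_, ?_⟩
  · have hxc : Continuous (absc n ε a c) :=
      continuous_iff_continuousAt.2 fun θ => (h.hasDerivAt_absc θ).continuousAt
    have hEc : Continuous (curveE n ε : ℝ → ℝ) := by unfold curveE; fun_prop
    have hRc := ((continuous_curveR n ε).comp (continuous_height a c)).sqrt
    have hR0 : ∀ θ, Real.sqrt (curveR n ε (height a c θ)) ≠ 0 := fun θ =>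
      (Real.sqrt_pos.2 (h.R_pos _ (h.abs_height_le_two θ))).ne'
    rw [show (2 : WithTop ℕ∞) = 1 + 1 by norm_num, contDiff_succ_iff_deriv]
    refine ⟨fun s => (hγ s).differentiableAt, by simp, ?_⟩
    rw [hγ', contDiff_one_iff_deriv]
    refine ⟨fun s => (hT s).differentiableAt, ?_⟩
    have : deriv (fun s => tangent n ε a c (ϑ s)) = _ := funext fun s => (hT s).deriv
    rw [this]
    have hvec : Continuous fun θ => (!₂[absc n ε a c θ / Real.sqrt (curveR n ε (height a c θ)),
        curveE n ε (height a c θ) / Real.sqrt (curveR n ε (height a c θ))] : Plane) := by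
      refine (PiLp.continuous_toLp 2 _).comp ?_
      refine continuous_pi fun i => ?_
      fin_cases i
      · exact hxc.div hRc hR0
      · exact (hEc.comp (continuous_height a c)).div hRc hR0
    have hneg : Continuous fun s => -(speed n ε a c (ϑ s) * curv n ε a c (ϑ s)) :=
      ((h.continuous_speed.comp hϑc).mul (h.continuous_curv.comp hϑc)).neg
    exact ((h.continuous_speed.comp hϑc).inv₀ fun s => (h.speed_pos _).ne').smul
      (hneg.smul (hvec.comp hϑc))
  · rw [hγ']; exact h.norm_tangent _
  · simp only [hϑadd, curvePt_add]
  · intro s hs t ht hst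
    obtain ⟨k, hk⟩ := h.exists_int_of_curvePt_eq hst
    have hϑ0 : ϑ 0 = 0 := by
      have := hϑ1 0
      simpa using this
    have hϑl : ϑ (S (2 * Real.pi)) = 2 * Real.pi := hϑ1 _
    have hb : ∀ r ∈ Set.Ico 0 (S (2 * Real.pi)), 0 ≤ ϑ r ∧ ϑ r < 2 * Real.pi := fun r hr =>
      ⟨by rw [← hϑ0]; exact hϑmono.monotone hr.1, by
        have := hϑmono hr.2
        rwa [hϑl] at this⟩
    have h1 := hb s hs
    have h2 := hb t ht
    -- Both angles lie in `[0, 2π)` and differ by `2πk`.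
    have hk0 : k = 0 := by
      have hpi := Real.two_pi_pos
      have h3 : (k : ℝ) < 1 := by
        by_contra! hge
        nlinarith [h1.1, h1.2, h2.1, h2.2]
      have h4 : (-1 : ℝ) < k := by
        by_contra! hge
        nlinarith [h1.1, h1.2, h2.1, h2.2]
      have h5 : k < 1 := by exact_mod_cast h3
      have h6 : -1 < k := by exact_mod_cast h4
      omega
    rw [hk0] at hk
    exact hϑmono.injective (by simpa using hk)
  · rw [← h.range_curvePt]
    have hsurj : Function.Surjective ϑ := fun x => ⟨S x, hϑ1 x⟩
    exact hsurj.range_comp (curvePt n ε a c)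

end RegularCurve

end PerturbedCircle

/-! ### Independence of the arc-length parametrization. -/

namespace PerturbedCircle

namespace RegularCurve

variable {n : ℕ} {ε a c : ℝ}

/-- Every arc-length parametrization is a reparametrization of `curvePt`. -/
theorem exists_angle_of_param (h : RegularCurve n ε a c) {γ : ℝ → Plane} {l : ℝ}
    (hγ : IsArcLengthParam (perturbedCircle n ε) γ l) :
    ∃ θ θ' : ℝ → ℝ, (∀ s, HasDerivAt θ (θ' s) s) ∧ Continuous θ' ∧
      ∀ s, γ s = curvePt n ε a c (θ s) := by
  have hmem : ∀ s, γ s 0 ^ 2 + γ s 1 ^ 2 + ε * γ s 1 ^ n = 1 ∧ |γ s 1| ≤ 3 / 2 := fun s =>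
    h.mem_perturbedCircle (hγ.range_eq ▸ Set.mem_range_self s)
  have hγ1 : ContDiff ℝ 1 γ := hγ.contDiff.of_le (by norm_num)
  have hc := contDiff_euclidean.1 hγ1
  have hQpos : ∀ s, 0 < curveQ n ε a c (γ s 1) := fun s =>
    h.Q_pos _ ((hmem s).2.trans (by norm_num))
  have hQ : ContDiff ℝ 1 fun s => curveQ n ε a c (γ s 1) := by
    have h1 := hc 1
    unfold curveQ
    fun_prop
  have hac : (a - c) / 2 ≠ 0 := div_ne_zero (sub_ne_zero.2 h.ne) two_ne_zero
  have hu : ContDiff ℝ 1 fun s => γ s 0 / ((a - c) / 2 * Real.sqrt (curveQ n ε a c (γ s 1))) :=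
    (hc 0).div (contDiff_const.mul (hQ.sqrt fun s => (hQpos s).ne'))
      fun s => mul_ne_zero hac (Real.sqrt_pos.2 (hQpos s)).ne'
  have hv : ContDiff ℝ 1 fun s => (γ s 1 - (a + c) / 2) / ((a - c) / 2) :=
    ((hc 1).sub contDiff_const).div_const _
  have hud := fun s => (hu.differentiable one_ne_zero s).hasDerivAt
  have hvd := fun s => (hv.differentiable one_ne_zero s).hasDerivAt
  have hu' := hu.continuous_deriv le_rfl
  have hv' := hv.continuous_deriv le_rfl
  obtain ⟨θ, h1, h2, h3⟩ := exists_angle_lift hud hvd hu' hv'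
    fun s => h.exists_eq_curvePt (hmem s).1 (hmem s).2
  refine ⟨θ, _, h1, ?_, fun s => h.eq_curvePt_of_angle (hmem s).2 (h2 s) (h3 s)⟩
  exact (hu.continuous.mul hv').sub (hv.continuous.mul hu')

/-- Unit speed forces `(θ' · speed)² = 1`; the base is continuous on a connected line, so its sign
is constant. -/
theorem exists_sign_of_param (h : RegularCurve n ε a c) {γ : ℝ → Plane} {l : ℝ}
    (hγ : IsArcLengthParam (perturbedCircle n ε) γ l) :
    ∃ (θ : ℝ → ℝ) (e : ℝ), (e = 1 ∨ e = -1) ∧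
      (∀ s, HasDerivAt θ (e / speed n ε a c (θ s)) s) ∧ ∀ s, γ s = curvePt n ε a c (θ s) := by
  obtain ⟨θ, θ', h1, h2, h3⟩ := h.exists_angle_of_param hγ
  have hθc : Continuous θ := continuous_iff_continuousAt.2 fun s => (h1 s).continuousAt
  have hγe : γ = fun s => curvePt n ε a c (θ s) := funext h3
  have hd : ∀ s, HasDerivAt γ (θ' s • speed n ε a c (θ s) • tangent n ε a c (θ s)) s := by
    intro s
    rw [hγe]
    exact (h.hasDerivAt_curvePt (θ s)).scomp s (h1 s)
  have hsq : Set.EqOn ((fun s => θ' s * speed n ε a c (θ s)) ^ 2) 1 Set.univ := by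
    intro s _
    have := hγ.unit_speed s
    rw [(hd s).deriv, smul_smul, norm_smul, h.norm_tangent, mul_one, Real.norm_eq_abs] at this
    simp only [Pi.pow_apply, Pi.one_apply]
    rw [← sq_abs, this, one_pow]
  have hcont : ContinuousOn (fun s => θ' s * speed n ε a c (θ s)) Set.univ :=
    (h2.mul (h.continuous_speed.comp hθc)).continuousOn
  have key : ∃ e : ℝ, (e = 1 ∨ e = -1) ∧ ∀ s, θ' s * speed n ε a c (θ s) = e := by
    rcases isPreconnected_univ.eq_one_or_eq_neg_one_of_sq_eq hcont hsq with he | he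
    · exact ⟨1, Or.inl rfl, fun s => he (Set.mem_univ s)⟩
    · exact ⟨-1, Or.inr rfl, fun s => he (Set.mem_univ s)⟩
  obtain ⟨e, he, hes⟩ := key
  refine ⟨θ, e, he, fun s => ?_, h3⟩
  refine (h1 s).congr_deriv ?_
  rw [← hes s, mul_div_cancel_right₀ _ (h.speed_pos _).ne']

/-- The curvature of an arc-length parametrization. -/
theorem curvature_eq (h : RegularCurve n ε a c) {γ : ℝ → Plane} {θ : ℝ → ℝ} {e : ℝ}
    (he : e = 1 ∨ e = -1) (hθ : ∀ s, HasDerivAt θ (e / speed n ε a c (θ s)) s)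
    (hγ : ∀ s, γ s = curvePt n ε a c (θ s)) (s : ℝ) :
    curvature γ s = curv n ε a c (θ s) := by
  have hγe : γ = fun s => curvePt n ε a c (θ s) := funext hγ
  have habs : |e| = 1 := by rcases he with rfl | rfl <;> simp
  have hd : deriv γ = fun s => e • tangent n ε a c (θ s) := by
    funext s
    rw [hγe]
    refine (((h.hasDerivAt_curvePt (θ s)).scomp s (hθ s)).congr_deriv ?_).deriv
    rw [smul_smul, div_mul_cancel₀ _ (h.speed_pos _).ne']
  have hd2 := ((h.hasDerivAt_tangent (θ s)).scomp s (hθ s)).const_smul e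
  have hR := h.R_pos _ (h.abs_height_le_two (θ s))
  have hn : ‖(!₂[absc n ε a c (θ s) / Real.sqrt (curveR n ε (height a c (θ s))),
      curveE n ε (height a c (θ s)) / Real.sqrt (curveR n ε (height a c (θ s)))] : Plane)‖ = 1 := by
    rw [norm_vec, div_pow, div_pow, Real.sq_sqrt hR.le, ← add_div, ← h.R_eq, div_self hR.ne',
      Real.sqrt_one]
  have hv := h.speed_pos (θ s)
  have hd3 : deriv (fun s => e • tangent n ε a c (θ s)) s = _ := hd2.deriv
  rw [curvature, hd, hd3, norm_smul, norm_smul, norm_smul, hn, norm_neg, norm_mul, norm_div,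
    Real.norm_eq_abs e, habs, Real.norm_of_nonneg hv.le, Real.norm_of_nonneg (h.curv_pos _).le]
  field_simp

/-- The curvature as a function of `ξ` is the same for all arc-length parametrizations, up to
translations and reflections of the `ξ`-axis. -/
theorem curvatureXi_eq (h : RegularCurve n ε a c) {γ : ℝ → Plane} {l : ℝ}
    (hγ : IsArcLengthParam (perturbedCircle n ε) γ l) :
    (∀ s, 0 < curvature γ s) ∧ ∃ e c' : ℝ, (e = 1 ∨ e = -1) ∧
      ∀ ξ, curvatureXi γ l ξ = curvXi n ε a c (e * ξ + c') := by
  obtain ⟨θ, e, he, hθ, hγθ⟩ := h.exists_sign_of_param hγ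
  have hκ := h.curvature_eq he hθ hγθ
  have hee : e * e = 1 := by rcases he with rfl | rfl <;> norm_num
  have hθc : Continuous θ := continuous_iff_continuousAt.2 fun s => (hθ s).continuousAt
  refine ⟨fun s => by rw [hκ]; exact h.curv_pos _, e, xiAngle n ε a c (θ 0), he, ?_⟩
  -- the angle is a bijection
  have hψ : ∀ s, HasDerivAt (fun s => e * θ s) (speed n ε a c (θ s))⁻¹ s := fun s =>
    ((hθ s).const_mul e).congr_deriv (by rw [← mul_div_assoc, hee, one_div])
  obtain ⟨d, hd, hle⟩ := exists_pos_le_of_periodic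
    (h.continuous_speed.inv₀ fun s => (h.speed_pos s).ne') Real.two_pi_pos
    (fun s => congrArg (·⁻¹) (periodic_speed n ε a c s)) (fun s => inv_pos.2 (h.speed_pos s))
  obtain ⟨hmono, g, -, hg, -⟩ := exists_inverse_of_hasDerivAt hψ hd fun s => hle (θ s)
  have hθsurj : Function.Surjective θ := fun x => ⟨g (e * x), by
    have h2 : e * (e * θ (g (e * x))) = e * (e * x) := by rw [hg]
    rwa [← mul_assoc, ← mul_assoc, hee, one_mul, one_mul] at h2⟩
  -- the total turn
  have hturn : θ l = θ 0 + e * (2 * Real.pi) := by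
    have hl := hγ.length_pos
    have hγl : γ l = γ 0 := by simpa using hγ.periodic 0
    rw [hγθ, hγθ] at hγl
    obtain ⟨k, hk⟩ := h.exists_int_of_curvePt_eq hγl
    have h1 : e * θ 0 < e * θ l := hmono hl
    have hpi := Real.two_pi_pos
    obtain ⟨k', hk'⟩ : ∃ k' : ℤ, e * k = k' := by
      rcases he with rfl | rfl
      · exact ⟨k, by simp⟩
      · exact ⟨-k, by simp⟩
    have h2 : e * θ l = e * θ 0 + k' * (2 * Real.pi) := by
      rw [hk, ← hk']; ring
    have h3 : 0 < k' := by
      have : (0 : ℝ) < k' := by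
        by_contra! h0
        nlinarith
      exact_mod_cast this
    -- If the angle turned twice, an intermediate parameter in `(0, l)` would reach the first full
    -- turn and return to `γ 0`, against injectivity on one period.
    have h4 : k' < 2 := by
      by_contra! h0
      have h0' : (2 : ℝ) ≤ k' := by exact_mod_cast h0
      have hψc : ContinuousOn (fun s => e * θ s) (Set.Icc 0 l) := by fun_prop
      obtain ⟨s, hs, hse⟩ := intermediate_value_Icc hl.le hψc
        (show e * θ 0 + 2 * Real.pi ∈ _ from ⟨by linarith, by nlinarith⟩)
      have hsl : s < l := by
        refine lt_of_le_of_ne hs.2 ?_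
        rintro rfl
        simp only [h2] at hse
        nlinarith
      have hs0 : s ≠ 0 := by
        rintro rfl
        simp only at hse
        linarith
      have hθs : θ s = θ 0 + e * (2 * Real.pi) := by
        have : e * (e * θ s) = e * (e * θ 0 + 2 * Real.pi) := by rw [← hse]
        rwa [← mul_assoc, hee, one_mul, mul_add, ← mul_assoc, hee, one_mul] at this
      have hγs : γ s = γ 0 := by
        rw [hγθ, hγθ, hθs, h.curvePt_eq_iff]
        rcases he with rfl | rfl
        · simp
        · constructor
          · simpa [sub_eq_add_neg] using Real.cos_sub_two_pi (θ 0)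
          · simpa [sub_eq_add_neg] using Real.sin_sub_two_pi (θ 0)
      exact hs0 (hγ.injOn ⟨hs.1, hsl⟩ ⟨le_rfl, hl⟩ hγs)
    have h5 : k' = 1 := by omega
    have h6 : (k : ℝ) = e := by
      have : e * (e * k) = e * k' := by rw [hk']
      rwa [← mul_assoc, hee, one_mul, h5, Int.cast_one, mul_one] at this
    rw [hk, h6]
  -- the integral of the density
  have hint : ∀ s, ∫ t in (0 : ℝ)..s, curvature γ t ^ (2 / 3 : ℝ) =
      e * (densityInt n ε a c (θ s) - densityInt n ε a c (θ 0)) := by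
    intro s
    have hd : ∀ t, HasDerivAt (fun t => e * densityInt n ε a c (θ t))
        (curvature γ t ^ (2 / 3 : ℝ)) t := by
      intro t
      refine (((h.hasDerivAt_densityInt (θ t)).comp t (hθ t)).const_mul e).congr_deriv ?_
      rw [hκ, density]
      have := (h.speed_pos (θ t)).ne'
      field_simp
      rw [sq, hee, one_mul]
    have hcont : Continuous fun t => curvature γ t ^ (2 / 3 : ℝ) := by
      have : (fun t => curvature γ t ^ (2 / 3 : ℝ)) = fun t => curv n ε a c (θ t) ^ (2 / 3 : ℝ) :=
        funext fun t => by rw [hκ]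
      rw [this]
      exact (h.continuous_curv.comp hθc).rpow_const fun t => Or.inl (h.curv_pos _).ne'
    rw [intervalIntegral.integral_eq_sub_of_hasDerivAt (fun t _ => hd t)
      (hcont.intervalIntegrable _ _), mul_sub]
  have htotal : xiConst γ l = densityInt n ε a c (2 * Real.pi) := by
    rw [xiConst, hint, hturn]
    rcases he with rfl | rfl
    · rw [one_mul, one_mul, h.densityInt_add, add_sub_cancel_left]
    · have := h.densityInt_add (θ 0 + -1 * (2 * Real.pi))
      rw [show θ 0 + -1 * (2 * Real.pi) + 2 * Real.pi = θ 0 by ring] at this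
      linarith
  have hxi : ∀ s, xi γ l s = e * (xiAngle n ε a c (θ s) - xiAngle n ε a c (θ 0)) := by
    intro s
    rw [xi, hint, htotal, xiAngle, xiAngle]
    ring
  obtain ⟨-, gx, -, hgx, -⟩ := h.exists_inverse_xiAngle
  intro ξ
  have hex : ∃ s, xi γ l s = ξ := by
    obtain ⟨s, hs⟩ := hθsurj (gx (e * ξ + xiAngle n ε a c (θ 0)))
    refine ⟨s, ?_⟩
    rw [hxi, hs, hgx, add_sub_cancel_right, ← mul_assoc, hee, one_mul]
  have hinv := Function.invFun_eq hex
  rw [curvatureXi, hκ, ← h.curvXi_xiAngle]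
  congr 1
  rw [hxi] at hinv
  have : e * (e * (xiAngle n ε a c (θ (Function.invFun (xi γ l) ξ)) - xiAngle n ε a c (θ 0))) =
      e * ξ := by rw [hinv]
  rw [← mul_assoc, hee, one_mul] at this
  linarith

end RegularCurve

end PerturbedCircle

/-! ### The curve is regular for small `ε`. -/

namespace PerturbedCircle

/-- The double sum has at most `n²` terms, each of total degree `n - 2`. Besides `Y = 2` over the
reals, the bound serves with `Y` of order `1/τ` over `ℂ`. -/
theorem norm_curveQ_sub_one_le {𝕜 : Type*} [NormedField 𝕜] {n : ℕ} {ε a c y : 𝕜} {Y : ℝ}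
    (ha : ‖a‖ ≤ Y) (hc : ‖c‖ ≤ Y) (hy : ‖y‖ ≤ Y) :
    ‖curveQ n ε a c y - 1‖ ≤ ‖ε‖ * (n ^ 2 * Y ^ (n - 2)) := by
  have hY : 0 ≤ Y := (norm_nonneg a).trans ha
  rw [curveQ, add_sub_cancel_left, norm_mul]
  refine mul_le_mul_of_nonneg_left ?_ (norm_nonneg _)
  have h1 : ∀ i ∈ Finset.range n, ‖a ^ (n - 1 - i) * ∑ j ∈ Finset.range i, y ^ j * c ^ (i - 1 - j)‖ ≤
      n * Y ^ (n - 2) := by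
    intro i hi
    rw [Finset.mem_range] at hi
    rw [Finset.mul_sum]
    have h2 : ∀ j ∈ Finset.range i, ‖a ^ (n - 1 - i) * (y ^ j * c ^ (i - 1 - j))‖ ≤ Y ^ (n - 2) := by
      intro j hj
      rw [Finset.mem_range] at hj
      have e : n - 2 = (n - 1 - i) + (j + (i - 1 - j)) := by omega
      rw [norm_mul, norm_mul, norm_pow, norm_pow, norm_pow, e, pow_add, pow_add]
      gcongr
    refine (norm_sum_le_of_le _ h2).trans ?_
    rw [Finset.sum_const, Finset.card_range, nsmul_eq_mul]
    have : (i : ℝ) ≤ n := by exact_mod_cast hi.le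
    gcongr
  refine (norm_sum_le_of_le _ h1).trans ?_
  rw [Finset.sum_const, Finset.card_range, nsmul_eq_mul]
  apply le_of_eq
  ring

/-- For small `ε` the curve is regular, and its vertices are close to those of the circle. -/
theorem exists_regularCurve {n : ℕ} (hn : 3 ≤ n) :
    ∃ ε₀ > 0, ∀ ε : ℝ, 0 < ε → ε < ε₀ → ∃ a c : ℝ, RegularCurve n ε a c ∧
      |a - 1| ≤ 2 ^ n * ε ∧ |c + 1| ≤ 2 ^ n * ε := by
  have hn1 : (3 : ℝ) ≤ n := by exact_mod_cast hn
  -- For `|y| ≤ 2` every correction term in `P` and `R` is then at most `1/8`: the coefficients are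
  -- at most `n²` and the powers of `y` at most `2^{2n} = 4ⁿ`.
  refine ⟨1 / (8 * (n ^ 2 * 4 ^ n)), by positivity, fun ε hε hlt => ?_⟩
  rw [lt_div_iff₀ (by positivity)] at hlt
  have h4 : (4 : ℝ) ^ n = 2 ^ n * 2 ^ n := by rw [← mul_pow]; norm_num
  have h2n : (1 : ℝ) ≤ 2 ^ n := one_le_pow₀ (by norm_num)
  set N : ℝ := n ^ 2 * 4 ^ n with hN
  have hNbig : (2 : ℝ) ^ n ≤ N := by
    rw [hN, h4]
    have h1 : (2 : ℝ) ^ n ≤ 2 ^ n * 2 ^ n := le_mul_of_one_le_left (by positivity) h2n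
    exact h1.trans (le_mul_of_one_le_left (by positivity) (by nlinarith))
  have hεN : ε * N ≤ 1 / 8 := by linarith
  have hN1 : 1 ≤ N := h2n.trans hNbig
  have hε1 : ε ≤ 1 / 8 := by nlinarith
  have hε2 : ε * 2 ^ n ≤ 1 / 8 := by nlinarith
  have hf : ContinuousOn (fun y : ℝ => y ^ 2 + ε * y ^ n) Set.univ := by fun_prop
  have hpow : ∀ y : ℝ, |y| ≤ 2 → |ε * y ^ n| ≤ 1 / 8 := by
    intro y hy
    rw [abs_mul, abs_of_pos hε, abs_pow]
    calc ε * |y| ^ n ≤ ε * 2 ^ n := by gcongr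
      _ ≤ _ := hε2
  have hb := fun y hy => abs_le.1 (hpow y hy)
  obtain ⟨a, ha, hfa⟩ := intermediate_value_Icc (show (1 / 2 : ℝ) ≤ 3 / 2 by norm_num)
    (hf.mono (Set.subset_univ _)) (show (1 : ℝ) ∈ Set.Icc _ _ by
      have h1 := hb (1 / 2) (by norm_num [abs_of_pos])
      have h2 := hb (3 / 2) (by norm_num [abs_of_pos])
      constructor <;> nlinarith [h1.2, h2.1])
  obtain ⟨c, hc, hfc⟩ := intermediate_value_Icc' (show (-(3 / 2) : ℝ) ≤ -(1 / 2) by norm_num)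
    (hf.mono (Set.subset_univ _)) (show (1 : ℝ) ∈ Set.Icc _ _ by
      have h1 := hb (-(1 / 2)) (by norm_num [abs_of_pos])
      have h2 := hb (-(3 / 2)) (by norm_num [abs_of_pos])
      constructor <;> nlinarith [h1.2, h2.1])
  simp only at hfa hfc
  have ha2 : |a| ≤ 2 := abs_le.2 ⟨by linarith [ha.1], by linarith [ha.2]⟩
  have hc2 : |c| ≤ 2 := abs_le.2 ⟨by linarith [hc.1], by linarith [hc.2]⟩
  have hεpow : ∀ y : ℝ, |y| ≤ 2 → |ε * y ^ n| ≤ 2 ^ n * ε := by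
    intro y hy
    rw [abs_mul, abs_of_pos hε, abs_pow, mul_comm]
    gcongr
  have hterm : ∀ (k : ℝ) (y : ℝ) (m : ℕ), |k| ≤ n ^ 2 → |y| ≤ 2 → m ≤ 2 * n →
      |k * ε * y ^ m| ≤ 1 / 8 := by
    intro k y m hk hy hm
    rw [abs_mul, abs_mul, abs_of_pos hε, abs_pow]
    have h1 : |y| ^ m ≤ 4 ^ n :=
      calc |y| ^ m ≤ 2 ^ m := by gcongr
        _ ≤ 2 ^ (2 * n) := by gcongr; norm_num
        _ = 4 ^ n := by rw [pow_mul]; norm_num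
    calc |k| * ε * |y| ^ m ≤ n ^ 2 * ε * 4 ^ n := by gcongr
      _ = ε * N := by rw [hN]; ring
      _ ≤ _ := hεN
  have hk1 : |(n : ℝ) * (n - 1) / 2| ≤ (n : ℝ) ^ 2 := by
    rw [abs_of_nonneg (by nlinarith)]; nlinarith
  have hk2 : |((n : ℝ) - 1) * (n - 2) / 2| ≤ (n : ℝ) ^ 2 := by
    rw [abs_of_nonneg (by nlinarith)]; nlinarith
  have hk3 : |(n : ℝ) * (n - 2) / 4 * ε| ≤ (n : ℝ) ^ 2 := by
    rw [abs_of_nonneg (mul_nonneg (by nlinarith) hε.le)]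
    have : (n : ℝ) * (n - 2) / 4 * ε ≤ (n : ℝ) * (n - 2) / 4 * 1 := by
      apply mul_le_mul_of_nonneg_left (by linarith) (by nlinarith)
    nlinarith
  have hk4 : |((n : ℝ) - 1)| ≤ (n : ℝ) ^ 2 := by
    rw [abs_of_nonneg (by linarith)]; nlinarith
  have hk5 : |(n : ℝ) ^ 2 / 4 * ε| ≤ (n : ℝ) ^ 2 := by
    rw [abs_of_nonneg (by positivity)]; nlinarith [sq_nonneg (n : ℝ)]
  refine ⟨a, c, ⟨hn, hε, hfa, hfc, ha, hc, fun y hy => ?_, fun y hy => ?_, fun y hy => ?_,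
    fun y h1 h2 => ?_⟩, ?_, ?_⟩
  · have e1 := abs_le.1 (hterm _ y (n - 2) hk1 hy (by omega))
    have e2 := abs_le.1 (hterm _ y n hk2 hy (by omega))
    have e3 := abs_le.1 (hterm _ y (2 * n - 2) hk3 hy (by omega))
    simp only [curveP]
    linarith [e1.1, e2.2, e3.2]
  · have e1 := abs_le.1 (hterm _ y n hk4 hy (by omega))
    have e2 := abs_le.1 (hterm _ y (2 * n - 2) hk5 hy (by omega))
    simp only [curveR]
    linarith [e1.1, e2.1]
  · have h := norm_curveQ_sub_one_le (n := n) (ε := ε) (a := a) (c := c) (y := y) (Y := 2) ha2 hc2 hy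
    rw [Real.norm_eq_abs, Real.norm_of_nonneg hε.le] at h
    have h2 : ε * (n ^ 2 * 2 ^ (n - 2)) ≤ ε * N := by
      rw [hN]
      have h3 : (2 : ℝ) ^ (n - 2) ≤ 4 ^ n :=
        (pow_le_pow_right₀ (by norm_num) (by omega : n - 2 ≤ n)).trans
          (pow_le_pow_left₀ (by norm_num) (by norm_num) n)
      gcongr
    linarith [(abs_le.1 (h.trans (h2.trans hεN))).1]
  · have := (hb y h2).1
    have : (3 / 2 : ℝ) ^ 2 < y ^ 2 := by rw [← sq_abs y]; gcongr
    linarith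
  · have h1 : |(a - 1) * (a + 1)| ≤ 2 ^ n * ε := by
      have : (a - 1) * (a + 1) = -(ε * a ^ n) := by linear_combination hfa
      rw [this, abs_neg]; exact hεpow a ha2
    rw [abs_mul, abs_of_pos (by linarith [ha.1] : 0 < a + 1)] at h1
    exact (le_mul_of_one_le_right (abs_nonneg _) (by linarith [ha.1])).trans h1
  · have h1 : |(c + 1) * (c - 1)| ≤ 2 ^ n * ε := by
      have : (c + 1) * (c - 1) = -(ε * c ^ n) := by linear_combination hfc
      rw [this, abs_neg]; exact hεpow c hc2
    rw [abs_mul, abs_of_neg (by linarith [hc.2] : c - 1 < 0)] at h1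
    exact (le_mul_of_one_le_right (abs_nonneg _) (by linarith [hc.2])).trans h1

end PerturbedCircle

/-! ### The limit density, and its minimum on circles. -/

namespace PerturbedCircle

/-- The modulus of the limit, as `ε → 0`, of `C dξ/dφ` in terms of the coordinate `p`. -/
def limitNorm (n : ℕ) (p : ℂ) : ℝ :=
  ‖1 - (n - 1) * p‖ ^ (2 / 3 : ℝ) * ‖1 + p‖ ^ (-(1 / 2) : ℝ) * ‖1 - p‖ ^ (-(7 / 6) : ℝ)

/-- `limitNorm` at a point of the segment `[0, 1 / (n - 1))`. -/
def limitDensity (n : ℕ) (r : ℝ) : ℝ :=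
  (1 - (n - 1) * r) ^ (2 / 3 : ℝ) * (1 + r) ^ (-(1 / 2) : ℝ) * (1 - r) ^ (-(7 / 6) : ℝ)

theorem limitNorm_ofReal {n : ℕ} (hn : 3 ≤ n) {r : ℝ} (h0 : 0 ≤ r) (h1 : (n - 1) * r ≤ 1) :
    limitNorm n r = limitDensity n r := by
  have hn1 : (3 : ℝ) ≤ n := by exact_mod_cast hn
  have hr : r ≤ 1 / 2 := by nlinarith
  have e1 : ‖(1 : ℂ) - (n - 1) * r‖ = 1 - (n - 1) * r := by
    rw [← Real.norm_of_nonneg (by linarith : 0 ≤ 1 - (n - 1) * r), ← Complex.norm_real]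
    push_cast; rfl
  have e2 : ‖(1 : ℂ) + r‖ = 1 + r := by
    rw [← Real.norm_of_nonneg (by linarith : 0 ≤ 1 + r), ← Complex.norm_real]
    push_cast; rfl
  have e3 : ‖(1 : ℂ) - r‖ = 1 - r := by
    rw [← Real.norm_of_nonneg (by linarith : 0 ≤ 1 - r), ← Complex.norm_real]
    push_cast; rfl
  rw [limitNorm, limitDensity, e1, e2, e3]

theorem one_sub_ne_zero_of_norm_lt {z : ℂ} (hz : ‖z‖ < 1) : 1 - z ≠ 0 := by
  intro h
  rw [← sub_eq_zero.1 h] at hz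
  simp at hz

/-- Among the points of a given modulus, `limitNorm` is smallest on the positive real axis. -/
theorem limitNorm_norm_le {n : ℕ} (hn : 3 ≤ n) {p : ℂ} (hp : (n - 1) * ‖p‖ < 1) :
    limitNorm n (‖p‖ : ℂ) ≤ limitNorm n p := by
  have hn1 : (3 : ℝ) ≤ n := by exact_mod_cast hn
  set N : ℂ := (n : ℂ) - 1 with hN
  have hNnorm : ‖N‖ = n - 1 := by
    rw [← Real.norm_of_nonneg (by linarith : (0 : ℝ) ≤ n - 1), ← Complex.norm_real, hN]
    push_cast; rfl
  -- the series of the logarithm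
  have hT : ∀ q : ℂ, (n - 1) * ‖q‖ < 1 → HasSum (fun k : ℕ => ((2 / 3 * ((n : ℝ) - 1) ^ k -
      1 / 2 * (-1) ^ k - 7 / 6) / k : ℝ) * (q ^ k).re) (-Real.log (limitNorm n q)) := by
    intro q hq
    have hq1 : ‖q‖ < 1 := by nlinarith [norm_nonneg q]
    have hq2 : ‖-q‖ < 1 := by rwa [norm_neg]
    have hq3 : ‖N * q‖ < 1 := by rwa [norm_mul, hNnorm]
    have s1 := Complex.hasSum_re (Complex.hasSum_taylorSeries_neg_log hq1)
    have s2 := Complex.hasSum_re (Complex.hasSum_taylorSeries_neg_log hq2)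
    have s3 := Complex.hasSum_re (Complex.hasSum_taylorSeries_neg_log hq3)
    have s := ((s3.mul_left (2 / 3)).sub (s2.mul_left (1 / 2))).sub (s1.mul_left (7 / 6))
    simp only [Complex.neg_re, Complex.log_re] at s
    convert! s using 1
    · funext k
      have h1 : (((N * q) ^ k / k : ℂ)).re = (n - 1) ^ k * (q ^ k).re / k := by
        have : ((N * q) ^ k / k : ℂ) = (((n - 1) ^ k / k : ℝ) : ℂ) * q ^ k := by
          rw [hN, mul_pow]; push_cast; ring
        rw [this, Complex.re_ofReal_mul]; ring
      have h2 : (((-q) ^ k / k : ℂ)).re = (-1) ^ k * (q ^ k).re / k := by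
        have : ((-q) ^ k / k : ℂ) = (((-1) ^ k / k : ℝ) : ℂ) * q ^ k := by
          rw [neg_pow]; push_cast; ring
        rw [this, Complex.re_ofReal_mul]; ring
      have h3 : ((q ^ k / k : ℂ)).re = (q ^ k).re / k := by
        have : (q ^ k / k : ℂ) = ((1 / k : ℝ) : ℂ) * q ^ k := by
          push_cast; ring
        rw [this, Complex.re_ofReal_mul]; ring
      rw [h1, h2, h3]
      ring
    · have n1 : ‖1 - q‖ ≠ 0 := norm_ne_zero_iff.2 (one_sub_ne_zero_of_norm_lt hq1)
      have n2 : ‖1 + q‖ ≠ 0 := by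
        have := norm_ne_zero_iff.2 (one_sub_ne_zero_of_norm_lt hq2)
        rwa [sub_neg_eq_add] at this
      have n3 : ‖1 - N * q‖ ≠ 0 := norm_ne_zero_iff.2 (one_sub_ne_zero_of_norm_lt hq3)
      have p1 := (norm_nonneg (1 - q)).lt_of_ne' n1
      have p2 := (norm_nonneg (1 + q)).lt_of_ne' n2
      have p3 := (norm_nonneg (1 - N * q)).lt_of_ne' n3
      rw [limitNorm, Real.log_mul (by positivity) (by positivity),
        Real.log_mul (by positivity) (by positivity), Real.log_rpow p3, Real.log_rpow p2,
        Real.log_rpow p1, sub_neg_eq_add]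
      ring
  have hr : (n - 1) * ‖(‖p‖ : ℂ)‖ < 1 := by simpa using hp
  have hle : -Real.log (limitNorm n p) ≤ -Real.log (limitNorm n (‖p‖ : ℂ)) := by
    refine hasSum_le (fun k => ?_) (hT p hp) (hT _ hr)
    rcases Nat.eq_zero_or_pos k with rfl | hk
    · simp
    -- For `k = 1` the numerator is `2/3 · (n - 2)`. For `k ≥ 2` the first term is at least `8/3`,
    -- which exceeds `1/2 + 7/6`. The nonnegative coefficients then meet `Re pᵏ ≤ |p|ᵏ`.
    have hc : 0 ≤ (2 / 3 * ((n : ℝ) - 1) ^ k - 1 / 2 * (-1) ^ k - 7 / 6) / k := by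
      apply div_nonneg _ (Nat.cast_nonneg k)
      rcases Nat.lt_or_ge k 2 with h2 | h2
      · have : k = 1 := by omega
        subst this
        norm_num
        linarith
      · have h3 : (2 : ℝ) ^ 2 ≤ ((n : ℝ) - 1) ^ k :=
          (pow_le_pow_right₀ (by norm_num) h2).trans
            (pow_le_pow_left₀ (by norm_num) (by linarith) k)
        have h4 : ((-1 : ℝ)) ^ k ≤ 1 := by
          rcases neg_one_pow_eq_or ℝ k with h | h <;> rw [h] <;> norm_num
        linarith
    refine mul_le_mul_of_nonneg_left ?_ hc
    refine (Complex.re_le_norm _).trans ?_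
    rw [norm_pow, ← Complex.ofReal_pow, Complex.ofReal_re]
  have hpos : ∀ q : ℂ, (n - 1) * ‖q‖ < 1 → 0 < limitNorm n q := by
    intro q hq
    have hq1 : ‖q‖ < 1 := by nlinarith [norm_nonneg q]
    have hq2 : ‖-q‖ < 1 := by rwa [norm_neg]
    have hq3 : ‖N * q‖ < 1 := by rwa [norm_mul, hNnorm]
    have n1 := norm_pos_iff.2 (one_sub_ne_zero_of_norm_lt hq1)
    have n2 := norm_pos_iff.2 (one_sub_ne_zero_of_norm_lt hq2)
    rw [sub_neg_eq_add] at n2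
    have n3 := norm_pos_iff.2 (one_sub_ne_zero_of_norm_lt hq3)
    unfold limitNorm
    positivity
  exact (Real.log_le_log_iff (hpos _ hr) (hpos _ hp)).1 (neg_le_neg_iff.1 hle)

theorem norm_pow_sub_pow_le {x y : ℂ} {M : ℝ} (hx : ‖x‖ ≤ M) (hy : ‖y‖ ≤ M) (n : ℕ) :
    ‖x ^ n - y ^ n‖ ≤ n * M ^ (n - 1) * ‖x - y‖ := by
  have hM : 0 ≤ M := (norm_nonneg x).trans hx
  rw [← (Commute.all x y).mul_geom_sum₂ n, norm_mul, mul_comm]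
  refine mul_le_mul_of_nonneg_right ?_ (norm_nonneg _)
  have h1 : ∀ i ∈ Finset.range n, ‖x ^ i * y ^ (n - 1 - i)‖ ≤ M ^ (n - 1) := by
    intro i hi
    rw [Finset.mem_range] at hi
    have e : n - 1 = i + (n - 1 - i) := by omega
    rw [norm_mul, norm_pow, norm_pow]
    conv_rhs => rw [e, pow_add]
    gcongr
  refine (norm_sum_le_of_le _ h1).trans ?_
  simp

/-- If `ζ ζ'` is of order `τ²`, then so is `(ζ + ζ')ⁿ - ζⁿ`. -/
theorem norm_add_pow_sub_pow_le {n : ℕ} (hn : 3 ≤ n) {ζ ζ' : ℂ} {τ : ℝ} (hτ0 : 0 < τ) (hτ : τ ≤ 1)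
    (h : ζ * ζ' = τ ^ 2 / 4) (h1 : ‖ζ‖ ≤ 5) (h2 : ‖ζ'‖ ≤ 4 * τ) :
    ‖(ζ + ζ') ^ n - ζ ^ n‖ ≤ n * 2 ^ n * (5 ^ n + 4 ^ n) * τ ^ 2 := by
  have hprod : ‖ζ'‖ * ‖ζ‖ = τ ^ 2 / 4 := by
    rw [mul_comm, ← norm_mul, h]
    have : ((τ : ℂ) ^ 2 / 4) = ((τ ^ 2 / 4 : ℝ) : ℂ) := by push_cast; rfl
    rw [this, Complex.norm_real, Real.norm_of_nonneg (by positivity)]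
  have h3 := norm_pow_sub_pow_le (x := ζ + ζ') (y := ζ) (M := ‖ζ‖ + ‖ζ'‖) (norm_add_le _ _)
    (by linarith [norm_nonneg ζ']) n
  rw [add_sub_cancel_left] at h3
  have h4 := add_pow_le (norm_nonneg ζ) (norm_nonneg ζ') (n - 1)
  have e1 : n - 1 = (n - 2) + 1 := by omega
  -- One factor `ζ` is paired with `ζ'`, and their product is `τ² / 4`; the other powers of `ζ` are
  -- bounded.
  have h5 : ‖ζ‖ ^ (n - 1) * ‖ζ'‖ ≤ 5 ^ n * τ ^ 2 := by
    have : ‖ζ‖ ^ (n - 1) * ‖ζ'‖ = ‖ζ‖ ^ (n - 2) * (τ ^ 2 / 4) := by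
      rw [e1, pow_succ, ← hprod]; ring
    rw [this]
    have h6 : ‖ζ‖ ^ (n - 2) ≤ 5 ^ n :=
      (pow_le_pow_left₀ (norm_nonneg _) h1 _).trans
        (pow_le_pow_right₀ (by norm_num) (by omega))
    have : τ ^ 2 / 4 ≤ τ ^ 2 := by nlinarith
    gcongr
  have h7 : ‖ζ'‖ ^ (n - 1) * ‖ζ'‖ ≤ 4 ^ n * τ ^ 2 := by
    rw [← pow_succ, show n - 1 + 1 = n by omega]
    calc ‖ζ'‖ ^ n ≤ (4 * τ) ^ n := by gcongr
      _ = 4 ^ n * τ ^ n := mul_pow _ _ _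
      _ ≤ 4 ^ n * τ ^ 2 := by
        have := pow_le_pow_of_le_one hτ0.le hτ (by omega : 2 ≤ n)
        gcongr
  have h8 : (2 : ℝ) ^ (n - 1 - 1) ≤ 2 ^ n := pow_le_pow_right₀ (by norm_num) (by omega)
  calc _ ≤ n * (‖ζ‖ + ‖ζ'‖) ^ (n - 1) * ‖ζ'‖ := h3
    _ ≤ n * (2 ^ (n - 1 - 1) * (‖ζ‖ ^ (n - 1) + ‖ζ'‖ ^ (n - 1))) * ‖ζ'‖ := by gcongr
    _ = n * 2 ^ (n - 1 - 1) * (‖ζ‖ ^ (n - 1) * ‖ζ'‖ + ‖ζ'‖ ^ (n - 1) * ‖ζ'‖) := by ring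
    _ ≤ n * 2 ^ n * (5 ^ n * τ ^ 2 + 4 ^ n * τ ^ 2) := by gcongr
    _ = _ := by ring

end PerturbedCircle

/-! ### Approximation of `P`, `R` and `Q` at heights of order `1/τ`. -/

namespace PerturbedCircle

/-- The scaled height `w = τ y` has an `n`-th power close to `fⁿ / (1 - p)`. -/
theorem norm_scaled_pow_sub_le {n : ℕ} (hn : 3 ≤ n) {τ a c : ℝ} (hτ0 : 0 < τ) (hτ : τ ≤ 1)
    (hτn : 10 * 2 ^ n * τ ^ 2 ≤ 1)
    (ha : |a - 1| ≤ 2 ^ n * τ ^ n) (hc : |c + 1| ≤ 2 ^ n * τ ^ n) {f f' lam w p p' : ℂ}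
    (hp : p = ((n : ℂ) - 1) / 2 * f ^ n) (hp' : p' = ((n : ℂ) - 1) / 2 * f' ^ n)
    (hff : f * f' = τ ^ 2 / 4) (hf : ‖f‖ ≤ 1) (hf' : ‖f'‖ ≤ τ) (hlam : ‖lam‖ ≤ 5)
    (hlam' : ‖lam⁻¹‖ ≤ 4) (hlam0 : lam ≠ 0) (hpn : ‖p‖ ≤ 2 / 3)
    (hlamn : lam ^ n = (1 - p') / (1 - p))
    (hw : w = τ * ((a + c) / 2) + (a - c) / 2 * (f * lam + f' * lam⁻¹)) :
    ‖w‖ ≤ 10 ∧ ‖p'‖ ≤ n * τ ^ 2 ∧ ‖((n : ℂ) - 1) / 2 * w ^ n - p / (1 - p)‖ ≤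
      (n * (n * 10 ^ n * (10 * 2 ^ n) + n * 2 ^ n * (5 ^ n + 4 ^ n)) + 2 * n) * τ ^ 2 := by
  have hn1 : (3 : ℝ) ≤ n := by exact_mod_cast hn
  have hτpow : τ ^ n ≤ τ ^ 2 := pow_le_pow_of_le_one hτ0.le hτ (by omega)
  have hα : ‖((n : ℂ) - 1) / 2‖ ≤ n := by
    have : ((n : ℂ) - 1) / 2 = ((((n : ℝ) - 1) / 2 : ℝ) : ℂ) := by push_cast; rfl
    rw [this, Complex.norm_real, Real.norm_of_nonneg (by linarith)]
    linarith
  set ζ := f * lam with hζ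
  set ζ' := f' * lam⁻¹ with hζ'
  have hζn : ‖ζ‖ ≤ 5 := by
    rw [hζ, norm_mul]
    nlinarith [norm_nonneg f, norm_nonneg lam]
  have hζn' : ‖ζ'‖ ≤ 4 * τ := by
    rw [hζ', norm_mul]
    nlinarith [norm_nonneg f', norm_nonneg lam⁻¹]
  have hζζ : ζ * ζ' = τ ^ 2 / 4 := by
    rw [hζ, hζ', ← hff]; field_simp
  have hadd : ‖ζ + ζ'‖ ≤ 9 := (norm_add_le _ _).trans (by linarith)
  have hcast : ∀ x : ℝ, ‖(x : ℂ)‖ = |x| := fun x => by simp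
  have hm : ‖(((a + c) / 2 : ℝ) : ℂ)‖ ≤ 2 ^ n * τ ^ 2 := by
    rw [hcast]
    have : (a + c) / 2 = ((a - 1) + (c + 1)) / 2 := by ring
    rw [this, abs_div, abs_two]
    have := abs_add_le (a - 1) (c + 1)
    have : 2 ^ n * τ ^ n ≤ 2 ^ n * τ ^ 2 := by gcongr
    linarith
  have hρ : ‖(((a - c) / 2 - 1 : ℝ) : ℂ)‖ ≤ 2 ^ n * τ ^ 2 := by
    rw [hcast]
    have : (a - c) / 2 - 1 = ((a - 1) - (c + 1)) / 2 := by ring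
    rw [this, abs_div, abs_two]
    have := abs_sub (a - 1) (c + 1)
    have : 2 ^ n * τ ^ n ≤ 2 ^ n * τ ^ 2 := by gcongr
    linarith
  -- The centre `(a + c)/2` and the deviation of `(a - c)/2` from 1 are `O(τⁿ)`, hence `O(τ²)`.
  have hdiff : ‖w - (ζ + ζ')‖ ≤ 10 * 2 ^ n * τ ^ 2 := by
    have : w - (ζ + ζ') = τ * (((a + c) / 2 : ℝ) : ℂ) + (((a - c) / 2 - 1 : ℝ) : ℂ) * (ζ + ζ') := by
      rw [hw]; push_cast; ring
    rw [this]
    refine (norm_add_le _ _).trans ?_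
    rw [norm_mul, norm_mul, hcast τ, abs_of_pos hτ0]
    have h1 : τ * ‖(((a + c) / 2 : ℝ) : ℂ)‖ ≤ 1 * (2 ^ n * τ ^ 2) := by gcongr
    have h2 : ‖(((a - c) / 2 - 1 : ℝ) : ℂ)‖ * ‖ζ + ζ'‖ ≤ 2 ^ n * τ ^ 2 * 9 := by gcongr
    linarith
  have hwn : ‖w‖ ≤ 10 := by
    have := norm_add_le (w - (ζ + ζ')) (ζ + ζ')
    rw [sub_add_cancel] at this
    linarith
  have hp'n : ‖p'‖ ≤ n * τ ^ 2 := by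
    rw [hp', norm_mul, norm_pow]
    have : ‖f'‖ ^ n ≤ τ ^ 2 := (pow_le_pow_left₀ (norm_nonneg _) hf' n).trans hτpow
    gcongr
  refine ⟨hwn, hp'n, ?_⟩
  have h1p : 1 / 3 ≤ ‖1 - p‖ := by
    have := norm_sub_norm_le (1 : ℂ) p
    rw [norm_one] at this
    linarith
  have h1p0 : 1 - p ≠ 0 := norm_pos_iff.1 (by linarith)
  -- The left term is exactly `p (1 - p') / (1 - p)`, so the error is proportional to `p'`, which is
  -- `O(τ²)`.
  have e1 : ((n : ℂ) - 1) / 2 * ζ ^ n - p / (1 - p) = -(p * p' / (1 - p)) := by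
    rw [hζ, mul_pow, hlamn, ← mul_assoc, ← hp]
    field_simp
    ring
  have e2 : ‖p * p' / (1 - p)‖ ≤ 2 * n * τ ^ 2 := by
    rw [norm_div, norm_mul, div_le_iff₀ (by linarith)]
    have : ‖p‖ * ‖p'‖ ≤ 2 / 3 * (n * τ ^ 2) := by gcongr
    have : 2 * n * τ ^ 2 * (1 / 3) ≤ 2 * n * τ ^ 2 * ‖1 - p‖ := by gcongr
    linarith
  have e3 : ‖w ^ n - ζ ^ n‖ ≤
      (n * 10 ^ n * (10 * 2 ^ n) + n * 2 ^ n * (5 ^ n + 4 ^ n)) * τ ^ 2 := by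
    have h1 := norm_pow_sub_pow_le (M := 10) hwn (hadd.trans (by norm_num)) n
    have h2 := norm_add_pow_sub_pow_le hn hτ0 hτ hζζ hζn hζn'
    have h3 : (10 : ℝ) ^ (n - 1) ≤ 10 ^ n := pow_le_pow_right₀ (by norm_num) (by omega)
    have h4 : (n : ℝ) * 10 ^ (n - 1) * ‖w - (ζ + ζ')‖ ≤ n * 10 ^ n * (10 * 2 ^ n * τ ^ 2) := by
      gcongr
    have h5 := norm_add_le (w ^ n - (ζ + ζ') ^ n) ((ζ + ζ') ^ n - ζ ^ n)
    rw [sub_add_sub_cancel] at h5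
    linarith
  have e4 : ((n : ℂ) - 1) / 2 * w ^ n - p / (1 - p) =
      ((n : ℂ) - 1) / 2 * (w ^ n - ζ ^ n) + (((n : ℂ) - 1) / 2 * ζ ^ n - p / (1 - p)) := by ring
  rw [e4, e1]
  refine (norm_add_le _ _).trans ?_
  rw [norm_mul, norm_neg]
  have : ‖((n : ℂ) - 1) / 2‖ * ‖w ^ n - ζ ^ n‖ ≤
      n * ((n * 10 ^ n * (10 * 2 ^ n) + n * 2 ^ n * (5 ^ n + 4 ^ n)) * τ ^ 2) := by gcongr
  linarith

/-- Bounds for the coefficients of `curveP` and `curveR`. -/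
theorem norm_coeff_le {n : ℕ} (hn : 3 ≤ n) :
    ‖((n : ℂ) * (n - 1) / 2)‖ ≤ (n : ℝ) ^ 2 ∧ ‖((n : ℂ) * (n - 2) / 4)‖ ≤ (n : ℝ) ^ 2 ∧
      ‖((n : ℂ) - 2)‖ ≤ n ∧ ‖((n : ℂ) ^ 2 / 4)‖ ≤ (n : ℝ) ^ 2 := by
  have hn1 : (3 : ℝ) ≤ n := by exact_mod_cast hn
  have hcast : ∀ x : ℝ, 0 ≤ x → ‖(x : ℂ)‖ = x := fun x hx => by simp [abs_of_nonneg hx]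
  refine ⟨?_, ?_, ?_, ?_⟩
  · have : ((n : ℂ) * (n - 1) / 2) = (((n : ℝ) * (n - 1) / 2 : ℝ) : ℂ) := by push_cast; rfl
    rw [this, hcast _ (by nlinarith)]; nlinarith
  · have : ((n : ℂ) * (n - 2) / 4) = (((n : ℝ) * (n - 2) / 4 : ℝ) : ℂ) := by push_cast; rfl
    rw [this, hcast _ (by nlinarith)]; nlinarith
  · have : ((n : ℂ) - 2) = (((n : ℝ) - 2 : ℝ) : ℂ) := by push_cast; rfl
    rw [this, hcast _ (by linarith)]; linarith
  · have : ((n : ℂ) ^ 2 / 4) = (((n : ℝ) ^ 2 / 4 : ℝ) : ℂ) := by push_cast; rfl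
    rw [this, hcast _ (by positivity)]; nlinarith

/-- The functions `curveP`, `curveR` and `curveQ` in terms of the coordinate `p`, up to `O(τ²)`. -/
theorem exists_approx_curve {n : ℕ} (hn : 3 ≤ n) :
    ∃ K > 0, ∃ τ₀ > 0, τ₀ ≤ 1 ∧ ∀ τ : ℝ, 0 < τ → τ < τ₀ → ∀ a c : ℝ,
      |a - 1| ≤ 2 ^ n * τ ^ n → |c + 1| ≤ 2 ^ n * τ ^ n → ∀ f f' lam y p p' : ℂ,
      p = ((n : ℂ) - 1) / 2 * f ^ n → p' = ((n : ℂ) - 1) / 2 * f' ^ n →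
      f * f' = τ ^ 2 / 4 → ‖f‖ ≤ 1 → ‖f'‖ ≤ τ → ‖lam‖ ≤ 5 → ‖lam⁻¹‖ ≤ 4 → lam ≠ 0 →
      ‖p‖ ≤ 2 / 3 → lam ^ n = (1 - p') / (1 - p) →
      τ * y = τ * ((a + c) / 2) + (a - c) / 2 * (f * lam + f' * lam⁻¹) →
      ‖curveP n ((τ : ℂ) ^ n) y - (1 - (n - 1) * p) / (1 - p)‖ ≤ K * τ ^ 2 ∧
      ‖curveR n ((τ : ℂ) ^ n) y - (1 + p) / (1 - p)‖ ≤ K * τ ^ 2 ∧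
      ‖curveQ n ((τ : ℂ) ^ n) a c y - 1‖ ≤ K * τ ^ 2 ∧ ‖p'‖ ≤ K * τ ^ 2 := by
  have hn1 : (3 : ℝ) ≤ n := by exact_mod_cast hn
  set K₁ : ℝ := n * (n * 10 ^ n * (10 * 2 ^ n) + n * 2 ^ n * (5 ^ n + 4 ^ n)) + 2 * n with hK₁
  have hK₁0 : 0 < K₁ := by positivity
  refine ⟨n ^ 2 * 100 ^ n * 2 + n * K₁, by positivity,
    1 / (10 * 2 ^ n), by positivity, ?_, ?_⟩
  · rw [div_le_one (by positivity)]
    have : (1 : ℝ) ≤ 2 ^ n := one_le_pow₀ (by norm_num)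
    linarith
  intro τ hτ0 hτlt a c ha hc f f' lam y p p' hp hp' hff hf hf' hlam hlam' hlam0 hpn hlamn hy
  have h2n : (1 : ℝ) ≤ 2 ^ n := one_le_pow₀ (by norm_num)
  have hτ10 : τ * (10 * 2 ^ n) < 1 := (lt_div_iff₀ (by positivity)).1 hτlt
  have hτ1 : τ ≤ 1 := by nlinarith
  have hτ10' : τ ≤ 1 / 10 := by nlinarith
  have hτn : 10 * 2 ^ n * τ ^ 2 ≤ 1 := by nlinarith
  obtain ⟨hw, hp'n, hU⟩ := norm_scaled_pow_sub_le hn hτ0 hτ1 hτn ha hc hp hp' hff hf hf' hlam hlam'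
    hlam0 hpn hlamn hy
  rw [← hK₁] at hU
  set w : ℂ := τ * y with hwdef
  have hτc : (τ : ℂ) ≠ 0 := by exact_mod_cast hτ0.ne'
  have hyw : y = w / τ := by rw [hwdef]; field_simp
  have h1p : 1 / 3 ≤ ‖1 - p‖ := by
    have := norm_sub_norm_le (1 : ℂ) p
    rw [norm_one] at this
    linarith
  have h1p0 : 1 - p ≠ 0 := norm_pos_iff.1 (by linarith)
  set U := ((n : ℂ) - 1) / 2 * w ^ n - p / (1 - p) with hUdef
  -- powers of the scaled height
  have s1 : (τ : ℂ) ^ n * y ^ n = w ^ n := by rw [hwdef, mul_pow]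
  have s2 : (τ : ℂ) ^ n * y ^ (n - 2) = τ ^ 2 * w ^ (n - 2) := by
    rw [hwdef, mul_pow, ← mul_assoc, ← pow_add, show 2 + (n - 2) = n by omega]
  have s3 : ((τ : ℂ) ^ n) ^ 2 * y ^ (2 * n - 2) = τ ^ 2 * w ^ (2 * n - 2) := by
    rw [hwdef, mul_pow, ← mul_assoc, ← pow_add, ← pow_mul, show 2 + (2 * n - 2) = n * 2 by omega]
  have hτ2 : ‖(τ : ℂ) ^ 2‖ = τ ^ 2 := by
    rw [norm_pow, Complex.norm_real, Real.norm_of_nonneg hτ0.le]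
  have b1 : ‖(τ : ℂ) ^ 2 * w ^ (n - 2)‖ ≤ τ ^ 2 * 100 ^ n := by
    rw [norm_mul, hτ2, norm_pow]
    have : ‖w‖ ^ (n - 2) ≤ 100 ^ n :=
      (pow_le_pow_left₀ (norm_nonneg _) (hw.trans (by norm_num : (10 : ℝ) ≤ 100)) _).trans
        (pow_le_pow_right₀ (by norm_num) (by omega))
    gcongr
  have b2 : ‖(τ : ℂ) ^ 2 * w ^ (2 * n - 2)‖ ≤ τ ^ 2 * 100 ^ n := by
    rw [norm_mul, hτ2, norm_pow]
    have : ‖w‖ ^ (2 * n - 2) ≤ 100 ^ n :=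
      (pow_le_pow_left₀ (norm_nonneg _) hw _).trans
        ((pow_le_pow_right₀ (by norm_num) (by omega : 2 * n - 2 ≤ 2 * n)).trans
          (by rw [pow_mul]; norm_num))
    gcongr
  obtain ⟨k1, k2, k3, k4⟩ := norm_coeff_le hn
  have htail : (0 : ℝ) ≤ n ^ 2 * 100 ^ n * τ ^ 2 := by positivity
  have htail2 : 0 ≤ n * K₁ * τ ^ 2 := by positivity
  refine ⟨?_, ?_, ?_, ?_⟩
  -- Only the terms with `ε yⁿ = wⁿ` survive: replacing `(n-1)/2 · wⁿ` by `p/(1-p)` gives `1 - (n-2)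
  -- p/(1-p)`, the main term. The other two terms carry a factor `τ²`.
  · have e : curveP n ((τ : ℂ) ^ n) y - (1 - (n - 1) * p) / (1 - p) =
        (n * (n - 1) / 2) * (τ ^ 2 * w ^ (n - 2)) - (n - 2) * U -
          (n * (n - 2) / 4) * (τ ^ 2 * w ^ (2 * n - 2)) := by
      rw [← s2, ← s3, hUdef, ← s1, curveP]
      field_simp
      ring
    rw [e]
    refine (norm_sub_le _ _).trans ?_
    refine (add_le_add_left (norm_sub_le _ _) _).trans ?_
    rw [norm_mul (n * (n - 1) / 2 : ℂ), norm_mul (n - 2 : ℂ), norm_mul (n * (n - 2) / 4 : ℂ)]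
    have m1 : ‖((n : ℂ) * (n - 1) / 2)‖ * ‖(τ : ℂ) ^ 2 * w ^ (n - 2)‖ ≤
        n ^ 2 * (τ ^ 2 * 100 ^ n) := by gcongr
    have m2 : ‖((n : ℂ) - 2)‖ * ‖U‖ ≤ n * (K₁ * τ ^ 2) := by gcongr
    have m3 : ‖((n : ℂ) * (n - 2) / 4)‖ * ‖(τ : ℂ) ^ 2 * w ^ (2 * n - 2)‖ ≤
        n ^ 2 * (τ ^ 2 * 100 ^ n) := by gcongr
    linarith
  · have e : curveR n ((τ : ℂ) ^ n) y - (1 + p) / (1 - p) =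
        2 * U + (n ^ 2 / 4) * (τ ^ 2 * w ^ (2 * n - 2)) := by
      rw [← s3, hUdef, ← s1, curveR]
      field_simp
      ring
    rw [e]
    refine (norm_add_le _ _).trans ?_
    rw [norm_mul 2, norm_mul (n ^ 2 / 4 : ℂ), Complex.norm_two]
    have m2 : 2 * ‖U‖ ≤ n * (K₁ * τ ^ 2) := by
      have : (2 : ℝ) ≤ n := by linarith
      gcongr
    have m3 : ‖((n : ℂ) ^ 2 / 4)‖ * ‖(τ : ℂ) ^ 2 * w ^ (2 * n - 2)‖ ≤
        n ^ 2 * (τ ^ 2 * 100 ^ n) := by gcongr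
    linarith
  -- All three arguments are at most `10/τ`, and `τⁿ (10/τ)^{n-2}` is `O(τ²)`.
  · have hY : 2 ≤ 10 / τ := by rw [le_div_iff₀ hτ0]; linarith
    have hpow1 : (2 : ℝ) ^ n * τ ^ n ≤ 1 := by
      have : τ ^ n ≤ τ ^ 2 := pow_le_pow_of_le_one hτ0.le hτ1 (by omega)
      nlinarith
    have ha2 : ‖(a : ℂ)‖ ≤ 10 / τ := by
      rw [Complex.norm_real, Real.norm_eq_abs]
      refine le_trans ?_ hY
      have := abs_add_le (a - 1) 1
      rw [sub_add_cancel, abs_one] at this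
      linarith
    have hc2 : ‖(c : ℂ)‖ ≤ 10 / τ := by
      rw [Complex.norm_real, Real.norm_eq_abs]
      refine le_trans ?_ hY
      have := abs_sub (c + 1) 1
      rw [add_sub_cancel_right, abs_one] at this
      linarith
    have hy2 : ‖y‖ ≤ 10 / τ := by
      rw [hyw, norm_div, Complex.norm_real, Real.norm_of_nonneg hτ0.le]
      gcongr
    refine (norm_curveQ_sub_one_le ha2 hc2 hy2).trans ?_
    rw [norm_pow, Complex.norm_real, Real.norm_of_nonneg hτ0.le]
    have e : τ ^ n * (n ^ 2 * (10 / τ) ^ (n - 2)) = n ^ 2 * 10 ^ (n - 2) * τ ^ 2 := by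
      have : τ ^ n = τ ^ (n - 2) * τ ^ 2 := by rw [← pow_add]; congr 1; omega
      rw [this, div_pow]
      field_simp
    rw [e]
    have : (10 : ℝ) ^ (n - 2) ≤ 100 ^ n :=
      (pow_le_pow_left₀ (by norm_num) (by norm_num : (10 : ℝ) ≤ 100) _).trans
        (pow_le_pow_right₀ (by norm_num) (by omega))
    have : (n : ℝ) ^ 2 * 10 ^ (n - 2) * τ ^ 2 ≤ n ^ 2 * 100 ^ n * τ ^ 2 := by gcongr
    linarith
  · have : (n : ℝ) * τ ^ 2 ≤ n * K₁ * τ ^ 2 := by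
      have h1 : 1 ≤ K₁ := by
        have : 0 ≤ (n : ℝ) * (n * 10 ^ n * (10 * 2 ^ n) + n * 2 ^ n * (5 ^ n + 4 ^ n)) := by
          positivity
        linarith
      have : (n : ℝ) ≤ n * K₁ := le_mul_of_one_le_right (by positivity) h1
      gcongr
    linarith

end PerturbedCircle

/-! ### The complex coordinate `φ`. -/

namespace PerturbedCircle

open Complex ComplexConjugate

/-- The coordinate `f`, in which the upper half of the strip is an annulus. -/
def fUp (τ : ℝ) (φ : ℂ) : ℂ := I * τ / 2 * exp (-(I * φ))

/-- The reflection of `fUp`. -/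
def fDn (τ : ℝ) (φ : ℂ) : ℂ := -(I * τ / 2) * exp (I * φ)

/-- The coordinate `p = (n - 1) / 2 * fⁿ`. -/
def pUp (n : ℕ) (τ : ℝ) (φ : ℂ) : ℂ := ((n : ℂ) - 1) / 2 * fUp τ φ ^ n

/-- The reflection of `pUp`. -/
def pDn (n : ℕ) (τ : ℝ) (φ : ℂ) : ℂ := ((n : ℂ) - 1) / 2 * fDn τ φ ^ n

/-- The angle `θ` in terms of the coordinate `φ`. -/
def thetaC (n : ℕ) (τ : ℝ) (φ : ℂ) : ℂ := φ - I / n * (log (1 - pUp n τ φ) - log (1 - pDn n τ φ))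

/-- The derivative of `thetaC`. -/
def dthetaC (n : ℕ) (τ : ℝ) (φ : ℂ) : ℂ := 1 / (1 - pUp n τ φ) + 1 / (1 - pDn n τ φ) - 1

/-- The height of the point of the complexified curve with coordinate `φ`. -/
def heightC (n : ℕ) (τ a c : ℝ) (φ : ℂ) : ℂ := (a + c) / 2 + (a - c) / 2 * sin (thetaC n τ φ)

/-- Complex conjugation exchanges the two coordinates; this allows the estimates to be made in the
upper half-plane only. -/
theorem fUp_conj (τ : ℝ) (φ : ℂ) : fUp τ (conj φ) = conj (fDn τ φ) := by
  have h2 : conj (2 : ℂ) = 2 := map_ofNat _ 2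
  simp only [fUp, fDn, map_mul, map_neg, map_div₀, conj_I, conj_ofReal, ← exp_conj, h2]
  rw [neg_mul]
  ring_nf

theorem pUp_conj (n : ℕ) (τ : ℝ) (φ : ℂ) : pUp n τ (conj φ) = conj (pDn n τ φ) := by
  have h2 : conj (2 : ℂ) = 2 := map_ofNat _ 2
  simp [pUp, pDn, fUp_conj, h2]

theorem pDn_conj (n : ℕ) (τ : ℝ) (φ : ℂ) : pDn n τ (conj φ) = conj (pUp n τ φ) := by
  have := pUp_conj n τ (conj φ)
  rw [conj_conj] at this
  rw [this, conj_conj]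

theorem norm_fUp {τ : ℝ} (hτ : 0 < τ) (φ : ℂ) : ‖fUp τ φ‖ = τ / 2 * Real.exp φ.im := by
  rw [fUp, norm_mul, norm_exp]
  simp [abs_of_pos hτ]

theorem norm_fDn {τ : ℝ} (hτ : 0 < τ) (φ : ℂ) : ‖fDn τ φ‖ = τ / 2 * Real.exp (-φ.im) := by
  rw [fDn, norm_mul, norm_exp]
  simp [abs_of_pos hτ]

theorem norm_alpha {n : ℕ} (hn : 3 ≤ n) : ‖((n : ℂ) - 1) / 2‖ = ((n : ℝ) - 1) / 2 := by
  have hn1 : (3 : ℝ) ≤ n := by exact_mod_cast hn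
  have : ((n : ℂ) - 1) / 2 = ((((n : ℝ) - 1) / 2 : ℝ) : ℂ) := by push_cast; rfl
  rw [this, norm_real, Real.norm_of_nonneg (by linarith)]

theorem norm_pUp {n : ℕ} (hn : 3 ≤ n) {τ : ℝ} (hτ : 0 < τ) (φ : ℂ) :
    ‖pUp n τ φ‖ = ((n : ℝ) - 1) / 2 * (τ / 2) ^ n * Real.exp (n * φ.im) := by
  rw [pUp, norm_mul, norm_pow, norm_fUp hτ, norm_alpha hn, mul_pow, ← Real.exp_nat_mul, mul_assoc]

theorem fUp_mul_fDn (τ : ℝ) (φ : ℂ) : fUp τ φ * fDn τ φ = τ ^ 2 / 4 := by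
  have h : exp (-(I * φ)) * exp (I * φ) = 1 := by rw [← exp_add]; simp
  rw [fUp, fDn]
  linear_combination (-(I * τ / 2) ^ 2) * h - τ ^ 2 / 4 * I_sq

theorem one_sub_mem_slitPlane {z : ℂ} (hz : ‖z‖ < 1) : 1 - z ∈ slitPlane := by
  refine Or.inl ?_
  have := (abs_le.1 (abs_re_le_norm z)).2
  simp only [sub_re, one_re]
  linarith

theorem thetaC_conj {n : ℕ} {τ : ℝ} {φ : ℂ} (h1 : ‖pUp n τ φ‖ < 1) (h2 : ‖pDn n τ φ‖ < 1) :
    thetaC n τ (conj φ) = conj (thetaC n τ φ) := by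
  have e1 : log (1 - conj (pDn n τ φ)) = conj (log (1 - pDn n τ φ)) := by
    rw [← log_conj _ (slitPlane_arg_ne_pi (one_sub_mem_slitPlane h2))]
    simp
  have e2 : log (1 - conj (pUp n τ φ)) = conj (log (1 - pUp n τ φ)) := by
    rw [← log_conj _ (slitPlane_arg_ne_pi (one_sub_mem_slitPlane h1))]
    simp
  rw [thetaC, thetaC, pUp_conj, pDn_conj, e1, e2]
  simp only [map_sub, map_mul, map_div₀, conj_I, map_natCast]
  ring

theorem dthetaC_conj (n : ℕ) (τ : ℝ) (φ : ℂ) : dthetaC n τ (conj φ) = conj (dthetaC n τ φ) := by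
  rw [dthetaC, dthetaC, pUp_conj, pDn_conj]
  simp only [map_sub, map_add, map_div₀, map_one]
  ring

theorem heightC_conj {n : ℕ} {τ a c : ℝ} {φ : ℂ} (h1 : ‖pUp n τ φ‖ < 1) (h2 : ‖pDn n τ φ‖ < 1) :
    heightC n τ a c (conj φ) = conj (heightC n τ a c φ) := by
  have h3 : conj (2 : ℂ) = 2 := map_ofNat _ 2
  rw [heightC, heightC, thetaC_conj h1 h2, sin_conj]
  simp [h3]

theorem fUp_add (τ : ℝ) (φ : ℂ) : fUp τ (φ + 2 * Real.pi) = fUp τ φ := by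
  have : -(I * (φ + 2 * Real.pi)) = -(I * φ) - 2 * Real.pi * I := by ring
  rw [fUp, fUp, this, exp_periodic.sub_eq]

theorem fDn_add (τ : ℝ) (φ : ℂ) : fDn τ (φ + 2 * Real.pi) = fDn τ φ := by
  have : I * (φ + 2 * Real.pi) = I * φ + 2 * Real.pi * I := by ring
  rw [fDn, fDn, this, exp_periodic]

theorem thetaC_add (n : ℕ) (τ : ℝ) (φ : ℂ) :
    thetaC n τ (φ + 2 * Real.pi) = thetaC n τ φ + 2 * Real.pi := by
  simp only [thetaC, pUp, pDn, fUp_add, fDn_add]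
  ring

theorem dthetaC_add (n : ℕ) (τ : ℝ) (φ : ℂ) :
    dthetaC n τ (φ + 2 * Real.pi) = dthetaC n τ φ := by
  simp only [dthetaC, pUp, pDn, fUp_add, fDn_add]

theorem heightC_add (n : ℕ) (τ a c : ℝ) (φ : ℂ) :
    heightC n τ a c (φ + 2 * Real.pi) = heightC n τ a c φ := by
  rw [heightC, heightC, thetaC_add, sin_add_two_pi]

theorem hasDerivAt_pUp {n : ℕ} (hn : 3 ≤ n) (τ : ℝ) (φ : ℂ) :
    HasDerivAt (pUp n τ) (-(n * I) * pUp n τ φ) φ := by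
  have h1 : HasDerivAt (fUp τ) (-I * fUp τ φ) φ := by
    have := (((hasDerivAt_id φ).const_mul I).neg.cexp).const_mul (I * τ / 2)
    refine this.congr_deriv ?_
    simp [fUp]
    ring
  refine ((h1.pow n).const_mul _).congr_deriv ?_
  have : fUp τ φ ^ n = fUp τ φ ^ (n - 1) * fUp τ φ := by
    rw [← pow_succ]; congr 1; omega
  rw [pUp, this]
  ring

theorem hasDerivAt_pDn {n : ℕ} (hn : 3 ≤ n) (τ : ℝ) (φ : ℂ) :
    HasDerivAt (pDn n τ) (n * I * pDn n τ φ) φ := by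
  have h1 : HasDerivAt (fDn τ) (I * fDn τ φ) φ := by
    have := (((hasDerivAt_id φ).const_mul I).cexp).const_mul (-(I * τ / 2))
    refine this.congr_deriv ?_
    simp [fDn]
    ring
  refine ((h1.pow n).const_mul _).congr_deriv ?_
  have : fDn τ φ ^ n = fDn τ φ ^ (n - 1) * fDn τ φ := by
    rw [← pow_succ]; congr 1; omega
  rw [pDn, this]
  ring

/-- Since `dp/dφ = -inp` and `dp'/dφ = inp'`, the two logarithms contribute `p/(1-p)` and
`p'/(1-p')`. The bounds by 1 keep `1 - p` and `1 - p'` off the cut. -/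
theorem hasDerivAt_thetaC {n : ℕ} (hn : 3 ≤ n) {τ : ℝ} {φ : ℂ} (h1 : ‖pUp n τ φ‖ < 1)
    (h2 : ‖pDn n τ φ‖ < 1) : HasDerivAt (thetaC n τ) (dthetaC n τ φ) φ := by
  have hn0 : (n : ℂ) ≠ 0 := by
    have : n ≠ 0 := by omega
    exact_mod_cast this
  have l1 := ((hasDerivAt_pUp hn τ φ).const_sub 1).clog (one_sub_mem_slitPlane h1)
  have l2 := ((hasDerivAt_pDn hn τ φ).const_sub 1).clog (one_sub_mem_slitPlane h2)
  refine ((hasDerivAt_id φ).sub ((l1.sub l2).const_mul (I / n))).congr_deriv ?_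
  have n1 := one_sub_ne_zero_of_norm_lt h1
  have n2 := one_sub_ne_zero_of_norm_lt h2
  rw [dthetaC]
  field_simp
  linear_combination (-(pUp n τ φ * (1 - pDn n τ φ) + pDn n τ φ * (1 - pUp n τ φ))) * I_sq

/-- The approximation of the curve in the coordinate `φ`. -/
theorem exists_approx {n : ℕ} (hn : 3 ≤ n) :
    ∃ K > 0, ∃ τ₀ > 0, τ₀ ≤ 1 ∧ ∀ τ : ℝ, 0 < τ → τ < τ₀ → ∀ a c : ℝ,
      |a - 1| ≤ 2 ^ n * τ ^ n → |c + 1| ≤ 2 ^ n * τ ^ n →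
      ∀ φ : ℂ, 0 ≤ φ.im → ‖pUp n τ φ‖ ≤ 2 / 3 →
      ‖curveP n ((τ : ℂ) ^ n) (heightC n τ a c φ) -
        (1 - (n - 1) * pUp n τ φ) / (1 - pUp n τ φ)‖ ≤ K * τ ^ 2 ∧
      ‖curveR n ((τ : ℂ) ^ n) (heightC n τ a c φ) -
        (1 + pUp n τ φ) / (1 - pUp n τ φ)‖ ≤ K * τ ^ 2 ∧
      ‖curveQ n ((τ : ℂ) ^ n) a c (heightC n τ a c φ) - 1‖ ≤ K * τ ^ 2 ∧
      ‖dthetaC n τ φ - 1 / (1 - pUp n τ φ)‖ ≤ K * τ ^ 2 ∧ ‖pDn n τ φ‖ ≤ 1 / 2 := by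
  have hn1 : (3 : ℝ) ≤ n := by exact_mod_cast hn
  obtain ⟨K, hK, τ₀, hτ₀, hτ₀1, H⟩ := exists_approx_curve hn
  refine ⟨2 * K, by positivity, min τ₀ (1 / (2 * n)), by positivity,
    (min_le_left _ _).trans hτ₀1, ?_⟩
  intro τ hτ hlt a c ha hc φ him hp
  have hτ1 : τ < τ₀ := hlt.trans_le (min_le_left _ _)
  have hτ2 : τ * (2 * n) < 1 := (lt_div_iff₀ (by positivity)).1 (hlt.trans_le (min_le_right _ _))
  have hτle : τ ≤ 1 := hτ1.le.trans hτ₀1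
  set p := pUp n τ φ with hpdef
  set p' := pDn n τ φ with hp'def
  have hf' : ‖fDn τ φ‖ ≤ τ := by
    rw [norm_fDn hτ]
    have : Real.exp (-φ.im) ≤ 1 := Real.exp_le_one_iff.2 (by linarith)
    nlinarith
  -- Otherwise `‖p‖ ≥ (n-1)/2 ≥ 1`.
  have hf : ‖fUp τ φ‖ ≤ 1 := by
    by_contra! h
    have h2 : ‖p‖ = ((n : ℝ) - 1) / 2 * ‖fUp τ φ‖ ^ n := by
      rw [hpdef, pUp, norm_mul, norm_pow, norm_alpha hn]
    have h3 : 1 ≤ ‖fUp τ φ‖ ^ n := one_le_pow₀ h.le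
    nlinarith
  have hp' : ‖p'‖ ≤ 1 / 2 := by
    rw [hp'def, pDn, norm_mul, norm_pow, norm_alpha hn]
    have h3 : ‖fDn τ φ‖ ^ n ≤ τ :=
      (pow_le_pow_left₀ (norm_nonneg _) hf' n).trans
        ((pow_le_pow_of_le_one hτ.le hτle (by omega : 1 ≤ n)).trans (by simp))
    calc ((n : ℝ) - 1) / 2 * ‖fDn τ φ‖ ^ n ≤ ((n : ℝ) - 1) / 2 * τ := by
          apply mul_le_mul_of_nonneg_left h3 (by linarith)
      _ ≤ 1 / 2 := by nlinarith
  have n1 : 1 - p ≠ 0 := one_sub_ne_zero_of_norm_lt (by linarith)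
  have n2 : 1 - p' ≠ 0 := one_sub_ne_zero_of_norm_lt (by linarith)
  have hn0 : (n : ℂ) ≠ 0 := by
    have : n ≠ 0 := by omega
    exact_mod_cast this
  set L := log (1 - p) - log (1 - p') with hL
  -- By the choice of `thetaC`, `e^{-iθ} = e^{-iφ} lam`, with `lam` an `n`-th root of
  -- `(1-p')/(1-p)`; this produces the height in the form that `exists_approx_curve` requires.
  set lam := exp (-(L / n)) with hlam
  have hlam0 : lam ≠ 0 := exp_ne_zero _
  have hlamn : lam ^ n = (1 - p') / (1 - p) := by
    rw [hlam, ← exp_nat_mul]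
    have : (n : ℂ) * -(L / n) = log (1 - p') - log (1 - p) := by
      rw [hL]; field_simp; ring
    rw [this, exp_sub, exp_log n1, exp_log n2]
  have b1 : 1 / 3 ≤ ‖1 - p‖ := by
    have := norm_sub_norm_le (1 : ℂ) p
    rw [norm_one] at this
    linarith
  have b2 : ‖1 - p‖ ≤ 5 / 3 := by
    have := norm_sub_le (1 : ℂ) p
    rw [norm_one] at this
    linarith
  have b3 : 1 / 2 ≤ ‖1 - p'‖ := by
    have := norm_sub_norm_le (1 : ℂ) p'
    rw [norm_one] at this
    linarith
  have b4 : ‖1 - p'‖ ≤ 3 / 2 := by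
    have := norm_sub_le (1 : ℂ) p'
    rw [norm_one] at this
    linarith
  have hlam5 : ‖lam‖ ≤ 5 := by
    refine le_of_pow_le_pow_left₀ (by omega : n ≠ 0) (by norm_num) ?_
    rw [← norm_pow, hlamn, norm_div]
    refine le_trans ?_ (le_self_pow₀ (by norm_num : (1 : ℝ) ≤ 5) (by omega : n ≠ 0))
    rw [div_le_iff₀ (by linarith)]
    linarith
  have hlam4 : ‖lam⁻¹‖ ≤ 4 := by
    refine le_of_pow_le_pow_left₀ (by omega : n ≠ 0) (by norm_num) ?_
    rw [← norm_pow, inv_pow, hlamn, inv_div, norm_div]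
    refine le_trans ?_ (le_self_pow₀ (by norm_num : (1 : ℝ) ≤ 4) (by omega : n ≠ 0))
    rw [div_le_iff₀ (by linarith)]
    linarith
  have hy : τ * heightC n τ a c φ =
      τ * ((a + c) / 2) + (a - c) / 2 * (fUp τ φ * lam + fDn τ φ * lam⁻¹) := by
    have e1 : exp (-thetaC n τ φ * I) = exp (-(I * φ)) * lam := by
      rw [hlam, ← exp_add]
      congr 1
      rw [thetaC, ← hpdef, ← hp'def, ← hL]
      linear_combination (L / n) * I_sq
    have e2 : exp (thetaC n τ φ * I) = exp (I * φ) * lam⁻¹ := by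
      rw [hlam, ← exp_neg, ← exp_add]
      congr 1
      rw [thetaC, ← hpdef, ← hp'def, ← hL]
      linear_combination (-(L / n)) * I_sq
    rw [heightC, sin, e1, e2, fUp, fDn]
    ring
  obtain ⟨r1, r2, r3, r4⟩ := H τ hτ hτ1 a c ha hc (fUp τ φ) (fDn τ φ) lam (heightC n τ a c φ) p p'
    rfl rfl (fUp_mul_fDn τ φ) hf hf' hlam5 hlam4 hlam0 hp hlamn hy
  have hKτ : K * τ ^ 2 ≤ 2 * K * τ ^ 2 := by nlinarith [mul_pos hK (sq_pos_of_pos hτ)]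
  refine ⟨r1.trans hKτ, r2.trans hKτ, r3.trans hKτ, ?_, hp'⟩
  have e : dthetaC n τ φ - 1 / (1 - p) = p' / (1 - p') := by
    rw [dthetaC, ← hpdef, ← hp'def]
    field_simp
    ring
  rw [e, norm_div, div_le_iff₀ (by linarith)]
  nlinarith [mul_pos hK (sq_pos_of_pos hτ)]

end PerturbedCircle

/-! ### Continuation of the density and of the curvature in the coordinate `φ`. -/

namespace PerturbedCircle

open Complex ComplexConjugate

/-- `curveP` in the coordinate `φ`. -/
def coordP (n : ℕ) (τ a c : ℝ) (φ : ℂ) : ℂ := curveP n ((τ : ℂ) ^ n) (heightC n τ a c φ)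

/-- `curveR` in the coordinate `φ`. -/
def coordR (n : ℕ) (τ a c : ℝ) (φ : ℂ) : ℂ := curveR n ((τ : ℂ) ^ n) (heightC n τ a c φ)

/-- `curveQ` in the coordinate `φ`. -/
def coordQ (n : ℕ) (τ a c : ℝ) (φ : ℂ) : ℂ := curveQ n ((τ : ℂ) ^ n) a c (heightC n τ a c φ)

/-- The analytic continuation of `C dξ/dφ`. -/
def coordH (n : ℕ) (τ a c : ℝ) (φ : ℂ) : ℂ :=
  coordP n τ a c φ ^ ((2 / 3 : ℝ) : ℂ) * coordR n τ a c φ ^ ((-(1 / 2) : ℝ) : ℂ) *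
    coordQ n τ a c φ ^ ((-(1 / 2) : ℝ) : ℂ) * dthetaC n τ φ

/-- The analytic continuation of the curvature. -/
def coordK (n : ℕ) (τ a c : ℝ) (φ : ℂ) : ℂ :=
  coordP n τ a c φ * coordR n τ a c φ ^ ((-(3 / 2) : ℝ) : ℂ)

/-- The modulus of `pUp` at height `σ`. -/
def radius (n : ℕ) (τ σ : ℝ) : ℝ := ((n : ℝ) - 1) / 2 * (τ / 2) ^ n * Real.exp (n * σ)

/-- The set of points where the continuations are regular. -/
def RegularAt (n : ℕ) (τ a c : ℝ) (φ : ℂ) : Prop :=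
  ‖pUp n τ φ‖ < 1 ∧ ‖pDn n τ φ‖ < 1 ∧ coordP n τ a c φ ∈ slitPlane ∧
    coordR n τ a c φ ∈ slitPlane ∧ coordQ n τ a c φ ∈ slitPlane

theorem conj_mem_slitPlane {z : ℂ} (h : z ∈ slitPlane) : conj z ∈ slitPlane := by
  rcases h with h | h
  · exact Or.inl (by simpa using h)
  · exact Or.inr (by simpa using h)

theorem coordP_conj {n : ℕ} {τ : ℝ} (a c : ℝ) {φ : ℂ} (h1 : ‖pUp n τ φ‖ < 1)
    (h2 : ‖pDn n τ φ‖ < 1) : coordP n τ a c (conj φ) = conj (coordP n τ a c φ) := by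
  have h2' : conj (2 : ℂ) = 2 := map_ofNat _ 2
  have h4' : conj (4 : ℂ) = 4 := map_ofNat _ 4
  simp [coordP, heightC_conj h1 h2, curveP, h2', h4']

theorem coordR_conj {n : ℕ} {τ : ℝ} (a c : ℝ) {φ : ℂ} (h1 : ‖pUp n τ φ‖ < 1)
    (h2 : ‖pDn n τ φ‖ < 1) : coordR n τ a c (conj φ) = conj (coordR n τ a c φ) := by
  have h4' : conj (4 : ℂ) = 4 := map_ofNat _ 4
  simp [coordR, heightC_conj h1 h2, curveR, h4']

theorem coordQ_conj {n : ℕ} {τ : ℝ} (a c : ℝ) {φ : ℂ} (h1 : ‖pUp n τ φ‖ < 1)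
    (h2 : ‖pDn n τ φ‖ < 1) : coordQ n τ a c (conj φ) = conj (coordQ n τ a c φ) := by
  simp [coordQ, heightC_conj h1 h2, curveQ, map_sum]

theorem RegularAt.conj {n : ℕ} {τ a c : ℝ} {φ : ℂ} (h : RegularAt n τ a c φ) :
    RegularAt n τ a c (conj φ) := by
  obtain ⟨h1, h2, h3, h4, h5⟩ := h
  refine ⟨?_, ?_, ?_, ?_, ?_⟩
  · rwa [pUp_conj, norm_conj]
  · rwa [pDn_conj, norm_conj]
  · rw [coordP_conj a c h1 h2]; exact conj_mem_slitPlane h3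
  · rw [coordR_conj a c h1 h2]; exact conj_mem_slitPlane h4
  · rw [coordQ_conj a c h1 h2]; exact conj_mem_slitPlane h5

theorem norm_coordH (n : ℕ) (τ a c : ℝ) (φ : ℂ) :
    ‖coordH n τ a c φ‖ = ‖coordP n τ a c φ‖ ^ (2 / 3 : ℝ) * ‖coordR n τ a c φ‖ ^ (-(1 / 2) : ℝ) *
      ‖coordQ n τ a c φ‖ ^ (-(1 / 2) : ℝ) * ‖dthetaC n τ φ‖ := by
  rw [coordH, norm_mul, norm_mul, norm_mul, norm_cpow_real, norm_cpow_real, norm_cpow_real]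

theorem norm_coordH_conj {n : ℕ} {τ : ℝ} (a c : ℝ) {φ : ℂ} (h1 : ‖pUp n τ φ‖ < 1)
    (h2 : ‖pDn n τ φ‖ < 1) : ‖coordH n τ a c (conj φ)‖ = ‖coordH n τ a c φ‖ := by
  rw [norm_coordH, norm_coordH, coordP_conj a c h1 h2, coordR_conj a c h1 h2,
    coordQ_conj a c h1 h2, dthetaC_conj, norm_conj, norm_conj, norm_conj, norm_conj]

theorem coordH_add (n : ℕ) (τ a c : ℝ) (φ : ℂ) :
    coordH n τ a c (φ + 2 * Real.pi) = coordH n τ a c φ := by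
  simp only [coordH, coordP, coordR, coordQ, heightC_add, dthetaC_add]

theorem differentiableAt_heightC {n : ℕ} (hn : 3 ≤ n) {τ : ℝ} (a c : ℝ) {φ : ℂ}
    (h1 : ‖pUp n τ φ‖ < 1) (h2 : ‖pDn n τ φ‖ < 1) :
    DifferentiableAt ℂ (heightC n τ a c) φ := by
  have := (hasDerivAt_thetaC hn h1 h2).differentiableAt
  exact (this.csin.const_mul _).const_add _

theorem differentiableAt_coordP {n : ℕ} (hn : 3 ≤ n) {τ : ℝ} (a c : ℝ) {φ : ℂ}
    (h1 : ‖pUp n τ φ‖ < 1) (h2 : ‖pDn n τ φ‖ < 1) :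
    DifferentiableAt ℂ (coordP n τ a c) φ := by
  have := differentiableAt_heightC hn a c h1 h2
  unfold coordP curveP
  fun_prop

theorem differentiableAt_coordR {n : ℕ} (hn : 3 ≤ n) {τ : ℝ} (a c : ℝ) {φ : ℂ}
    (h1 : ‖pUp n τ φ‖ < 1) (h2 : ‖pDn n τ φ‖ < 1) :
    DifferentiableAt ℂ (coordR n τ a c) φ := by
  have := differentiableAt_heightC hn a c h1 h2
  unfold coordR curveR
  fun_prop

theorem differentiableAt_coordQ {n : ℕ} (hn : 3 ≤ n) {τ : ℝ} (a c : ℝ) {φ : ℂ}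
    (h1 : ‖pUp n τ φ‖ < 1) (h2 : ‖pDn n τ φ‖ < 1) :
    DifferentiableAt ℂ (coordQ n τ a c) φ := by
  have := differentiableAt_heightC hn a c h1 h2
  unfold coordQ curveQ
  fun_prop

theorem differentiableAt_dthetaC {n : ℕ} (hn : 3 ≤ n) {τ : ℝ} {φ : ℂ}
    (h1 : ‖pUp n τ φ‖ < 1) (h2 : ‖pDn n τ φ‖ < 1) :
    DifferentiableAt ℂ (dthetaC n τ) φ := by
  have d1 := (hasDerivAt_pUp hn τ φ).differentiableAt
  have d2 := (hasDerivAt_pDn hn τ φ).differentiableAt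
  have n1 := one_sub_ne_zero_of_norm_lt h1
  have n2 := one_sub_ne_zero_of_norm_lt h2
  unfold dthetaC
  exact (((differentiableAt_const _).div (d1.const_sub _) n1).add
    ((differentiableAt_const _).div (d2.const_sub _) n2)).sub_const _

namespace RegularAt

variable {n : ℕ} {τ a c : ℝ} {φ : ℂ}

theorem differentiableAt_coordH (hn : 3 ≤ n) (h : RegularAt n τ a c φ) :
    DifferentiableAt ℂ (coordH n τ a c) φ :=
  (((differentiableAt_coordP hn a c h.1 h.2.1).cpow_const h.2.2.1).mul
    ((differentiableAt_coordR hn a c h.1 h.2.1).cpow_const h.2.2.2.1)).mul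
    ((differentiableAt_coordQ hn a c h.1 h.2.1).cpow_const h.2.2.2.2) |>.mul
    (differentiableAt_dthetaC hn h.1 h.2.1)

theorem differentiableAt_coordK (hn : 3 ≤ n) (h : RegularAt n τ a c φ) :
    DifferentiableAt ℂ (coordK n τ a c) φ :=
  (differentiableAt_coordP hn a c h.1 h.2.1).mul ((differentiableAt_coordR hn a c h.1 h.2.1).cpow_const h.2.2.2.1)

theorem coordK_ne_zero (h : RegularAt n τ a c φ) : coordK n τ a c φ ≠ 0 := by
  refine mul_ne_zero (slitPlane_ne_zero h.2.2.1) ?_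
  rw [Ne, cpow_eq_zero_iff]
  exact fun h' => slitPlane_ne_zero h.2.2.2.1 h'.1

end RegularAt

theorem isOpen_regularAt {n : ℕ} (hn : 3 ≤ n) (τ a c : ℝ) :
    IsOpen {φ | RegularAt n τ a c φ} := by
  rw [isOpen_iff_mem_nhds]
  intro φ h
  have c1 := (hasDerivAt_pUp hn τ φ).continuousAt.norm.eventually_lt continuousAt_const h.1
  have c2 := (hasDerivAt_pDn hn τ φ).continuousAt.norm.eventually_lt continuousAt_const h.2.1
  have c3 := (differentiableAt_coordP hn a c h.1 h.2.1).continuousAt.eventually_mem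
    (isOpen_slitPlane.mem_nhds h.2.2.1)
  have c4 := (differentiableAt_coordR hn a c h.1 h.2.1).continuousAt.eventually_mem
    (isOpen_slitPlane.mem_nhds h.2.2.2.1)
  have c5 := (differentiableAt_coordQ hn a c h.1 h.2.1).continuousAt.eventually_mem
    (isOpen_slitPlane.mem_nhds h.2.2.2.2)
  filter_upwards [c1, c2, c3, c4, c5] with ψ a1 a2 a3 a4 a5
  exact ⟨a1, a2, a3, a4, a5⟩

/-- The effect of relative errors at most `s` on the product that defines `coordH`. -/
theorem density_error {P P₀ R R₀ Q d d₀ s : ℝ} (hs0 : 0 ≤ s) (hs : s ≤ 1 / 2) (hP₀ : 0 < P₀)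
    (hR₀ : 0 < R₀) (hd₀ : 0 < d₀) (hP : |P - P₀| ≤ s * P₀) (hR : |R - R₀| ≤ s * R₀)
    (hQ : |Q - 1| ≤ s) (hd : |d - d₀| ≤ s * d₀) :
    P₀ ^ (2 / 3 : ℝ) * R₀ ^ (-(1 / 2) : ℝ) * d₀ * (1 - 4 * s) ≤
      P ^ (2 / 3 : ℝ) * R ^ (-(1 / 2) : ℝ) * Q ^ (-(1 / 2) : ℝ) * d ∧
    P ^ (2 / 3 : ℝ) * R ^ (-(1 / 2) : ℝ) * Q ^ (-(1 / 2) : ℝ) * d ≤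
      P₀ ^ (2 / 3 : ℝ) * R₀ ^ (-(1 / 2) : ℝ) * d₀ * (1 + 16 * s) := by
  -- A power with exponent in `[0, 1]` does not enlarge the relative error.
  have h1 : ∀ e : ℝ, 0 ≤ e → e ≤ 1 → ∀ x : ℝ, 0 ≤ x → |x - 1| ≤ s →
      1 - s ≤ x ^ e ∧ x ^ e ≤ 1 + s := by
    intro e he0 he1 x hx0 hx
    obtain ⟨hx1, hx2⟩ := abs_le.1 hx
    constructor
    · calc 1 - s ≤ (1 - s) ^ e :=
            Real.self_le_rpow_of_le_one (by linarith) (by linarith) he1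
        _ ≤ x ^ e := Real.rpow_le_rpow (by linarith) (by linarith) he0
    · calc x ^ e ≤ (1 + s) ^ e := Real.rpow_le_rpow hx0 (by linarith) he0
        _ ≤ 1 + s := Real.rpow_le_self_of_one_le (by linarith) he1
  have h2 : ∀ x : ℝ, |x - 1| ≤ s →
      1 - s ≤ x ^ (-(1 / 2) : ℝ) ∧ x ^ (-(1 / 2) : ℝ) ≤ 1 + 2 * s := by
    intro x hx
    have hx0 : 0 < x := by linarith [(abs_le.1 hx).1]
    obtain ⟨y1, y2⟩ := h1 (1 / 2) (by norm_num) (by norm_num) x hx0.le hx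
    rw [Real.rpow_neg hx0.le, ← one_div]
    have hy : 0 < x ^ (1 / 2 : ℝ) := by linarith
    constructor
    · rw [le_div_iff₀ hy]; nlinarith
    · rw [div_le_iff₀ hy]; nlinarith
  have e1 : ∀ {x x₀ : ℝ}, 0 < x₀ → |x - x₀| ≤ s * x₀ → 0 ≤ x ∧ |x / x₀ - 1| ≤ s := by
    intro x x₀ h0 h
    refine ⟨by nlinarith [(abs_le.1 h).1], ?_⟩
    rw [div_sub_one h0.ne', abs_div, abs_of_pos h0, div_le_iff₀ h0]
    exact h
  obtain ⟨hP0, hP1⟩ := e1 hP₀ hP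
  obtain ⟨hR0, hR1⟩ := e1 hR₀ hR
  obtain ⟨hd0, hd1⟩ := e1 hd₀ hd
  obtain ⟨p1, p2⟩ := h1 (2 / 3) (by norm_num) (by norm_num) _ (div_nonneg hP0 hP₀.le) hP1
  obtain ⟨r1, r2⟩ := h2 _ hR1
  obtain ⟨q1, q2⟩ := h2 _ hQ
  obtain ⟨d1, d2⟩ := abs_le.1 hd1
  rw [Real.div_rpow hP0 hP₀.le] at p1 p2
  rw [Real.div_rpow hR0 hR₀.le] at r1 r2
  have hPp : 0 < P₀ ^ (2 / 3 : ℝ) := Real.rpow_pos_of_pos hP₀ _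
  have hRp : 0 < R₀ ^ (-(1 / 2) : ℝ) := Real.rpow_pos_of_pos hR₀ _
  set A := P ^ (2 / 3 : ℝ) / P₀ ^ (2 / 3 : ℝ) with hA
  set B := R ^ (-(1 / 2) : ℝ) / R₀ ^ (-(1 / 2) : ℝ) with hB
  set E := Q ^ (-(1 / 2) : ℝ) with hE
  set G := d / d₀ with hG
  have e : P ^ (2 / 3 : ℝ) * R ^ (-(1 / 2) : ℝ) * E * d =
      P₀ ^ (2 / 3 : ℝ) * R₀ ^ (-(1 / 2) : ℝ) * d₀ * (A * B * E * G) := by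
    rw [hA, hB, hG]; field_simp
  have hs1 : 0 ≤ 1 - s := by linarith
  rw [e]
  constructor
  · refine mul_le_mul_of_nonneg_left ?_ (by positivity)
    calc 1 - 4 * s ≤ (1 - s) * (1 - s) * (1 - s) * (1 - s) := by
          nlinarith [mul_nonneg hs0 hs0, mul_nonneg (mul_nonneg hs0 hs0) hs1,
            mul_nonneg (mul_nonneg hs0 hs0) (mul_nonneg hs1 hs1)]
      _ ≤ A * B * E * G := by
          have g1 : 1 - s ≤ G := by linarith
          have a1 : (1 - s) * (1 - s) ≤ A * B := mul_le_mul p1 r1 hs1 (by linarith)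
          have a2 : (1 - s) * (1 - s) * (1 - s) ≤ A * B * E :=
            mul_le_mul a1 q1 hs1 ((mul_nonneg hs1 hs1).trans a1)
          exact mul_le_mul a2 g1 hs1 ((mul_nonneg (mul_nonneg hs1 hs1) hs1).trans a2)
  · refine mul_le_mul_of_nonneg_left ?_ (by positivity)
    have hG2 : G ≤ 1 + s := by linarith
    have hA0 : 0 ≤ A := by linarith
    have hB0 : 0 ≤ B := by linarith
    have hE0 : 0 ≤ E := by linarith
    have hG0 : 0 ≤ G := by linarith
    calc A * B * E * G ≤ (1 + s) * (1 + 2 * s) * (1 + 2 * s) * (1 + s) := by gcongr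
      _ = ((1 + s) * (1 + 2 * s)) ^ 2 := by ring
      _ ≤ (1 + 4 * s) ^ 2 := by
          have : (1 + s) * (1 + 2 * s) ≤ 1 + 4 * s := by nlinarith
          gcongr
      _ ≤ 1 + 16 * s := by nlinarith

end PerturbedCircle

/-! ### Two-sided estimates of the density in the upper half-plane. -/

namespace PerturbedCircle

open Complex

set_option maxHeartbeats 1000000 in
/-- The estimates for `coordH` in the upper half plane. -/
theorem exists_estimates {n : ℕ} (hn : 3 ≤ n) :
    ∃ K ≥ 1, ∃ τ₀ > 0, τ₀ ≤ 1 ∧ ∀ τ : ℝ, 0 < τ → τ < τ₀ → ∀ a c : ℝ,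
      |a - 1| ≤ 2 ^ n * τ ^ n → |c + 1| ≤ 2 ^ n * τ ^ n → ∀ φ : ℂ, 0 ≤ φ.im →
      (K * τ ^ 2 ≤ 1 - (n - 1) * ‖pUp n τ φ‖ → RegularAt n τ a c φ ∧
        limitNorm n (pUp n τ φ) * (1 - K * τ ^ 2 / (1 - (n - 1) * ‖pUp n τ φ‖)) ≤
          ‖coordH n τ a c φ‖ ∧
        ‖coordH n τ a c φ‖ ≤
          limitNorm n (pUp n τ φ) * (1 + K * τ ^ 2 / (1 - (n - 1) * ‖pUp n τ φ‖))) ∧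
      (‖pUp n τ φ‖ ≤ 2 / 3 → ‖coordH n τ a c φ‖ ≤ K ∧
        ‖coordP n τ a c φ - (1 - (n - 1) * pUp n τ φ) / (1 - pUp n τ φ)‖ ≤ K * τ ^ 2 ∧
        0 < (coordR n τ a c φ).re ∧ 0 < (coordQ n τ a c φ).re ∧ ‖pDn n τ φ‖ < 1 ∧
        ‖dthetaC n τ φ - 1 / (1 - pUp n τ φ)‖ < 1 / 2) := by
  have hn1 : (3 : ℝ) ≤ n := by exact_mod_cast hn
  obtain ⟨K₀, hK₀, τ₀, hτ₀, hτ₀1, H⟩ := exists_approx hn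
  -- The first summand makes `K τ² / D` dominate the relative error `16 s` with `s = 3 K₀ τ² / D`;
  -- the second bounds `‖coordH‖` up to and past the zero of `P`.
  refine ⟨48 * K₀ + 80 * (3 * n + 1), by linarith, min τ₀ (1 / (10 * (K₀ + 1))), by positivity,
    (min_le_left _ _).trans hτ₀1, ?_⟩
  intro τ hτ hlt a c ha hc φ him
  have hτ1 : τ < τ₀ := hlt.trans_le (min_le_left _ _)
  have hτ2 : τ * (10 * (K₀ + 1)) < 1 :=
    (lt_div_iff₀ (by positivity)).1 (hlt.trans_le (min_le_right _ _))
  set t := K₀ * τ ^ 2 with ht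
  have ht0 : 0 < t := by positivity
  have ht10 : t ≤ 1 / 10 := by
    have : τ ≤ 1 := hτ1.le.trans hτ₀1
    have : K₀ * τ ^ 2 ≤ K₀ * τ := by
      rw [sq]; exact mul_le_mul_of_nonneg_left (by nlinarith) hK₀.le
    nlinarith
  have H' := H τ hτ hτ1 a c ha hc φ him
  clear H
  set p := pUp n τ φ with hp
  have hcast : ∀ x : ℝ, 0 ≤ x → ‖(x : ℂ)‖ = x := fun x hx => by simp [abs_of_nonneg hx]
  have hN : ‖(n : ℂ) - 1‖ = n - 1 := by
    rw [← hcast _ (by linarith : (0 : ℝ) ≤ n - 1)]; push_cast; rfl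
  -- The Cayley transform maps the unit disc to the right half-plane; on `|p| ≤ 2/3` its real part
  -- is at least `(1 - 4/9) / (25/9) = 1/5`.
  have reR : ‖p‖ ≤ 2 / 3 → 1 / 5 ≤ ((1 + p) / (1 - p)).re := by
    intro hp3
    have h1 : 1 - p ≠ 0 := one_sub_ne_zero_of_norm_lt (by linarith)
    have hs : 0 < normSq (1 - p) := normSq_pos.2 h1
    have e1 : ((1 + p) / (1 - p)).re = (1 - ‖p‖ ^ 2) / normSq (1 - p) := by
      rw [div_re, ← normSq_eq_norm_sq, ← add_div]
      congr 1
      simp [normSq_apply]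
      ring
    have e2 : normSq (1 - p) ≤ (1 + ‖p‖) ^ 2 := by
      rw [normSq_eq_norm_sq]
      have := norm_sub_le (1 : ℂ) p
      rw [norm_one] at this
      gcongr
    rw [e1, le_div_iff₀ hs]
    nlinarith [norm_nonneg p]
  constructor
  · intro hD
    set D := 1 - (n - 1) * ‖p‖ with hDdef
    have hD1 : D ≤ 1 := by nlinarith [norm_nonneg p]
    have hKt : 48 * t < (48 * K₀ + 80 * (3 * n + 1)) * τ ^ 2 := by
      have : 0 < 80 * (3 * (n : ℝ) + 1) * τ ^ 2 := by positivity
      rw [ht]; linarith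
    have hD0 : 48 * t < D := hKt.trans_le hD
    have hDpos : 0 < D := by linarith
    have hp2 : ‖p‖ ≤ 1 / 2 := by nlinarith [norm_nonneg p]
    obtain ⟨r1, r2, r3, r4, r5⟩ := H' (by linarith)
    change ‖coordP n τ a c φ - _‖ ≤ _ at r1
    change ‖coordR n τ a c φ - _‖ ≤ _ at r2
    change ‖coordQ n τ a c φ - _‖ ≤ _ at r3
    have n1 : 1 - p ≠ 0 := one_sub_ne_zero_of_norm_lt (by linarith)
    have b1 : 1 / 2 ≤ ‖1 - p‖ := by
      have := norm_sub_norm_le (1 : ℂ) p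
      rw [norm_one] at this
      linarith
    have b2 : ‖1 - p‖ ≤ 3 / 2 := by
      have := norm_sub_le (1 : ℂ) p
      rw [norm_one] at this
      linarith
    have b3 : 1 / 2 ≤ ‖1 + p‖ := by
      have := norm_sub_norm_le (1 : ℂ) (-p)
      rw [norm_one, norm_neg, sub_neg_eq_add] at this
      linarith
    have b4 : D ≤ ‖1 - (n - 1) * p‖ := by
      have := norm_sub_norm_le (1 : ℂ) ((n - 1) * p)
      rw [norm_one, norm_mul, hN] at this
      exact this
    -- From `(n-1)|p| ≤ 1` follows `(n-2)|p| ≤ (n-1)|p| (1-|p|)`, so the subtracted fraction has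
    -- modulus at most `1 - D`. As `D` exceeds the error `t`, the value of `P` lies in the right
    -- half-plane.
    have reP : D ≤ ((1 - (n - 1) * p) / (1 - p)).re := by
      have e : (1 - (n - 1) * p) / (1 - p) = 1 - (n - 2) * p / (1 - p) := by
        field_simp; ring
      have h2 : ‖(n - 2) * p / (1 - p)‖ ≤ 1 - D := by
        have hN2 : ‖(n : ℂ) - 2‖ = n - 2 := by
          rw [← hcast _ (by linarith : (0 : ℝ) ≤ n - 2)]; push_cast; rfl
        have h3 : 1 - ‖p‖ ≤ ‖1 - p‖ := by
          have := norm_sub_norm_le (1 : ℂ) p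
          rwa [norm_one] at this
        rw [norm_div, norm_mul, hN2, div_le_iff₀ (by linarith)]
        have h4 : (1 - D) * (1 - ‖p‖) ≤ (1 - D) * ‖1 - p‖ :=
          mul_le_mul_of_nonneg_left h3 (by linarith)
        refine le_trans ?_ h4
        rw [hDdef]
        nlinarith [norm_nonneg p]
      rw [e, sub_re, one_re]
      linarith [(abs_le.1 (abs_re_le_norm ((n - 2) * p / (1 - p)))).2]
    have reOf : ∀ {z w : ℂ} {b : ℝ}, ‖z - w‖ ≤ t → b ≤ w.re → b - t ≤ z.re := by
      intro z w b h1 h2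
      have := (abs_le.1 (abs_re_le_norm (z - w))).1
      rw [sub_re] at this
      linarith
    have s1 := reOf r1 reP
    have s2 := reOf r2 (reR (by linarith))
    have s3 := reOf r3 (b := 1) (by simp)
    refine ⟨⟨by linarith, by linarith, Or.inl (by linarith), Or.inl (by linarith),
      Or.inl (by linarith)⟩, ?_⟩
    -- Absolute errors `t` become relative errors `s`: the main term of `P` is at least `2D/3`,
    -- those of `R` and `dθ/dφ` are at least `1/3` and `2/3`, and `D ≤ 1`.
    set s := 3 * t / D with hs
    have hs0 : 0 ≤ s := by positivity
    have hs2 : s ≤ 1 / 2 := by rw [hs, div_le_iff₀ hDpos]; linarith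
    have hsD : s * D = 3 * t := by rw [hs]; field_simp
    have ab : ∀ {z w : ℂ}, ‖z - w‖ ≤ t → |‖z‖ - ‖w‖| ≤ t := fun h =>
      (abs_norm_sub_norm_le _ _).trans h
    have P0 : 2 / 3 * D ≤ ‖(1 - (n - 1) * p) / (1 - p)‖ := by
      rw [norm_div, le_div_iff₀ (by linarith)]
      have : 2 / 3 * D * ‖1 - p‖ ≤ 2 / 3 * D * (3 / 2) := by gcongr
      linarith
    have R0 : 1 / 3 ≤ ‖(1 + p) / (1 - p)‖ := by
      rw [norm_div, le_div_iff₀ (by linarith)]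
      linarith
    have d0 : 2 / 3 ≤ ‖1 / (1 - p)‖ := by
      rw [norm_div, norm_one, le_div_iff₀ (by linarith)]
      linarith
    have hst : 3 * t ≤ s := by
      rw [← hsD]; exact mul_le_of_le_one_right hs0 hD1
    have q3 := ab r3
    rw [norm_one] at q3
    have main := density_error hs0 hs2 (by linarith) (by linarith) (by linarith)
      ((ab r1).trans (show t ≤ s * ‖(1 - (n - 1) * p) / (1 - p)‖ by
        have := mul_le_mul_of_nonneg_left P0 hs0
        linarith))
      ((ab r2).trans (show t ≤ s * ‖(1 + p) / (1 - p)‖ by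
        have := mul_le_mul_of_nonneg_left R0 hs0
        linarith)) (q3.trans (by linarith))
      ((ab r4).trans (show t ≤ s * ‖1 / (1 - p)‖ by
        have := mul_le_mul_of_nonneg_left d0 hs0
        linarith))
    rw [← norm_coordH] at main
    have hlim : ‖(1 - (n - 1) * p) / (1 - p)‖ ^ (2 / 3 : ℝ) *
        ‖(1 + p) / (1 - p)‖ ^ (-(1 / 2) : ℝ) * ‖1 / (1 - p)‖ = limitNorm n p := by
      have hx : 0 < ‖1 - p‖ := by linarith
      have hx1 : ‖1 / (1 - p)‖ = ‖1 - p‖ ^ (-1 : ℝ) := by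
        rw [norm_div, norm_one, Real.rpow_neg_one, one_div]
      have hd : ∀ x e : ℝ, x / ‖1 - p‖ ^ e = x * ‖1 - p‖ ^ (-e) := fun x e => by
        rw [Real.rpow_neg hx.le, div_eq_mul_inv]
      rw [limitNorm, norm_div, norm_div (1 + p), hx1, Real.div_rpow (norm_nonneg _) hx.le,
        Real.div_rpow (norm_nonneg _) hx.le, hd, hd]
      have : ‖1 - p‖ ^ (-(7 / 6) : ℝ) = ‖1 - p‖ ^ (-(2 / 3) : ℝ) * ‖1 - p‖ ^ (-(-(1 / 2)) : ℝ) *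
          ‖1 - p‖ ^ (-1 : ℝ) := by
        rw [← Real.rpow_add hx, ← Real.rpow_add hx]; norm_num
      rw [this]
      ring
    rw [hlim] at main
    have hlim0 : 0 ≤ limitNorm n p := by unfold limitNorm; positivity
    have hle : 16 * s ≤ (48 * K₀ + 80 * (3 * n + 1)) * τ ^ 2 / D := by
      rw [hs, ← mul_div_assoc]
      exact div_le_div_of_nonneg_right (by linarith) hDpos.le
    refine ⟨le_trans (mul_le_mul_of_nonneg_left ?_ hlim0) main.1,
      main.2.trans (mul_le_mul_of_nonneg_left ?_ hlim0)⟩ <;> linarith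
  · intro hp3
    obtain ⟨r1, r2, r3, r4, r5⟩ := H' hp3
    change ‖coordP n τ a c φ - _‖ ≤ _ at r1
    change ‖coordR n τ a c φ - _‖ ≤ _ at r2
    change ‖coordQ n τ a c φ - _‖ ≤ _ at r3
    have hKt : K₀ * τ ^ 2 ≤ (48 * K₀ + 80 * (3 * n + 1)) * τ ^ 2 := by
      gcongr; linarith
    have s2 : 1 / 10 ≤ (coordR n τ a c φ).re := by
      have := (abs_le.1 (abs_re_le_norm (coordR n τ a c φ - (1 + p) / (1 - p)))).1
      rw [sub_re] at this
      linarith [reR hp3]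
    have s3 : 1 / 2 ≤ (coordQ n τ a c φ).re := by
      have := (abs_le.1 (abs_re_le_norm (coordQ n τ a c φ - 1))).1
      rw [sub_re, one_re] at this
      linarith
    refine ⟨?_, r1.trans hKt, by linarith, by linarith, by linarith, by linarith⟩
    have b1 : 1 / 3 ≤ ‖1 - p‖ := by
      have := norm_sub_norm_le (1 : ℂ) p
      rw [norm_one] at this
      linarith
    have nP : ‖coordP n τ a c φ‖ ≤ 3 * n + 1 := by
      have h1 : ‖(1 - (n - 1) * p) / (1 - p)‖ ≤ 3 * n := by
        rw [norm_div, div_le_iff₀ (by linarith)]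
        have := norm_sub_le (1 : ℂ) ((n - 1) * p)
        rw [norm_one, norm_mul, hN] at this
        have h2 : (n - 1) * ‖p‖ ≤ (n - 1) * (2 / 3) := by
          apply mul_le_mul_of_nonneg_left hp3; linarith
        have h3 : 3 * n * (1 / 3) ≤ 3 * n * ‖1 - p‖ := by gcongr
        linarith
      have h2 := norm_add_le (coordP n τ a c φ - (1 - (n - 1) * p) / (1 - p))
        ((1 - (n - 1) * p) / (1 - p))
      rw [sub_add_cancel] at h2
      linarith
    have nd : ‖dthetaC n τ φ‖ ≤ 4 := by
      have h1 : ‖1 / (1 - p)‖ ≤ 3 := by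
        rw [norm_div, norm_one, div_le_iff₀ (by linarith)]
        linarith
      have h2 := norm_add_le (dthetaC n τ φ - 1 / (1 - p)) (1 / (1 - p))
      rw [sub_add_cancel] at h2
      linarith
    have m1 : ‖coordP n τ a c φ‖ ^ (2 / 3 : ℝ) ≤ 3 * n + 1 :=
      (Real.rpow_le_rpow (norm_nonneg _) nP (by norm_num)).trans
        (Real.rpow_le_self_of_one_le (by linarith) (by norm_num))
    have inv_le : ∀ x b : ℝ, 0 < b → b ≤ 1 → b ≤ x → x ^ (-(1 / 2) : ℝ) ≤ b⁻¹ := by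
      intro x b hb hb1 hx
      calc x ^ (-(1 / 2) : ℝ) ≤ b ^ (-(1 / 2) : ℝ) :=
            Real.rpow_le_rpow_of_nonpos hb hx (by norm_num)
        _ ≤ b ^ (-1 : ℝ) := Real.rpow_le_rpow_of_exponent_ge hb hb1 (by norm_num)
        _ = b⁻¹ := Real.rpow_neg_one b
    have m2 := inv_le ‖coordR n τ a c φ‖ (1 / 10) (by norm_num) (by norm_num)
      (s2.trans (re_le_norm _))
    have m3 := inv_le ‖coordQ n τ a c φ‖ (1 / 2) (by norm_num) (by norm_num)
      (s3.trans (re_le_norm _))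
    rw [norm_coordH]
    calc _ ≤ (3 * n + 1 : ℝ) * (1 / 10)⁻¹ * (1 / 2)⁻¹ * 4 := by gcongr
      _ = 80 * (3 * n + 1) := by norm_num; ring
      _ ≤ _ := by linarith

end PerturbedCircle

/-! ### The coordinate `φ` on the real axis. -/

namespace PerturbedCircle

open Complex ComplexConjugate

/-- A periodic analytic function on a strip is Lipschitz on smaller closed strips. -/
theorem exists_lipschitzOnWith_of_periodic {f : ℂ → ℂ} {σ₁ σ₂ T : ℝ} (hT : 0 < T) (hσ : σ₂ < σ₁)
    (hf : DifferentiableOn ℂ f (strip σ₁)) (hp : ∀ z, f (z + T) = f z) :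
    ∃ L, LipschitzOnWith L f {z : ℂ | |z.im| ≤ σ₂} := by
  have hsub : ∀ z : ℂ, |z.im| ≤ σ₂ → z ∈ strip σ₁ := fun z hz => lt_of_le_of_lt hz hσ
  have hd : ContinuousOn (deriv f) (strip σ₁) := (hf.deriv (isOpen_strip σ₁)).continuousOn
  have hcomp : IsCompact (Set.Icc 0 T ×ℂ Set.Icc (-σ₂) σ₂) := isCompact_Icc.reProdIm isCompact_Icc
  have hK : ∀ z ∈ Set.Icc 0 T ×ℂ Set.Icc (-σ₂) σ₂, z ∈ strip σ₁ := fun z hz =>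
    hsub z (abs_le.2 ⟨hz.2.1, hz.2.2⟩)
  obtain ⟨M, hM⟩ := hcomp.exists_bound_of_continuousOn (hd.mono hK)
  -- Periodicity is stated for a whole vertical line at once, so that any `z` can be moved to the
  -- compact rectangle without changing its imaginary part.
  have hdp : Function.Periodic (fun x : ℝ => fun y : ℝ => deriv f (x + y * I)) T := by
    intro x
    funext y
    have : (fun z => f (z + T)) = f := funext hp
    have e := deriv_comp_add_const f (T : ℂ) (x + y * I)
    rw [this] at e
    simp only []
    rw [e]
    push_cast
    congr 1
    ring
  have hbound : ∀ z : ℂ, |z.im| ≤ σ₂ → ‖deriv f z‖ ≤ M := by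
    intro z hz
    obtain ⟨x, hx, hxe⟩ := hdp.exists_mem_Ico₀ hT z.re
    have h1 := congrFun hxe z.im
    simp only [re_add_im] at h1
    rw [h1]
    refine hM _ ⟨?_, ?_⟩
    · simpa using ⟨hx.1, hx.2.le⟩
    · simpa using abs_le.1 hz
  have hconv : Convex ℝ {z : ℂ | |z.im| ≤ σ₂} := by
    have h : {z : ℂ | |z.im| ≤ σ₂} = {z : ℂ | -σ₂ ≤ z.im} ∩ {z : ℂ | z.im ≤ σ₂} := by
      ext z; simp [abs_le]
    rw [h]
    exact (convex_halfSpace_im_ge _).inter (convex_halfSpace_im_le _)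
  refine ⟨M.toNNReal, Convex.lipschitzOnWith_of_nnnorm_deriv_le
    (fun z hz => (hf.differentiableAt ((isOpen_strip σ₁).mem_nhds (hsub z hz)))) ?_ hconv⟩
  intro z hz
  rw [← NNReal.coe_le_coe, coe_nnnorm]
  exact (hbound z hz).trans (Real.le_coe_toNNReal M)

/-- A regular curve for which the estimates of `exists_estimates` hold, and give information on the
real axis. -/
structure ApproxCurve (n : ℕ) (τ K a c : ℝ) : Prop where
  regular : RegularCurve n (τ ^ n) a c
  pos : 0 < τ
  const_pos : 0 < K
  small : K * τ ^ 2 ≤ 1 - (n - 1) * radius n τ 0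
  estimates : ∀ φ : ℂ, 0 ≤ φ.im →
      (K * τ ^ 2 ≤ 1 - (n - 1) * ‖pUp n τ φ‖ → RegularAt n τ a c φ ∧
        limitNorm n (pUp n τ φ) * (1 - K * τ ^ 2 / (1 - (n - 1) * ‖pUp n τ φ‖)) ≤
          ‖coordH n τ a c φ‖ ∧
        ‖coordH n τ a c φ‖ ≤
          limitNorm n (pUp n τ φ) * (1 + K * τ ^ 2 / (1 - (n - 1) * ‖pUp n τ φ‖))) ∧
      (‖pUp n τ φ‖ ≤ 2 / 3 → ‖coordH n τ a c φ‖ ≤ K ∧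
        ‖coordP n τ a c φ - (1 - (n - 1) * pUp n τ φ) / (1 - pUp n τ φ)‖ ≤ K * τ ^ 2 ∧
        0 < (coordR n τ a c φ).re ∧ 0 < (coordQ n τ a c φ).re ∧ ‖pDn n τ φ‖ < 1 ∧
        ‖dthetaC n τ φ - 1 / (1 - pUp n τ φ)‖ < 1 / 2)

theorem norm_pUp_eq_radius {n : ℕ} (hn : 3 ≤ n) {τ : ℝ} (hτ : 0 < τ) (φ : ℂ) :
    ‖pUp n τ φ‖ = radius n τ φ.im := norm_pUp hn hτ φ

theorem radius_pos {n : ℕ} (hn : 3 ≤ n) {τ : ℝ} (hτ : 0 < τ) (σ : ℝ) : 0 < radius n τ σ := by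
  have hn1 : (3 : ℝ) ≤ n := by exact_mod_cast hn
  have : 0 < (n : ℝ) - 1 := by linarith
  unfold radius
  positivity

theorem radius_strictMono {n : ℕ} (hn : 3 ≤ n) {τ : ℝ} (hτ : 0 < τ) :
    StrictMono (radius n τ) := by
  have hn1 : (3 : ℝ) ≤ n := by exact_mod_cast hn
  intro s t h
  have : 0 < (n : ℝ) - 1 := by linarith
  unfold radius
  gcongr

theorem continuous_radius (n : ℕ) (τ : ℝ) : Continuous (radius n τ) := by
  unfold radius; fun_prop

/-- The angle `θ` as a function of the real coordinate `φ`. -/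
def thetaR (n : ℕ) (τ x : ℝ) : ℝ := (thetaC n τ x).re

/-- The power `2/3` turns `R^{-3/2}` into `R^{-1}`, and the speed contributes `R^{1/2} Q^{-1/2}`. -/
theorem density_eq {n : ℕ} {ε a c : ℝ} (h : RegularCurve n ε a c) (θ : ℝ) :
    density n ε a c θ = curveP n ε (height a c θ) ^ (2 / 3 : ℝ) *
      curveR n ε (height a c θ) ^ (-(1 / 2) : ℝ) *
      curveQ n ε a c (height a c θ) ^ (-(1 / 2) : ℝ) := by
  have hP := h.P_pos _ (h.abs_height_le_two θ)
  have hR := h.R_pos _ (h.abs_height_le_two θ)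
  have hQ := h.Q_pos _ (h.abs_height_le_two θ)
  rw [density, speed, curv, Real.sqrt_eq_rpow, Real.sqrt_eq_rpow, ← Real.rpow_mul_natCast hR.le,
    Real.div_rpow hP.le (by positivity), ← Real.rpow_mul hR.le, Real.rpow_neg hR.le,
    Real.rpow_neg hQ.le]
  have e : curveR n ε (height a c θ) ^ (1 / 2 * ((3 : ℕ) : ℝ) * (2 / 3)) =
      curveR n ε (height a c θ) ^ (1 / 2 : ℝ) * curveR n ε (height a c θ) ^ (1 / 2 : ℝ) := by
    rw [← Real.rpow_add hR]; norm_num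
  rw [e]
  have h1 := Real.rpow_pos_of_pos hR (1 / 2)
  have h2 := Real.rpow_pos_of_pos hQ (1 / 2)
  field_simp

theorem curv_eq {n : ℕ} {ε a c : ℝ} (h : RegularCurve n ε a c) (θ : ℝ) :
    curv n ε a c θ = curveP n ε (height a c θ) *
      curveR n ε (height a c θ) ^ (-(3 / 2) : ℝ) := by
  have hR := h.R_pos _ (h.abs_height_le_two θ)
  rw [curv, Real.sqrt_eq_rpow, ← Real.rpow_mul_natCast hR.le, Real.rpow_neg hR.le, div_eq_mul_inv]
  norm_num

theorem curveP_ofReal (n : ℕ) (ε y : ℝ) :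
    ((curveP n ε y : ℝ) : ℂ) = curveP n (ε : ℂ) y := by
  simp [curveP]

theorem curveR_ofReal (n : ℕ) (ε y : ℝ) :
    ((curveR n ε y : ℝ) : ℂ) = curveR n (ε : ℂ) y := by
  simp [curveR]

theorem curveQ_ofReal (n : ℕ) (ε a c y : ℝ) :
    ((curveQ n ε a c y : ℝ) : ℂ) = curveQ n (ε : ℂ) a c y := by
  simp [curveQ]

namespace ApproxCurve

variable {n : ℕ} {τ K a c : ℝ}

theorem three_le (h : ApproxCurve n τ K a c) : 3 ≤ n := h.regular.three_le

theorem const_mul_pos (h : ApproxCurve n τ K a c) : 0 < K * τ ^ 2 :=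
  mul_pos h.const_pos (pow_pos h.pos 2)

/-- In the upper half-plane `limitNorm_norm_le` replaces `p` by `|p|`, which leaves a bound in `Im
φ` alone; the lower half-plane follows by conjugation. -/
theorem regularAt (h : ApproxCurve n τ K a c) {φ : ℂ}
    (hφ : K * τ ^ 2 ≤ 1 - (n - 1) * radius n τ |φ.im|) :
    RegularAt n τ a c φ ∧ limitDensity n (radius n τ |φ.im|) *
      (1 - K * τ ^ 2 / (1 - (n - 1) * radius n τ |φ.im|)) ≤ ‖coordH n τ a c φ‖ := by
  have key : ∀ ψ : ℂ, 0 ≤ ψ.im → K * τ ^ 2 ≤ 1 - (n - 1) * radius n τ ψ.im →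
      RegularAt n τ a c ψ ∧ limitDensity n (radius n τ ψ.im) *
        (1 - K * τ ^ 2 / (1 - (n - 1) * radius n τ ψ.im)) ≤ ‖coordH n τ a c ψ‖ := by
    intro ψ him hψ
    have h0 := h.const_mul_pos
    rw [← norm_pUp_eq_radius h.three_le h.pos] at hψ ⊢
    obtain ⟨h1, h2, -⟩ := (h.estimates ψ him).1 hψ
    refine ⟨h1, le_trans ?_ h2⟩
    have h3 := limitNorm_norm_le h.three_le (p := pUp n τ ψ) (by linarith)
    rw [limitNorm_ofReal h.three_le (norm_nonneg _) (by linarith)] at h3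
    refine mul_le_mul_of_nonneg_right h3 ?_
    rw [sub_nonneg, div_le_one (by linarith)]
    exact hψ
  rcases le_total 0 φ.im with him | him
  · rw [abs_of_nonneg him] at hφ ⊢
    exact key φ him hφ
  · rw [abs_of_nonpos him] at hφ ⊢
    have := key (conj φ) (by simpa using him) (by simpa using hφ)
    obtain ⟨h1, h2⟩ := this
    rw [conj_im] at h2
    have h3 := h1.conj
    rw [conj_conj] at h3
    exact ⟨h3, by rwa [norm_coordH_conj a c h3.1 h3.2.1] at h2⟩

theorem regularAt_ofReal (h : ApproxCurve n τ K a c) (x : ℝ) : RegularAt n τ a c x :=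
  (h.regularAt (by simpa using h.small)).1

theorem thetaC_ofReal (h : ApproxCurve n τ K a c) (x : ℝ) :
    thetaC n τ x = (thetaR n τ x : ℂ) := by
  obtain ⟨h1, h2, -⟩ := h.regularAt_ofReal x
  have := thetaC_conj h1 h2
  rw [conj_ofReal] at this
  exact (conj_eq_iff_re.1 this.symm).symm

theorem dthetaC_ofReal (n : ℕ) (τ x : ℝ) : dthetaC n τ x = ((dthetaC n τ x).re : ℂ) := by
  have := dthetaC_conj n τ x
  rw [conj_ofReal] at this
  exact (conj_eq_iff_re.1 this.symm).symm

theorem heightC_ofReal (h : ApproxCurve n τ K a c) (x : ℝ) :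
    heightC n τ a c x = (height a c (thetaR n τ x) : ℂ) := by
  rw [heightC, height, h.thetaC_ofReal]
  push_cast
  rfl

theorem coordP_ofReal (h : ApproxCurve n τ K a c) (x : ℝ) :
    coordP n τ a c x = ((curveP n (τ ^ n) (height a c (thetaR n τ x)) : ℝ) : ℂ) := by
  rw [coordP, h.heightC_ofReal, curveP_ofReal, ofReal_pow]

theorem coordR_ofReal (h : ApproxCurve n τ K a c) (x : ℝ) :
    coordR n τ a c x = ((curveR n (τ ^ n) (height a c (thetaR n τ x)) : ℝ) : ℂ) := by
  rw [coordR, h.heightC_ofReal, curveR_ofReal, ofReal_pow]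

theorem coordQ_ofReal (h : ApproxCurve n τ K a c) (x : ℝ) :
    coordQ n τ a c x = ((curveQ n (τ ^ n) a c (height a c (thetaR n τ x)) : ℝ) : ℂ) := by
  rw [coordQ, h.heightC_ofReal, curveQ_ofReal, ofReal_pow]

theorem coordH_ofReal (h : ApproxCurve n τ K a c) (x : ℝ) :
    coordH n τ a c x =
      ((density n (τ ^ n) a c (thetaR n τ x) * (dthetaC n τ x).re : ℝ) : ℂ) := by
  have hy := h.regular.abs_height_le_two (thetaR n τ x)
  rw [coordH, h.coordP_ofReal, h.coordR_ofReal, h.coordQ_ofReal, dthetaC_ofReal n τ x,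
    ← ofReal_cpow (h.regular.P_pos _ hy).le, ← ofReal_cpow (h.regular.R_pos _ hy).le,
    ← ofReal_cpow (h.regular.Q_pos _ hy).le, density_eq h.regular]
  simp only [ofReal_mul, ofReal_re]

theorem coordK_ofReal (h : ApproxCurve n τ K a c) (x : ℝ) :
    coordK n τ a c x = (curv n (τ ^ n) a c (thetaR n τ x) : ℂ) := by
  have hy := h.regular.abs_height_le_two (thetaR n τ x)
  rw [coordK, h.coordP_ofReal, h.coordR_ofReal, ← ofReal_cpow (h.regular.R_pos _ hy).le,
    curv_eq h.regular, ofReal_mul]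

theorem hasDerivAt_thetaR (h : ApproxCurve n τ K a c) (x : ℝ) :
    HasDerivAt (thetaR n τ) (dthetaC n τ x).re x := by
  obtain ⟨h1, h2, -⟩ := h.regularAt_ofReal x
  exact (hasDerivAt_thetaC h.three_le h1 h2).real_of_complex

theorem thetaR_add (n : ℕ) (τ x : ℝ) :
    thetaR n τ (x + 2 * Real.pi) = thetaR n τ x + 2 * Real.pi := by
  rw [thetaR]
  push_cast
  rw [thetaC_add, add_re, thetaR]
  simp

/-- The map `p ↦ 1/(1-p)` sends the unit disc to `Re > 1/2`, and the error is less than `1/2`. Hence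
`θ` increases with `φ`. -/
theorem dthetaC_re_pos (h : ApproxCurve n τ K a c) (x : ℝ) : 0 < (dthetaC n τ x).re := by
  have hn1 : (3 : ℝ) ≤ n := by exact_mod_cast h.three_le
  have hp : ‖pUp n τ x‖ ≤ 1 / 2 := by
    have h0 := h.small
    have h1 := h.const_mul_pos
    have h2 := norm_pUp_eq_radius h.three_le h.pos x
    rw [ofReal_im] at h2
    rw [← h2] at h0
    nlinarith [norm_nonneg (pUp n τ x)]
  obtain ⟨-, -, -, -, -, h6⟩ := (h.estimates x (by simp)).2 (by linarith)
  set p := pUp n τ x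
  have hs : 0 < normSq (1 - p) := normSq_pos.2 (one_sub_ne_zero_of_norm_lt (by linarith))
  have e : (1 / (1 - p)).re = (1 - p.re) / normSq (1 - p) := by
    rw [div_re]; simp
  have e2 : normSq (1 - p) = 1 - 2 * p.re + ‖p‖ ^ 2 := by
    rw [← normSq_eq_norm_sq]; simp [normSq_apply]; ring
  have h7 : 1 / 2 < (1 / (1 - p)).re := by
    rw [e, lt_div_iff₀ hs, e2]
    nlinarith [norm_nonneg p]
  have h8 := (abs_le.1 (abs_re_le_norm (dthetaC n τ x - 1 / (1 - p)))).1
  rw [sub_re] at h8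
  linarith

/-- The variable `ξ` as a function of the real coordinate `φ`. -/
theorem exists_inverse_xi (h : ApproxCurve n τ K a c) :
    (∀ x : ℝ, HasDerivAt (fun x => xiAngle n (τ ^ n) a c (thetaR n τ x))
      (density n (τ ^ n) a c (thetaR n τ x) * (dthetaC n τ x).re /
        densityInt n (τ ^ n) a c (2 * Real.pi)) x) ∧
    ∃ g : ℝ → ℝ, Continuous g ∧ ∀ y, xiAngle n (τ ^ n) a c (thetaR n τ (g y)) = y := by
  have hθc : Continuous (thetaR n τ) :=
    continuous_iff_continuousAt.2 fun x => (h.hasDerivAt_thetaR x).continuousAt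
  have hdc : Continuous fun x : ℝ => (dthetaC n τ x).re := by
    refine continuous_re.comp (continuous_iff_continuousAt.2 fun x => ?_)
    have := (differentiableAt_dthetaC h.three_le (h.regularAt_ofReal x).1
      (h.regularAt_ofReal x).2.1).continuousAt
    exact this.comp (continuous_ofReal.continuousAt (x := x))
  have hd : ∀ x : ℝ, HasDerivAt (fun x => xiAngle n (τ ^ n) a c (thetaR n τ x))
      (density n (τ ^ n) a c (thetaR n τ x) * (dthetaC n τ x).re /
        densityInt n (τ ^ n) a c (2 * Real.pi)) x := by
    intro x
    refine ((h.regular.hasDerivAt_xiAngle (thetaR n τ x)).comp x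
      (h.hasDerivAt_thetaR x)).congr_deriv ?_
    ring
  refine ⟨hd, ?_⟩
  obtain ⟨d, hd0, hle⟩ := exists_pos_le_of_periodic
    (f := fun x => density n (τ ^ n) a c (thetaR n τ x) * (dthetaC n τ x).re)
    ((h.regular.continuous_density.comp hθc).mul hdc) Real.two_pi_pos
    (fun x => by
      have e : dthetaC n τ ((x + 2 * Real.pi : ℝ) : ℂ) = dthetaC n τ x := by
        push_cast; exact dthetaC_add n τ x
      simp only []
      rw [thetaR_add, e, RegularCurve.periodic_density n (τ ^ n) a c])
    (fun x => mul_pos (h.regular.density_pos _) (h.dthetaC_re_pos x))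
  obtain ⟨-, g, -, h2, h3⟩ := exists_inverse_of_hasDerivAt hd
    (div_pos hd0 h.regular.densityInt_two_pi_pos)
    (fun x => div_le_div_of_nonneg_right (hle x) h.regular.densityInt_two_pi_pos.le)
  exact ⟨g, continuous_iff_continuousAt.2 fun y => (h3 y).continuousAt, h2⟩

end ApproxCurve

end PerturbedCircle

/-! ### The lower bound for the widths. -/

namespace PerturbedCircle

open Complex

namespace ApproxCurve

variable {n : ℕ} {τ K a c : ℝ}

/-- The variable `ξ` as an analytic function of `φ` in an open convex set that meets the real axis
in an interval around `x₀`. -/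
theorem exists_primitive (h : ApproxCurve n τ K a c) {U : Set ℂ} (hU : IsOpen U)
    (hconv : Convex ℝ U) (hreg : ∀ φ ∈ U, RegularAt n τ a c φ) {x₀ : ℝ} (hx₀ : (x₀ : ℂ) ∈ U) :
    ∃ X : ℂ → ℂ, (∀ φ ∈ U, HasDerivAt X
        (coordH n τ a c φ / (densityInt n (τ ^ n) a c (2 * Real.pi) : ℂ)) φ) ∧
      ∀ x : ℝ, (x : ℂ) ∈ U → X x = (xiAngle n (τ ^ n) a c (thetaR n τ x) : ℂ) := by
  set C := densityInt n (τ ^ n) a c (2 * Real.pi) with hC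
  have hdiff : DifferentiableOn ℂ (fun φ => coordH n τ a c φ / (C : ℂ)) U := fun φ hφ =>
    (((hreg φ hφ).differentiableAt_coordH h.three_le).div_const _).differentiableWithinAt
  obtain ⟨X, hX⟩ := hconv.exists_forall_hasDerivWithinAt hdiff
  have hX' : ∀ φ ∈ U, HasDerivAt X (coordH n τ a c φ / (C : ℂ)) φ := fun φ hφ =>
    (hX φ hφ).hasDerivAt (hU.mem_nhds hφ)
  refine ⟨fun φ => X φ - X x₀ + xiAngle n (τ ^ n) a c (thetaR n τ x₀), fun φ hφ =>
    ((hX' φ hφ).sub_const _).add_const _, fun x hx => ?_⟩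
  set I : Set ℝ := {x : ℝ | (x : ℂ) ∈ U} with hI
  have hIopen : IsOpen I := hU.preimage continuous_ofReal
  have hIconv : Convex ℝ I := by
    intro y hy z hz s t hs ht hst
    have := hconv hy hz hs ht hst
    change ((s • y + t • z : ℝ) : ℂ) ∈ U
    simpa using this
  have hd : ∀ y ∈ I, HasDerivAt (fun y : ℝ => X y - (xiAngle n (τ ^ n) a c (thetaR n τ y) : ℂ)) 0 y := by
    intro y hy
    have h1 := (hX' y hy).comp_ofReal
    have h2 := (h.exists_inverse_xi.1 y).ofReal_comp
    refine (h1.sub h2).congr_deriv ?_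
    rw [h.coordH_ofReal, ← ofReal_div, sub_self]
  have := hIopen.is_const_of_deriv_eq_zero hIconv.isPreconnected
    (fun y hy => (hd y hy).differentiableAt.differentiableWithinAt)
    (fun y hy => (hd y hy).deriv) hx hx₀
  linear_combination this

/-- A lower bound for the widths of the strips to which the curvature extends. -/
theorem integral_mem_extensionWidths (h : ApproxCurve n τ K a c) {σ₁ σ₂ : ℝ} (hσ₂ : 0 < σ₂)
    (hσ : σ₂ < σ₁) (hσ₁ : K * τ ^ 2 ≤ 1 - (n - 1) * radius n τ σ₁) :
    (∫ t in (0 : ℝ)..σ₂, limitDensity n (radius n τ t) *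
      (1 - K * τ ^ 2 / (1 - (n - 1) * radius n τ t)) /
        densityInt n (τ ^ n) a c (2 * Real.pi)) ∈ extensionWidths (curvXi n (τ ^ n) a c) := by
  have hn1 : (3 : ℝ) ≤ n := by exact_mod_cast h.three_le
  set C := densityInt n (τ ^ n) a c (2 * Real.pi) with hC
  have hC0 : 0 < C := h.regular.densityInt_two_pi_pos
  set m : ℝ → ℝ := fun t => limitDensity n (radius n τ t) *
      (1 - K * τ ^ 2 / (1 - (n - 1) * radius n τ t)) / C with hm
  have h0 := h.const_mul_pos
  have hmono := radius_strictMono h.three_le h.pos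
  have hD1 : ∀ t ≤ σ₁, K * τ ^ 2 ≤ 1 - (n - 1) * radius n τ t := fun t ht => by
    have := mul_le_mul_of_nonneg_left (hmono.monotone ht) (by linarith : (0 : ℝ) ≤ n - 1)
    linarith
  have hD2 : ∀ t ≤ σ₂, K * τ ^ 2 < 1 - (n - 1) * radius n τ t := fun t ht => by
    have := mul_lt_mul_of_pos_left (hmono (ht.trans_lt hσ)) (by linarith : (0 : ℝ) < n - 1)
    linarith
  have hreg : ∀ φ ∈ strip σ₁, RegularAt n τ a c φ ∧ m |φ.im| ≤ ‖coordH n τ a c φ / (C : ℂ)‖ := by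
    intro φ hφ
    obtain ⟨h1, h2⟩ := h.regularAt (hD1 _ (le_of_lt hφ))
    refine ⟨h1, ?_⟩
    rw [norm_div, norm_real, Real.norm_of_nonneg hC0.le]
    exact div_le_div_of_nonneg_right h2 hC0.le
  have hr : ∀ t ≤ σ₂, 0 < 1 - (n - 1) * radius n τ t ∧ 0 < 1 + radius n τ t ∧
      0 < 1 - radius n τ t := by
    intro t ht
    have h1 := hD2 t ht
    have h2 := radius_pos h.three_le h.pos t
    refine ⟨by linarith, by linarith, by nlinarith⟩
  have hm0 : ∀ t ≤ σ₂, 0 < m t := by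
    intro t ht
    obtain ⟨h1, h2, h3⟩ := hr t ht
    have h4 : 0 < 1 - K * τ ^ 2 / (1 - (n - 1) * radius n τ t) := by
      rw [sub_pos, div_lt_one h1]; exact hD2 t ht
    simp only [hm, limitDensity]
    positivity
  have hmc : ContinuousOn m (Set.Icc 0 σ₂) := by
    have hrc := (continuous_radius n τ).continuousOn (s := Set.Icc 0 σ₂)
    simp only [hm, limitDensity]
    refine ContinuousOn.div_const (ContinuousOn.mul (ContinuousOn.mul (ContinuousOn.mul ?_ ?_) ?_)
      ?_) _
    · exact (continuousOn_const.sub (continuousOn_const.mul hrc)).rpow_const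
        fun t ht => Or.inl (hr t ht.2).1.ne'
    · exact (continuousOn_const.add hrc).rpow_const fun t ht => Or.inl (hr t ht.2).2.1.ne'
    · exact (continuousOn_const.sub hrc).rpow_const fun t ht => Or.inl (hr t ht.2).2.2.ne'
    · exact continuousOn_const.sub (continuousOn_const.div
        (continuousOn_const.sub (continuousOn_const.mul hrc)) fun t ht => (hr t ht.2).1.ne')
  -- On an intermediate strip the lower bound is strictly positive, so `1 / coordH` is holomorphic
  -- there and Lipschitz on the closed strip of half-width `σ₂`.
  obtain ⟨σ₃, h23, h31⟩ := exists_between hσ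
  have hD3 : ∀ t ≤ σ₃, K * τ ^ 2 < 1 - (n - 1) * radius n τ t := fun t ht => by
    have := mul_lt_mul_of_pos_left (hmono (ht.trans_lt h31)) (by linarith : (0 : ℝ) < n - 1)
    linarith
  have hH0 : ∀ φ ∈ strip σ₃, coordH n τ a c φ / (C : ℂ) ≠ 0 := by
    intro φ hφ
    have h1 := hD3 |φ.im| (le_of_lt hφ)
    have h2 := (hreg φ (strip_mono h31.le hφ)).2
    have h4 := radius_pos h.three_le h.pos |φ.im|
    have h5 : 0 < 1 - (n - 1) * radius n τ |φ.im| := by linarith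
    have h6 : 0 < 1 - radius n τ |φ.im| := by nlinarith
    have h7 : 0 < 1 - K * τ ^ 2 / (1 - (n - 1) * radius n τ |φ.im|) := by
      rw [sub_pos, div_lt_one h5]; exact h1
    refine norm_pos_iff.1 (lt_of_lt_of_le ?_ h2)
    simp only [hm, limitDensity]
    positivity
  obtain ⟨X, hX, hXr⟩ := h.exists_primitive (isOpen_strip σ₁) (convex_strip σ₁)
    (fun φ hφ => (hreg φ hφ).1) (ofReal_mem_strip (hσ₂.trans hσ) 0)
  have hsub : ∀ z : ℂ, |z.im| ≤ σ₂ → z ∈ strip σ₃ := fun z hz => lt_of_le_of_lt hz h23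
  have hinv : DifferentiableOn ℂ (fun φ => (coordH n τ a c φ / (C : ℂ))⁻¹) (strip σ₃) :=
    fun φ hφ => ((((hreg φ (strip_mono h31.le hφ)).1.differentiableAt_coordH h.three_le).div_const
      _).inv (hH0 φ hφ)).differentiableWithinAt
  obtain ⟨L, hL⟩ := exists_lipschitzOnWith_of_periodic Real.two_pi_pos h23 hinv (fun z => by
    push_cast; rw [coordH_add])
  obtain ⟨-, g, hgc, hg⟩ := h.exists_inverse_xi
  obtain ⟨Θ, hΘr, hΘ⟩ := exists_right_inverse_on_strip (φ₀ := g) hσ₂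
    (fun z hz => hX z (strip_mono h31.le (hsub z hz))) hL hmc (fun t ht => hm0 t ht.2)
    (fun z hz => (hreg z (strip_mono h31.le (hsub z hz))).2) hgc
    (fun s => by rw [hXr _ (ofReal_mem_strip (hσ₂.trans hσ) _), hg])
  -- The inverse `Θ` stays in the strip where all points are regular, and at a regular point
  -- `coordK` is holomorphic and not zero.
  refine ⟨?_, fun z => coordK n τ a c (Θ z), ⟨fun z hz => ?_, fun z hz => ?_, fun x => ?_⟩⟩
  · exact intervalIntegral.intervalIntegral_pos_of_pos_on
      (hmc.intervalIntegrable_of_Icc hσ₂.le) (fun t ht => hm0 t ht.2.le) hσ₂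
  · obtain ⟨h1, -, h3⟩ := hΘ z hz
    have h4 := (hreg (Θ z) (strip_mono h31.le (hsub _ h1.le))).1.differentiableAt_coordK h.three_le
    exact (h4.comp z h3.differentiableAt).differentiableWithinAt
  · obtain ⟨h1, -, -⟩ := hΘ z hz
    exact (hreg (Θ z) (strip_mono h31.le (hsub _ h1.le))).1.coordK_ne_zero
  · rw [hΘr, h.coordK_ofReal]
    conv_rhs => rw [← hg x, h.regular.curvXi_xiAngle]

end ApproxCurve

end PerturbedCircle

/-! ### The line `Re φ = π/2`. -/

namespace PerturbedCircle

open Complex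

/-- The vertical half line on which the first zero of the curvature lies. -/
def ray (σ : ℝ) : ℂ := Real.pi / 2 + σ * I

theorem ray_im (σ : ℝ) : (ray σ).im = σ := by
  have : ray σ = ((Real.pi / 2 : ℝ) : ℂ) + σ * I := by rw [ray]; push_cast; rfl
  rw [this]; simp

theorem ray_zero : ray 0 = ((Real.pi / 2 : ℝ) : ℂ) := by simp [ray]

theorem hasDerivAt_ray (σ : ℝ) : HasDerivAt ray I σ := by
  have := ((hasDerivAt_id σ).ofReal_comp.mul_const I).const_add (Real.pi / 2 : ℂ)
  exact this.congr_deriv (by simp)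

theorem continuous_ray : Continuous ray :=
  continuous_iff_continuousAt.2 fun σ => (hasDerivAt_ray σ).continuousAt

/-- The factor `I` in `fUp` places the positive values of `f`, hence of `p`, on this line; there
`limitNorm_norm_le` is an equality. -/
theorem fUp_ray (τ σ : ℝ) : fUp τ (ray σ) = ((τ / 2 * Real.exp σ : ℝ) : ℂ) := by
  have e : -(I * ray σ) = σ + -(Real.pi / 2 * I) := by
    rw [ray]; linear_combination (-(σ : ℂ)) * I_sq
  rw [fUp, e, exp_add, exp_neg, exp_pi_div_two_mul_I, inv_I]
  push_cast
  linear_combination (-(τ : ℂ) / 2 * exp σ) * I_sq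

theorem fDn_ray (τ σ : ℝ) : fDn τ (ray σ) = ((τ / 2 * Real.exp (-σ) : ℝ) : ℂ) := by
  have e : I * ray σ = -σ + Real.pi / 2 * I := by
    rw [ray]; linear_combination (σ : ℂ) * I_sq
  rw [fDn, e, exp_add, exp_pi_div_two_mul_I]
  push_cast
  linear_combination (-(τ : ℂ) / 2 * exp (-σ)) * I_sq

theorem pUp_ray (n : ℕ) (τ σ : ℝ) : pUp n τ (ray σ) = (radius n τ σ : ℂ) := by
  rw [pUp, fUp_ray, radius, mul_assoc, Real.exp_nat_mul, ← mul_pow]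
  push_cast
  rfl

theorem pDn_ray (n : ℕ) (τ σ : ℝ) : pDn n τ (ray σ) = (radius n τ (-σ) : ℂ) := by
  rw [pDn, fDn_ray, radius, mul_assoc, Real.exp_nat_mul, ← mul_pow]
  push_cast
  rfl

theorem dthetaC_ray (n : ℕ) (τ σ : ℝ) : dthetaC n τ (ray σ) =
    ((1 / (1 - radius n τ σ) + 1 / (1 - radius n τ (-σ)) - 1 : ℝ) : ℂ) := by
  rw [dthetaC, pUp_ray, pDn_ray]
  push_cast
  rfl

/-- On the line, `θ` stays on `π/2 + iℝ`, where the sine is a hyperbolic cosine. Thus `P`, `R` and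
`Q` are real along it, and a sign change of `P` yields a zero. -/
theorem exists_heightC_ray {n : ℕ} {τ a c σ : ℝ} (h1 : radius n τ σ < 1)
    (h2 : radius n τ (-σ) < 1) : ∃ y : ℝ, heightC n τ a c (ray σ) = y := by
  set v : ℝ := σ - (Real.log (1 - radius n τ σ) - Real.log (1 - radius n τ (-σ))) / n with hv
  have hθ : thetaC n τ (ray σ) = v * I + Real.pi / 2 := by
    rw [thetaC, pUp_ray, pDn_ray, ray, hv]
    push_cast
    rw [ofReal_log (by linarith), ofReal_log (by linarith)]
    push_cast
    ring
  refine ⟨(a + c) / 2 + (a - c) / 2 * Real.cosh v, ?_⟩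
  rw [heightC, hθ, sin_add_pi_div_two, cos_mul_I]
  push_cast
  rfl

theorem coordP_ray {n : ℕ} {τ : ℝ} (a c : ℝ) {σ : ℝ} (h1 : radius n τ σ < 1)
    (h2 : radius n τ (-σ) < 1) : coordP n τ a c (ray σ) = ((coordP n τ a c (ray σ)).re : ℂ) := by
  obtain ⟨y, hy⟩ := exists_heightC_ray (a := a) (c := c) h1 h2
  rw [coordP, hy, ← ofReal_pow, ← curveP_ofReal, ofReal_re]

theorem coordR_ray {n : ℕ} {τ : ℝ} (a c : ℝ) {σ : ℝ} (h1 : radius n τ σ < 1)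
    (h2 : radius n τ (-σ) < 1) : coordR n τ a c (ray σ) = ((coordR n τ a c (ray σ)).re : ℂ) := by
  obtain ⟨y, hy⟩ := exists_heightC_ray (a := a) (c := c) h1 h2
  rw [coordR, hy, ← ofReal_pow, ← curveR_ofReal, ofReal_re]

theorem coordQ_ray {n : ℕ} {τ : ℝ} (a c : ℝ) {σ : ℝ} (h1 : radius n τ σ < 1)
    (h2 : radius n τ (-σ) < 1) : coordQ n τ a c (ray σ) = ((coordQ n τ a c (ray σ)).re : ℂ) := by
  obtain ⟨y, hy⟩ := exists_heightC_ray (a := a) (c := c) h1 h2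
  rw [coordQ, hy, ← ofReal_pow, ← curveQ_ofReal, ofReal_re]

/-- A continuous function that is positive at the left end of an interval and not at the right end
has a first zero. -/
theorem exists_first_zero {f : ℝ → ℝ} {b : ℝ} (hb : 0 ≤ b) (hf : ContinuousOn f (Set.Icc 0 b))
    (h0 : 0 < f 0) (hfb : f b ≤ 0) :
    ∃ s, 0 < s ∧ s ≤ b ∧ f s = 0 ∧ ∀ t, 0 ≤ t → t < s → 0 < f t := by
  set Z := Set.Icc 0 b ∩ f ⁻¹' Set.Iic 0 with hZ
  have hZc : IsClosed Z := hf.preimage_isClosed_of_isClosed isClosed_Icc isClosed_Iic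
  have hZn : Z.Nonempty := ⟨b, ⟨hb, le_rfl⟩, hfb⟩
  have hZb : BddBelow Z := ⟨0, fun x hx => hx.1.1⟩
  have hs := hZc.csInf_mem hZn hZb
  set s := sInf Z with hsdef
  have hpos : ∀ t, 0 ≤ t → t < s → 0 < f t := by
    intro t ht hts
    by_contra! hle
    exact absurd (csInf_le hZb ⟨⟨ht, hts.le.trans hs.1.2⟩, hle⟩) (not_le.2 hts)
  have hs0 : 0 < s := by
    refine lt_of_le_of_ne hs.1.1 fun he => ?_
    have : f s ≤ 0 := hs.2
    rw [← he] at this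
    linarith
  refine ⟨s, hs0, hs.1.2, le_antisymm hs.2 ?_, hpos⟩
  obtain ⟨t, ht, hft⟩ := intermediate_value_Icc' hs0.le
    (hf.mono (Set.Icc_subset_Icc le_rfl hs.1.2)) ⟨(hs.2 : f s ≤ 0), h0.le⟩
  rcases ht.2.lt_or_eq with hlt | heq
  · exact absurd hft (hpos t ht.1 hlt).ne'
  · rw [← heq, hft]

namespace ApproxCurve

variable {n : ℕ} {τ K a c : ℝ}

theorem norm_lt_one_ray (h : ApproxCurve n τ K a c) {σ : ℝ} (h0 : 0 ≤ σ)
    (hr : radius n τ σ ≤ 2 / 3) :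
    radius n τ σ < 1 ∧ radius n τ (-σ) < 1 ∧ ‖pUp n τ (ray σ)‖ < 1 ∧ ‖pDn n τ (ray σ)‖ < 1 := by
  have h1 : radius n τ (-σ) ≤ radius n τ σ :=
    (radius_strictMono h.three_le h.pos).monotone (by linarith)
  rw [pUp_ray, pDn_ray, norm_real, norm_real, Real.norm_of_nonneg (radius_pos h.three_le h.pos _).le,
    Real.norm_of_nonneg (radius_pos h.three_le h.pos _).le]
  refine ⟨?_, ?_, ?_, ?_⟩ <;> linarith

theorem estimates_ray (h : ApproxCurve n τ K a c) {σ : ℝ} (h0 : 0 ≤ σ)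
    (hr : radius n τ σ ≤ 2 / 3) :
    ‖coordH n τ a c (ray σ)‖ ≤ K ∧
      |(coordP n τ a c (ray σ)).re - (1 - (n - 1) * radius n τ σ) / (1 - radius n τ σ)| ≤
        K * τ ^ 2 ∧ 0 < (coordR n τ a c (ray σ)).re ∧ 0 < (coordQ n τ a c (ray σ)).re := by
  have hp : ‖pUp n τ (ray σ)‖ = radius n τ σ := by
    rw [pUp_ray, norm_real, Real.norm_of_nonneg (radius_pos h.three_le h.pos _).le]
  obtain ⟨h1, h2, h3, h4, -, -⟩ := (h.estimates (ray σ) (by rwa [ray_im])).2 (by rwa [hp])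
  refine ⟨h1, ?_, h3, h4⟩
  obtain ⟨r1, r2, -, -⟩ := h.norm_lt_one_ray h0 hr
  rw [pUp_ray, coordP_ray a c r1 r2] at h2
  rw [← Real.norm_eq_abs, ← norm_real]
  push_cast
  exact h2

theorem regularAt_ray (h : ApproxCurve n τ K a c) {σ : ℝ} (h0 : 0 ≤ σ)
    (hr : radius n τ σ ≤ 2 / 3) (hP : 0 < (coordP n τ a c (ray σ)).re) :
    RegularAt n τ a c (ray σ) := by
  obtain ⟨-, -, r3, r4⟩ := h.norm_lt_one_ray h0 hr
  obtain ⟨-, -, h3, h4⟩ := h.estimates_ray h0 hr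
  exact ⟨r3, r4, Or.inl hP, Or.inl h3, Or.inl h4⟩

/-- All factors are positive, so `ξ` moves vertically when `φ` does. -/
theorem coordH_ray (h : ApproxCurve n τ K a c) {σ : ℝ} (h0 : 0 ≤ σ)
    (hr : radius n τ σ ≤ 2 / 3) (hP : 0 < (coordP n τ a c (ray σ)).re) :
    coordH n τ a c (ray σ) = (‖coordH n τ a c (ray σ)‖ : ℂ) := by
  obtain ⟨r1, r2, -, -⟩ := h.norm_lt_one_ray h0 hr
  obtain ⟨-, -, h3, h4⟩ := h.estimates_ray h0 hr
  have hr1 := radius_pos h.three_le h.pos σ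
  have hr2 := radius_pos h.three_le h.pos (-σ)
  have hd : 0 ≤ 1 / (1 - radius n τ σ) + 1 / (1 - radius n τ (-σ)) - 1 := by
    have e1 : 1 ≤ 1 / (1 - radius n τ σ) := by
      rw [le_div_iff₀ (by linarith)]; linarith
    have e2 : 0 ≤ 1 / (1 - radius n τ (-σ)) := div_nonneg zero_le_one (by linarith)
    linarith
  rw [coordH, coordP_ray a c r1 r2, coordR_ray a c r1 r2, coordQ_ray a c r1 r2, dthetaC_ray,
    ← ofReal_cpow hP.le, ← ofReal_cpow h3.le, ← ofReal_cpow h4.le, ← ofReal_mul, ← ofReal_mul,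
    ← ofReal_mul, norm_real, Real.norm_of_nonneg]
  positivity

/-- The modulus is used because it remains continuous up to a zero of `P` and beyond, the exponent
`2/3` of `‖P‖` being positive, whereas `RegularAt` fails there. -/
theorem continuousOn_norm_coordH_ray (h : ApproxCurve n τ K a c) {b : ℝ}
    (hr : radius n τ b ≤ 2 / 3) :
    ContinuousOn (fun σ => ‖coordH n τ a c (ray σ)‖) (Set.Icc 0 b) := by
  intro σ hσ
  have hrσ : radius n τ σ ≤ 2 / 3 :=
    ((radius_strictMono h.three_le h.pos).monotone hσ.2).trans hr
  obtain ⟨-, -, r3, r4⟩ := h.norm_lt_one_ray hσ.1 hrσ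
  obtain ⟨-, -, h3, h4⟩ := h.estimates_ray hσ.1 hrσ
  have hcomp : ∀ {f : ℂ → ℂ}, DifferentiableAt ℂ f (ray σ) →
      ContinuousAt (fun σ => ‖f (ray σ)‖) σ := fun hf =>
    (ContinuousAt.comp (f := ray) hf.continuousAt continuous_ray.continuousAt).norm
  have c1 := hcomp (differentiableAt_coordP h.three_le a c r3 r4)
  have c2 := hcomp (differentiableAt_coordR h.three_le a c r3 r4)
  have c3 := hcomp (differentiableAt_coordQ h.three_le a c r3 r4)
  have c4 := hcomp (differentiableAt_dthetaC h.three_le r3 r4)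
  have n2 : ‖coordR n τ a c (ray σ)‖ ≠ 0 := (h3.trans_le (re_le_norm _)).ne'
  have n3 : ‖coordQ n τ a c (ray σ)‖ ≠ 0 := (h4.trans_le (re_le_norm _)).ne'
  simp only [norm_coordH]
  exact ((((c1.rpow_const (Or.inr (by norm_num))).mul (c2.rpow_const (Or.inl n2))).mul
    (c3.rpow_const (Or.inl n3))).mul c4).continuousWithinAt

theorem continuousOn_coordP_ray (h : ApproxCurve n τ K a c) {b : ℝ}
    (hr : radius n τ b ≤ 2 / 3) :
    ContinuousOn (fun σ => (coordP n τ a c (ray σ)).re) (Set.Icc 0 b) := by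
  intro σ hσ
  have hrσ : radius n τ σ ≤ 2 / 3 :=
    ((radius_strictMono h.three_le h.pos).monotone hσ.2).trans hr
  obtain ⟨-, -, r3, r4⟩ := h.norm_lt_one_ray hσ.1 hrσ
  exact (continuous_re.continuousAt.comp (ContinuousAt.comp (f := ray)
    (differentiableAt_coordP h.three_le a c r3 r4).continuousAt
    continuous_ray.continuousAt)).continuousWithinAt

end ApproxCurve

end PerturbedCircle

/-! ### The upper bound for the widths. -/

namespace PerturbedCircle

open Complex

theorem ray_image_Icc (b : ℝ) (hb : 0 ≤ b) : ray '' Set.Icc 0 b = segment ℝ (ray 0) (ray b) := by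
  have h : ray = AffineMap.lineMap (k := ℝ) (Real.pi / 2 : ℂ) (Real.pi / 2 + I) := by
    funext σ
    simp [ray, AffineMap.lineMap_apply, add_comm]
  rw [← segment_eq_Icc hb, h, image_segment]

/-- A compact segment of `ray` in an open set has an open convex neighbourhood in that set. -/
theorem exists_convex_nhd_ray {b : ℝ} (hb : 0 ≤ b) {V : Set ℂ} (hV : IsOpen V)
    (h : ∀ σ ∈ Set.Icc 0 b, ray σ ∈ V) :
    ∃ U : Set ℂ, IsOpen U ∧ Convex ℝ U ∧ U ⊆ V ∧ ∀ σ ∈ Set.Icc 0 b, ray σ ∈ U := by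
  have hc : IsCompact (ray '' Set.Icc 0 b) := isCompact_Icc.image continuous_ray
  obtain ⟨δ, hδ, hsub⟩ := hc.exists_thickening_subset_open hV (by
    rintro _ ⟨σ, hσ, rfl⟩; exact h σ hσ)
  refine ⟨Metric.thickening δ (ray '' Set.Icc 0 b), Metric.isOpen_thickening, ?_, hsub,
    fun σ hσ => Metric.self_subset_thickening hδ _ ⟨σ, hσ, rfl⟩⟩
  rw [ray_image_Icc b hb]
  exact (convex_segment _ _).thickening δ

namespace ApproxCurve

variable {n : ℕ} {τ K a c : ℝ}

/-- The continuation of the curvature along `ray`, as long as `coordP` does not vanish. -/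
theorem extension_ray (h : ApproxCurve n τ K a c) {w : ℝ} {F : ℂ → ℂ}
    (hF : IsNonvanishingExtension (curvXi n (τ ^ n) a c) w F) {b : ℝ} (hb : 0 ≤ b)
    (hr : radius n τ b ≤ 2 / 3) (hP : ∀ σ ∈ Set.Icc 0 b, 0 < (coordP n τ a c (ray σ)).re)
    (hw : (∫ t in (0 : ℝ)..b, ‖coordH n τ a c (ray t)‖ /
      densityInt n (τ ^ n) a c (2 * Real.pi)) < w) :
    F (xiAngle n (τ ^ n) a c (thetaR n τ (Real.pi / 2)) +
      ((∫ t in (0 : ℝ)..b, ‖coordH n τ a c (ray t)‖ /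
        densityInt n (τ ^ n) a c (2 * Real.pi) : ℝ) : ℂ) * I) = coordK n τ a c (ray b) := by
  set C := densityInt n (τ ^ n) a c (2 * Real.pi) with hC
  have hC0 : 0 < C := h.regular.densityInt_two_pi_pos
  set ξ₀ := xiAngle n (τ ^ n) a c (thetaR n τ (Real.pi / 2)) with hξ₀
  set T : ℝ → ℝ := fun s => ∫ t in (0 : ℝ)..s, ‖coordH n τ a c (ray t)‖ / C with hT
  have hrσ : ∀ σ ∈ Set.Icc 0 b, radius n τ σ ≤ 2 / 3 := fun σ hσ =>
    ((radius_strictMono h.three_le h.pos).monotone hσ.2).trans hr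
  have hcont : ContinuousOn (fun t => ‖coordH n τ a c (ray t)‖ / C) (Set.Icc 0 b) :=
    (h.continuousOn_norm_coordH_ray hr).div_const _
  have hT0 : ∀ σ ∈ Set.Icc 0 b, 0 ≤ T σ ∧ T σ ≤ T b := by
    intro σ hσ
    have i1 : IntervalIntegrable (fun t => ‖coordH n τ a c (ray t)‖ / C) MeasureTheory.volume 0 σ :=
      (hcont.mono (Set.Icc_subset_Icc le_rfl hσ.2)).intervalIntegrable_of_Icc hσ.1
    have i2 : IntervalIntegrable (fun t => ‖coordH n τ a c (ray t)‖ / C) MeasureTheory.volume σ b :=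
      (hcont.mono (Set.Icc_subset_Icc hσ.1 le_rfl)).intervalIntegrable_of_Icc hσ.2
    have e := intervalIntegral.integral_add_adjacent_intervals i1 i2
    have p1 := intervalIntegral.integral_nonneg (μ := MeasureTheory.volume) hσ.1
      (fun t _ => div_nonneg (norm_nonneg (coordH n τ a c (ray t))) hC0.le)
    have p2 := intervalIntegral.integral_nonneg (μ := MeasureTheory.volume) hσ.2
      (fun t _ => div_nonneg (norm_nonneg (coordH n τ a c (ray t))) hC0.le)
    simp only [hT]
    exact ⟨p1, by linarith⟩
  -- the variable `ξ` near the segment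
  obtain ⟨U, hU, hUc, hUV, hUS⟩ := exists_convex_nhd_ray hb (isOpen_regularAt h.three_le τ a c)
    (fun σ hσ => h.regularAt_ray hσ.1 (hrσ σ hσ) (hP σ hσ))
  have h0b : (0 : ℝ) ∈ Set.Icc 0 b := ⟨le_rfl, hb⟩
  have hx₀ : ((Real.pi / 2 : ℝ) : ℂ) ∈ U := by
    have := hUS 0 h0b
    rwa [ray_zero] at this
  obtain ⟨X, hX, hXr⟩ := h.exists_primitive hU hUc (fun φ hφ => hUV hφ) hx₀
  -- The derivative of `X ∘ ray` is `i` times a nonnegative number, so its real part stays at `ξ₀`.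
  have hXray : ∀ σ ∈ Set.Icc 0 b, X (ray σ) = ξ₀ + (T σ : ℂ) * I := by
    intro σ hσ
    have hd : ∀ t ∈ Set.uIcc 0 σ, HasDerivAt (fun t => X (ray t))
        (((‖coordH n τ a c (ray t)‖ / C : ℝ) : ℂ) * I) t := by
      intro t ht
      rw [Set.uIcc_of_le hσ.1] at ht
      have ht' : t ∈ Set.Icc 0 b := ⟨ht.1, ht.2.trans hσ.2⟩
      refine ((hX _ (hUS t ht')).comp_of_eq t (hasDerivAt_ray t) rfl).congr_deriv ?_
      rw [h.coordH_ray ht'.1 (hrσ t ht') (hP t ht'), norm_real, norm_norm]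
      push_cast
      rfl
    have hi : IntervalIntegrable (fun t => ((‖coordH n τ a c (ray t)‖ / C : ℝ) : ℂ) * I)
        MeasureTheory.volume 0 σ := by
      refine ContinuousOn.intervalIntegrable_of_Icc hσ.1 ?_
      exact (continuous_ofReal.comp_continuousOn
        (hcont.mono (Set.Icc_subset_Icc le_rfl hσ.2))).mul continuousOn_const
    have e := intervalIntegral.integral_eq_sub_of_hasDerivAt hd hi
    rw [intervalIntegral.integral_mul_const, intervalIntegral.integral_ofReal, ray_zero,
      hXr _ hx₀] at e
    linear_combination -e
  -- the identity theorem
  have hXc : ContinuousOn X U := fun φ hφ => (hX φ hφ).continuousAt.continuousWithinAt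
  obtain ⟨W, hW, hWc, hWV, hWS⟩ := exists_convex_nhd_ray hb
    -- The neighbourhood is shrunk until `X` maps it into the strip where `F` is holomorphic; then
    -- `F ∘ X` and `coordK` can be compared from the real axis.
    (hXc.isOpen_inter_preimage hU (isOpen_strip w)) (fun σ hσ => by
      refine ⟨hUS σ hσ, ?_⟩
      have h1 := hT0 σ hσ
      change |(X (ray σ)).im| < w
      rw [hXray σ hσ]
      simp only [add_im, ofReal_im, mul_im, ofReal_re, I_im, I_re, mul_one, mul_zero, zero_add,
        add_zero]
      rw [abs_of_nonneg h1.1]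
      exact h1.2.trans_lt hw)
  have hx₁ : ((Real.pi / 2 : ℝ) : ℂ) ∈ W := by
    have := hWS 0 h0b
    rwa [ray_zero] at this
  have d1 : DifferentiableOn ℂ (fun φ => F (X φ)) W := fun φ hφ => by
    have h1 : DifferentiableAt ℂ F (X φ) :=
      hF.differentiableOn.differentiableAt ((isOpen_strip w).mem_nhds (hWV hφ).2)
    exact (h1.comp φ (hX φ (hWV hφ).1).differentiableAt).differentiableWithinAt
  have d2 : DifferentiableOn ℂ (coordK n τ a c) W := fun φ hφ =>
    ((hUV (hWV hφ).1 : RegularAt n τ a c φ).differentiableAt_coordK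
      h.three_le).differentiableWithinAt
  have heq := AnalyticOnNhd.eqOn_of_preconnected_of_frequently_eq
    (d1.analyticOnNhd hW) (d2.analyticOnNhd hW) hWc.isPreconnected hx₁
    (frequently_eq_of_real (by
      have : ∀ᶠ y : ℝ in 𝓝 (Real.pi / 2), (y : ℂ) ∈ W :=
        continuous_ofReal.continuousAt.eventually_mem (hW.mem_nhds hx₁)
      filter_upwards [this] with y hy
      rw [hXr y (hWV hy).1, hF.eq_on_real, h.regular.curvXi_xiAngle, h.coordK_ofReal]))
  have hbb : b ∈ Set.Icc 0 b := ⟨hb, le_rfl⟩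
  have := heq (hWS b hbb)
  simp only [] at this
  rw [← this, hXray b hbb]

/-- The curvature does not extend past the first zero of `coordP` on `ray`. -/
theorem width_le_of_zero (h : ApproxCurve n τ K a c) {s : ℝ} (hs : 0 < s)
    (hr : radius n τ s ≤ 2 / 3) (h0 : (coordP n τ a c (ray s)).re = 0)
    (hP : ∀ σ, 0 ≤ σ → σ < s → 0 < (coordP n τ a c (ray σ)).re) {w : ℝ}
    (hw : w ∈ extensionWidths (curvXi n (τ ^ n) a c)) :
    w ≤ ∫ t in (0 : ℝ)..s, ‖coordH n τ a c (ray t)‖ /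
      densityInt n (τ ^ n) a c (2 * Real.pi) := by
  obtain ⟨hw0, F, hF⟩ := hw
  by_contra! hlt
  set C := densityInt n (τ ^ n) a c (2 * Real.pi) with hC
  have hC0 : 0 < C := h.regular.densityInt_two_pi_pos
  set T : ℝ → ℝ := fun s => ∫ t in (0 : ℝ)..s, ‖coordH n τ a c (ray t)‖ / C with hT
  set ξ₀ := xiAngle n (τ ^ n) a c (thetaR n τ (Real.pi / 2)) with hξ₀
  have hcont : ContinuousOn (fun t => ‖coordH n τ a c (ray t)‖ / C) (Set.Icc 0 s) :=
    (h.continuousOn_norm_coordH_ray hr).div_const _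
  have hint : IntervalIntegrable (fun t => ‖coordH n τ a c (ray t)‖ / C) MeasureTheory.volume 0 s :=
    hcont.intervalIntegrable_of_Icc hs.le
  have hTc : ContinuousOn T (Set.Icc 0 s) := by
    have := intervalIntegral.continuousOn_primitive_interval (μ := MeasureTheory.volume)
      (a := 0) (b := s) (f := fun t => ‖coordH n τ a c (ray t)‖ / C) (by
        rw [Set.uIcc_of_le hs.le]; exact hcont.integrableOn_Icc)
    rwa [Set.uIcc_of_le hs.le] at this
  have hTs : 0 ≤ T s := intervalIntegral.integral_nonneg hs.le
      (fun t _ => div_nonneg (norm_nonneg (coordH n τ a c (ray t))) hC0.le)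
  have hTmono : ∀ σ, 0 ≤ σ → σ < s → T σ ≤ T s := by
    intro σ hσ hσs
    have i1 := hint.mono_set (c := 0) (d := σ) (by
      rw [Set.uIcc_of_le hσ, Set.uIcc_of_le hs.le]; exact Set.Icc_subset_Icc le_rfl hσs.le)
    have i2 := hint.mono_set (c := σ) (d := s) (by
      rw [Set.uIcc_of_le hσs.le, Set.uIcc_of_le hs.le]; exact Set.Icc_subset_Icc hσ le_rfl)
    have e := intervalIntegral.integral_add_adjacent_intervals i1 i2
    have p2 := intervalIntegral.integral_nonneg (μ := MeasureTheory.volume) hσs.le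
      (fun t _ => div_nonneg (norm_nonneg (coordH n τ a c (ray t))) hC0.le)
    simp only [hT]
    linarith
  have hval : ∀ σ, 0 ≤ σ → σ < s → F (ξ₀ + (T σ : ℂ) * I) = coordK n τ a c (ray σ) := by
    intro σ hσ hσs
    refine h.extension_ray hF hσ
      (((radius_strictMono h.three_le h.pos).monotone hσs.le).trans hr)
      (fun t ht => hP t ht.1 (ht.2.trans_lt hσs)) ((hTmono σ hσ hσs).trans_lt hlt)
  have hstrip : (ξ₀ + (T s : ℂ) * I : ℂ) ∈ strip w := by
    change |(ξ₀ + (T s : ℂ) * I : ℂ).im| < w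
    simp only [add_im, ofReal_im, mul_im, ofReal_re, I_im, I_re, mul_one, mul_zero, zero_add,
      add_zero]
    rwa [abs_of_nonneg hTs]
  have hne : (𝓝[Set.Ico 0 s] s).NeBot := by
    rw [← mem_closure_iff_nhdsWithin_neBot, closure_Ico hs.ne]
    exact ⟨hs.le, le_rfl⟩
  have l1 : Tendsto (fun σ => F (ξ₀ + (T σ : ℂ) * I)) (𝓝[Set.Ico 0 s] s)
      (𝓝 (F (ξ₀ + (T s : ℂ) * I))) := by
    have hFc : ContinuousAt F (ξ₀ + (T s : ℂ) * I) :=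
      (hF.differentiableOn.differentiableAt
        ((isOpen_strip w).mem_nhds hstrip)).continuousAt
    refine hFc.tendsto.comp ?_
    have hTt : Tendsto T (𝓝[Set.Ico 0 s] s) (𝓝 (T s)) :=
      ((hTc s ⟨hs.le, le_rfl⟩).mono Set.Ico_subset_Icc_self)
    exact ((continuous_ofReal.continuousAt.tendsto.comp hTt).mul_const I).const_add _
  obtain ⟨r1, r2, r3, r4⟩ := h.norm_lt_one_ray hs.le hr
  obtain ⟨-, -, h3, -⟩ := h.estimates_ray hs.le hr
  have hK0 : coordK n τ a c (ray s) = 0 := by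
    rw [coordK, coordP_ray a c r1 r2, h0, ofReal_zero, zero_mul]
  have l2 : Tendsto (fun σ => coordK n τ a c (ray σ)) (𝓝[Set.Ico 0 s] s) (𝓝 0) := by
    have hKc : ContinuousAt (coordK n τ a c) (ray s) :=
      ((differentiableAt_coordP h.three_le a c r3 r4).mul
        ((differentiableAt_coordR h.three_le a c r3 r4).cpow_const (Or.inl h3))).continuousAt
    rw [← hK0]
    exact (ContinuousAt.comp (f := ray) hKc continuous_ray.continuousAt).tendsto.mono_left
      nhdsWithin_le_nhds
  have l3 := l1.congr' (by
    filter_upwards [self_mem_nhdsWithin] with σ hσ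
    exact hval σ hσ.1 hσ.2)
  -- As `σ` increases to `s`, the value `F (ξ₀ + i T σ) = coordK (ray σ)` tends to 0, although `F`
  -- is continuous and nonzero at the limit point, which lies inside the strip.
  exact hF.ne_zero _ hstrip (tendsto_nhds_unique l3 l2)

/-- An upper bound for the widths of the strips to which the curvature extends. -/
theorem width_le (h : ApproxCurve n τ K a c) {σ₁ σ₃ : ℝ} (hσ₁ : 0 ≤ σ₁) (hσ : σ₁ ≤ σ₃)
    (h1 : K * τ ^ 2 ≤ 1 - (n - 1) * radius n τ σ₁) (hr : radius n τ σ₃ ≤ 2 / 3)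
    (h3 : K * τ ^ 2 ≤ (n - 1) * radius n τ σ₃ - 1) {w : ℝ}
    (hw : w ∈ extensionWidths (curvXi n (τ ^ n) a c)) :
    w ≤ ((∫ t in (0 : ℝ)..σ₁, limitDensity n (radius n τ t) *
        (1 + K * τ ^ 2 / (1 - (n - 1) * radius n τ t))) + K * (σ₃ - σ₁)) /
      densityInt n (τ ^ n) a c (2 * Real.pi) := by
  have hn1 : (3 : ℝ) ≤ n := by exact_mod_cast h.three_le
  set C := densityInt n (τ ^ n) a c (2 * Real.pi) with hC
  have hC0 : 0 < C := h.regular.densityInt_two_pi_pos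
  have hKτ := h.const_mul_pos
  have hmono := radius_strictMono h.three_le h.pos
  have hσ₃ : 0 ≤ σ₃ := hσ₁.trans hσ
  have hrσ : ∀ t ≤ σ₃, radius n τ t ≤ 2 / 3 := fun t ht => (hmono.monotone ht).trans hr
  have hD : ∀ t ≤ σ₁, K * τ ^ 2 ≤ 1 - (n - 1) * radius n τ t := fun t ht => by
    have := mul_le_mul_of_nonneg_left (hmono.monotone ht) (by linarith : (0 : ℝ) ≤ n - 1)
    linarith
  have hPpos : ∀ t, 0 ≤ t → t ≤ σ₁ → 0 < (coordP n τ a c (ray t)).re := by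
    intro t ht0 ht
    have hp : ‖pUp n τ (ray t)‖ = radius n τ t := by
      rw [pUp_ray, norm_real, Real.norm_of_nonneg (radius_pos h.three_le h.pos _).le]
    obtain ⟨hreg, -⟩ := (h.estimates (ray t) (by rwa [ray_im])).1 (by rw [hp]; exact hD t ht)
    obtain ⟨r1, r2, -, -⟩ := h.norm_lt_one_ray ht0 (hrσ t (ht.trans hσ))
    have := hreg.2.2.1
    rw [coordP_ray a c r1 r2] at this
    exact ofReal_mem_slitPlane.1 this
  -- The main term `(1-(n-1)r)/(1-r)` has a negative numerator and a denominator in `(0, 1)`, so it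
  -- is at most `1-(n-1)r ≤ -K τ²`, and the error cannot make `P` positive.
  have hP3 : (coordP n τ a c (ray σ₃)).re ≤ 0 := by
    obtain ⟨-, h2, -, -⟩ := h.estimates_ray hσ₃ hr
    have h4 : (1 - (n - 1) * radius n τ σ₃) / (1 - radius n τ σ₃) ≤
        1 - (n - 1) * radius n τ σ₃ := by
      have := radius_pos h.three_le h.pos σ₃
      rw [div_le_iff₀ (by linarith)]
      nlinarith
    linarith [(abs_le.1 h2).2]
  obtain ⟨s, hs0, hsb, hPs, hPlt⟩ := exists_first_zero hσ₃ (h.continuousOn_coordP_ray hr)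
    (hPpos 0 le_rfl hσ₁) hP3
  have hs1 : σ₁ < s := by
    by_contra! hle
    exact (hPpos s hs0.le hle).ne' hPs
  refine (h.width_le_of_zero hs0 (hrσ s hsb) hPs hPlt hw).trans ?_
  rw [intervalIntegral.integral_div]
  refine div_le_div_of_nonneg_right ?_ hC0.le
  have hcont := h.continuousOn_norm_coordH_ray hr
  have i1 : IntervalIntegrable (fun t => ‖coordH n τ a c (ray t)‖) MeasureTheory.volume 0 σ₁ :=
    (hcont.mono (Set.Icc_subset_Icc le_rfl hσ)).intervalIntegrable_of_Icc hσ₁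
  have i2 : IntervalIntegrable (fun t => ‖coordH n τ a c (ray t)‖) MeasureTheory.volume σ₁ s :=
    (hcont.mono (Set.Icc_subset_Icc hσ₁ hsb)).intervalIntegrable_of_Icc hs1.le
  rw [← intervalIntegral.integral_add_adjacent_intervals i1 i2]
  -- Up to `σ₁` the sharp estimate applies; on the remaining interval, of length at most `σ₃ - σ₁`,
  -- the bound `K` is enough.
  refine add_le_add ?_ ?_
  · refine intervalIntegral.integral_mono_on hσ₁ i1 ?_ ?_
    · refine ContinuousOn.intervalIntegrable_of_Icc hσ₁ ?_
      have hrc := (continuous_radius n τ).continuousOn (s := Set.Icc 0 σ₁)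
      have e1 : ∀ t ∈ Set.Icc 0 σ₁, 1 - (n - 1) * radius n τ t ≠ 0 := fun t ht => by
        have := hD t ht.2; linarith
      have e2 : ∀ t ∈ Set.Icc 0 σ₁, 1 + radius n τ t ≠ 0 := fun t _ => by
        have := radius_pos h.three_le h.pos t; linarith
      have e3 : ∀ t ∈ Set.Icc 0 σ₁, 1 - radius n τ t ≠ 0 := fun t ht => by
        have := hrσ t (ht.2.trans hσ); linarith
      simp only [limitDensity]
      refine ContinuousOn.mul (ContinuousOn.mul (ContinuousOn.mul ?_ ?_) ?_) ?_
      · exact (continuousOn_const.sub (continuousOn_const.mul hrc)).rpow_const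
          fun t ht => Or.inl (e1 t ht)
      · exact (continuousOn_const.add hrc).rpow_const fun t ht => Or.inl (e2 t ht)
      · exact (continuousOn_const.sub hrc).rpow_const fun t ht => Or.inl (e3 t ht)
      · exact continuousOn_const.add (continuousOn_const.div
          (continuousOn_const.sub (continuousOn_const.mul hrc)) e1)
    · intro t ht
      have hp : ‖pUp n τ (ray t)‖ = radius n τ t := by
        rw [pUp_ray, norm_real, Real.norm_of_nonneg (radius_pos h.three_le h.pos _).le]
      obtain ⟨-, -, h5⟩ := (h.estimates (ray t) (by rw [ray_im]; exact ht.1)).1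
        (by rw [hp]; exact hD t ht.2)
      rw [hp, pUp_ray, limitNorm_ofReal h.three_le (radius_pos h.three_le h.pos _).le
        (by linarith [hD t ht.2])] at h5
      exact h5
  · have h6 : ∫ t in σ₁..s, ‖coordH n τ a c (ray t)‖ ≤ ∫ t in σ₁..s, K :=
      intervalIntegral.integral_mono_on hs1.le i2 (by simp) fun t ht =>
        (h.estimates_ray (hσ₁.trans ht.1) (hrσ t (ht.2.trans hsb))).1
    refine h6.trans ?_
    rw [intervalIntegral.integral_const, smul_eq_mul, mul_comm]
    exact mul_le_mul_of_nonneg_left (by linarith) h.const_pos.le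

end ApproxCurve

end PerturbedCircle

/-! ### The regularized integral of the limit density. -/

namespace PerturbedCircle

open MeasureTheory

theorem limitDensity_nonneg {n : ℕ} (hn : 3 ≤ n) {r : ℝ} (h0 : 0 ≤ r) (h1 : (n - 1) * r ≤ 1) :
    0 ≤ limitDensity n r := by
  rw [← limitNorm_ofReal hn h0 h1]
  unfold limitNorm
  positivity

theorem limitDensity_le {n : ℕ} (hn : 3 ≤ n) {r : ℝ} (h0 : 0 ≤ r) (h1 : (n - 1) * r ≤ 1) :
    limitDensity n r ≤ 4 * (1 - (n - 1) * r) ^ (2 / 3 : ℝ) := by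
  have hn1 : (3 : ℝ) ≤ n := by exact_mod_cast hn
  have hr : r ≤ 1 / 2 := by nlinarith
  have e1 : (1 + r) ^ (-(1 / 2) : ℝ) ≤ 1 :=
    Real.rpow_le_one_of_one_le_of_nonpos (by linarith) (by norm_num)
  have e2 : (1 - r) ^ (-(7 / 6) : ℝ) ≤ 4 := by
    calc (1 - r) ^ (-(7 / 6) : ℝ) ≤ (1 / 2 : ℝ) ^ (-(7 / 6) : ℝ) :=
          Real.rpow_le_rpow_of_nonpos (by norm_num) (by linarith) (by norm_num)
      _ ≤ (1 / 2 : ℝ) ^ (-2 : ℝ) :=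
          Real.rpow_le_rpow_of_exponent_ge (by norm_num) (by norm_num) (by norm_num)
      _ = 4 := by
          rw [Real.rpow_neg (by norm_num)]; norm_num
  have e3 : 0 ≤ (1 - (n - 1) * r) ^ (2 / 3 : ℝ) := Real.rpow_nonneg (by linarith) _
  have e4 : 0 ≤ (1 - r) ^ (-(7 / 6) : ℝ) := Real.rpow_nonneg (by linarith) _
  rw [limitDensity]
  calc _ ≤ (1 - (n - 1) * r) ^ (2 / 3 : ℝ) * 1 * 4 := by gcongr
    _ = _ := by ring

/-- Each of the three powers is `1 + O(r)`. As `r` decays exponentially away from the critical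
height, this makes `profile n s - 1` integrable up to infinity. -/
theorem abs_limitDensity_sub_one_le {n : ℕ} (hn : 3 ≤ n) {r : ℝ} (h0 : 0 ≤ r)
    (h1 : (n - 1) * r ≤ 1) : |limitDensity n r - 1| ≤ 8 * n * r := by
  have hn1 : (3 : ℝ) ≤ n := by exact_mod_cast hn
  have hr : r ≤ 1 / 2 := by nlinarith
  have a1 : 1 - (n - 1) * r ≤ (1 - (n - 1) * r) ^ (2 / 3 : ℝ) :=
    Real.self_le_rpow_of_le_one (by linarith) (by nlinarith) (by norm_num)
  have a2 : (1 - (n - 1) * r) ^ (2 / 3 : ℝ) ≤ 1 :=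
    Real.rpow_le_one (by linarith) (by nlinarith) (by norm_num)
  have b1 : 1 - r ≤ (1 + r) ^ (-(1 / 2) : ℝ) := by
    calc 1 - r ≤ (1 + r)⁻¹ := by
          rw [← one_div, le_div_iff₀ (by linarith)]; nlinarith
      _ = (1 + r) ^ (-1 : ℝ) := (Real.rpow_neg_one _).symm
      _ ≤ _ := Real.rpow_le_rpow_of_exponent_le (by linarith) (by norm_num)
  have b2 : (1 + r) ^ (-(1 / 2) : ℝ) ≤ 1 :=
    Real.rpow_le_one_of_one_le_of_nonpos (by linarith) (by norm_num)
  have c1 : 1 ≤ (1 - r) ^ (-(7 / 6) : ℝ) :=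
    Real.one_le_rpow_of_pos_of_le_one_of_nonpos (by linarith) (by linarith) (by norm_num)
  have c2 : (1 - r) ^ (-(7 / 6) : ℝ) ≤ 1 + 8 * r := by
    calc (1 - r) ^ (-(7 / 6) : ℝ) ≤ (1 - r) ^ (-2 : ℝ) :=
          Real.rpow_le_rpow_of_exponent_ge (by linarith) (by linarith) (by norm_num)
      _ = ((1 - r) ^ 2)⁻¹ := by
          rw [Real.rpow_neg (by linarith)]; norm_num
      _ ≤ 1 + 8 * r := by
          rw [← one_div, div_le_iff₀ (by nlinarith)]
          nlinarith [mul_nonneg h0 (sub_nonneg.2 hr), mul_nonneg (mul_nonneg h0 h0) h0]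
  set A := (1 - (n - 1) * r) ^ (2 / 3 : ℝ)
  set B := (1 + r) ^ (-(1 / 2) : ℝ)
  set E := (1 - r) ^ (-(7 / 6) : ℝ)
  have hAB1 : (1 - (n - 1) * r) * (1 - r) ≤ A * B :=
    mul_le_mul a1 b1 (by linarith) (by linarith)
  have hAB0 : 0 ≤ A * B := mul_nonneg (by linarith) (by linarith)
  have hAB2 : A * B ≤ 1 := mul_le_one₀ a2 (by linarith) b2
  have hlow : A * B ≤ A * B * E := le_mul_of_one_le_right hAB0 c1
  have hup : A * B * E ≤ E := mul_le_of_le_one_left (by linarith) hAB2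
  have hnr : r ≤ n * r := le_mul_of_one_le_left h0 (by linarith)
  change |A * B * E - 1| ≤ _
  rw [abs_le]
  constructor
  · nlinarith [mul_nonneg (mul_nonneg h0 h0) (by linarith : (0 : ℝ) ≤ n - 1)]
  · linarith

/-- The function `limitDensity` in terms of the distance from the critical height. -/
def profile (n : ℕ) (s : ℝ) : ℝ := limitDensity n (Real.exp (-(n * s)) / (n - 1))

theorem profile_arg {n : ℕ} (hn : 3 ≤ n) {s : ℝ} (hs : 0 ≤ s) :
    0 ≤ Real.exp (-(n * s)) / ((n : ℝ) - 1) ∧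
      ((n : ℝ) - 1) * (Real.exp (-(n * s)) / (n - 1)) = Real.exp (-(n * s)) ∧
      Real.exp (-(n * s)) ≤ 1 := by
  have hn1 : (3 : ℝ) ≤ n := by exact_mod_cast hn
  refine ⟨div_nonneg (Real.exp_pos _).le (by linarith), ?_, Real.exp_le_one_iff.2 ?_⟩
  · have : (n : ℝ) - 1 ≠ 0 := by linarith
    field_simp
  · have : 0 ≤ n * s := by positivity
    linarith

theorem profile_nonneg {n : ℕ} (hn : 3 ≤ n) {s : ℝ} (hs : 0 ≤ s) : 0 ≤ profile n s := by
  obtain ⟨h1, h2, h3⟩ := profile_arg hn hs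
  exact limitDensity_nonneg hn h1 (h2.trans_le h3)

theorem profile_le {n : ℕ} (hn : 3 ≤ n) {s : ℝ} (hs : 0 ≤ s) :
    profile n s ≤ 4 * (1 - Real.exp (-(n * s))) ^ (2 / 3 : ℝ) := by
  obtain ⟨h1, h2, h3⟩ := profile_arg hn hs
  have := limitDensity_le hn h1 (h2.trans_le h3)
  rwa [h2] at this

theorem profile_le_four {n : ℕ} (hn : 3 ≤ n) {s : ℝ} (hs : 0 ≤ s) : profile n s ≤ 4 := by
  have h3 := (profile_arg hn hs).2.2
  have h4 := Real.exp_pos (-(n * s))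
  have : (1 - Real.exp (-(n * s))) ^ (2 / 3 : ℝ) ≤ 1 :=
    Real.rpow_le_one (by linarith) (by linarith) (by norm_num)
  linarith [profile_le hn hs]

theorem abs_profile_sub_one_le {n : ℕ} (hn : 3 ≤ n) {s : ℝ} (hs : 0 ≤ s) :
    |profile n s - 1| ≤ 8 * n * Real.exp (-n * s) := by
  have hn1 : (3 : ℝ) ≤ n := by exact_mod_cast hn
  obtain ⟨h1, h2, h3⟩ := profile_arg hn hs
  refine (abs_limitDensity_sub_one_le hn h1 (h2.trans_le h3)).trans ?_
  rw [neg_mul]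
  refine mul_le_mul_of_nonneg_left (div_le_self (Real.exp_pos _).le (by linarith)) (by positivity)

theorem continuousOn_profile {n : ℕ} (hn : 3 ≤ n) : ContinuousOn (profile n) (Set.Ici 0) := by
  have hn1 : (3 : ℝ) ≤ n := by exact_mod_cast hn
  have hc : ContinuousOn (fun s : ℝ => Real.exp (-(n * s)) / ((n : ℝ) - 1)) (Set.Ici 0) := by
    fun_prop
  unfold profile limitDensity
  refine ContinuousOn.mul (ContinuousOn.mul ?_ ?_) ?_
  · exact (continuousOn_const.sub (continuousOn_const.mul hc)).rpow_const
      fun s _ => Or.inr (by norm_num)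
  · exact (continuousOn_const.add hc).rpow_const fun s hs => Or.inl
      (by linarith [(profile_arg hn hs).1] : (0 : ℝ) < 1 + Real.exp (-(n * s)) / (n - 1)).ne'
  · refine (continuousOn_const.sub hc).rpow_const fun s hs => Or.inl ?_
    obtain ⟨h1, h2, h3⟩ := profile_arg hn hs
    exact (by nlinarith : (0 : ℝ) < 1 - Real.exp (-(n * s)) / (n - 1)).ne'

theorem intervalIntegrable_profile {n : ℕ} (hn : 3 ≤ n) {a b : ℝ} (ha : 0 ≤ a) (hab : a ≤ b) :
    IntervalIntegrable (profile n) volume a b :=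
  ((continuousOn_profile hn).mono fun _ hx => ha.trans hx.1).intervalIntegrable_of_Icc hab

/-- The regularized integral of `profile`. -/
theorem exists_integral_profile {n : ℕ} (hn : 3 ≤ n) :
    ∃ c : ℝ, ∀ L : ℝ, 0 ≤ L →
      |(∫ s in (0 : ℝ)..L, profile n s) - (L + c)| ≤ 8 * Real.exp (-n * L) := by
  have hn1 : (3 : ℝ) ≤ n := by exact_mod_cast hn
  have hneg : -(n : ℝ) < 0 := by linarith
  have hexp : ∀ L : ℝ, IntegrableOn (fun s => 8 * n * Real.exp (-n * s)) (Set.Ioi L) := fun L =>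
    (integrableOn_exp_mul_Ioi hneg L).const_mul _
  have hcont : ContinuousOn (fun s => profile n s - 1) (Set.Ioi 0) :=
    ((continuousOn_profile hn).sub continuousOn_const).mono Set.Ioi_subset_Ici_self
  have hint : IntegrableOn (fun s => profile n s - 1) (Set.Ioi 0) := by
    refine Integrable.mono' (hexp 0) (hcont.aestronglyMeasurable measurableSet_Ioi) ?_
    filter_upwards [ae_restrict_mem measurableSet_Ioi] with s hs
    exact abs_profile_sub_one_le hn (le_of_lt hs)
  -- The error at `L` is the tail of this integral beyond `L`.
  refine ⟨∫ s in Set.Ioi 0, (profile n s - 1), fun L hL => ?_⟩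
  have hintL : IntegrableOn (fun s => profile n s - 1) (Set.Ioi L) :=
    hint.mono_set (Set.Ioi_subset_Ioi hL)
  have e1 := intervalIntegral.integral_interval_add_Ioi hint hintL
  have e2 : ∫ s in (0 : ℝ)..L, (profile n s - 1) = (∫ s in (0 : ℝ)..L, profile n s) - L := by
    rw [intervalIntegral.integral_sub (intervalIntegrable_profile hn le_rfl hL) (by simp)]
    simp
  have e3 : |∫ s in Set.Ioi L, (profile n s - 1)| ≤ ∫ s in Set.Ioi L, 8 * n * Real.exp (-n * s) := by
    rw [← Real.norm_eq_abs]
    refine MeasureTheory.norm_integral_le_of_norm_le (hexp L) ?_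
    filter_upwards [ae_restrict_mem measurableSet_Ioi] with s hs
    exact abs_profile_sub_one_le hn (hL.trans (le_of_lt hs))
  rw [integral_const_mul, integral_exp_mul_Ioi hneg] at e3
  have e4 : 8 * (n : ℝ) * (-Real.exp (-n * L) / -n) = 8 * Real.exp (-n * L) := by
    field_simp
  rw [e4] at e3
  have e5 : (∫ s in (0 : ℝ)..L, profile n s) - (L + ∫ s in Set.Ioi 0, (profile n s - 1)) =
      -∫ s in Set.Ioi L, (profile n s - 1) := by
    rw [← e1, e2]; ring
  rw [e5, abs_neg]
  exact e3

/-- The profile vanishes like the power `2/3` of `1 - e^{-ns}`, so the quotient has a singularity of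
exponent `-1/3` only, which is integrable. -/
theorem profile_div_le {n : ℕ} (hn : 3 ≤ n) {s : ℝ} (hs : 0 < s) :
    profile n s / (1 - Real.exp (-(n * s))) ≤ 4 * (1 + s ^ (-(1 / 3) : ℝ)) := by
  have hn1 : (3 : ℝ) ≤ n := by exact_mod_cast hn
  have hx : 0 < n * s := by positivity
  set x := n * s with hxdef
  have hxs : s ≤ x := le_mul_of_one_le_left hs.le (by linarith)
  have he : Real.exp (-x) ≤ 1 / (1 + x) := by
    rw [Real.exp_neg, ← one_div]
    exact one_div_le_one_div_of_le (by linarith) (by linarith [Real.add_one_le_exp x])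
  have hD : s / (1 + s) ≤ 1 - Real.exp (-x) := by
    have : 1 / (1 + x) ≤ 1 / (1 + s) := one_div_le_one_div_of_le (by linarith) (by linarith)
    have e : s / (1 + s) = 1 - 1 / (1 + s) := by field_simp; ring
    rw [e]; linarith
  have hD0 : 0 < s / (1 + s) := by positivity
  have hDpos : 0 < 1 - Real.exp (-x) := hD0.trans_le hD
  have h1 : profile n s / (1 - Real.exp (-x)) ≤ 4 * (1 - Real.exp (-x)) ^ (-(1 / 3) : ℝ) := by
    rw [div_le_iff₀ hDpos]
    refine (profile_le hn hs.le).trans (le_of_eq ?_)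
    have : (1 - Real.exp (-x)) ^ (2 / 3 : ℝ) =
        (1 - Real.exp (-x)) ^ (-(1 / 3) : ℝ) * (1 - Real.exp (-x)) := by
      conv_rhs => rw [← Real.rpow_add_one hDpos.ne']
      norm_num
    rw [this, mul_assoc]
  refine h1.trans (mul_le_mul_of_nonneg_left ?_ (by norm_num))
  calc (1 - Real.exp (-x)) ^ (-(1 / 3) : ℝ) ≤ (s / (1 + s)) ^ (-(1 / 3) : ℝ) :=
        Real.rpow_le_rpow_of_nonpos hD0 hD (by norm_num)
    _ = (1 + s⁻¹) ^ (1 / 3 : ℝ) := by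
        rw [Real.rpow_neg hD0.le, ← Real.inv_rpow hD0.le]
        congr 1
        field_simp
        ring
    _ ≤ 1 ^ (1 / 3 : ℝ) + s⁻¹ ^ (1 / 3 : ℝ) :=
        Real.rpow_add_le_add_rpow zero_le_one (by positivity) (by norm_num) (by norm_num)
    _ = 1 + s ^ (-(1 / 3) : ℝ) := by
        rw [Real.one_rpow, Real.inv_rpow hs.le, Real.rpow_neg hs.le]

theorem continuousOn_profile_div {n : ℕ} (hn : 3 ≤ n) {u L : ℝ} (hu : 0 < u) :
    ContinuousOn (fun s => profile n s / (1 - Real.exp (-(n * s)))) (Set.Icc u L) := by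
  have hn1 : (3 : ℝ) ≤ n := by exact_mod_cast hn
  refine ((continuousOn_profile hn).mono fun _ hx => hu.le.trans hx.1).div (by fun_prop) ?_
  intro s hs
  have hs0 : 0 < s := hu.trans_le hs.1
  have : Real.exp (-(n * s)) < 1 := by
    have : 0 < n * s := by positivity
    rw [Real.exp_lt_one_iff]
    linarith
  linarith

/-- The bound does not depend on `u`: the relative error that blows up at the critical height
contributes only `O(L)` to the width, times `τ²`. -/
theorem integral_profile_div_le {n : ℕ} (hn : 3 ≤ n) {u L : ℝ} (hu : 0 < u) (huL : u ≤ L) :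
    0 ≤ ∫ s in u..L, profile n s / (1 - Real.exp (-(n * s))) ∧
    ∫ s in u..L, profile n s / (1 - Real.exp (-(n * s))) ≤ 10 * (1 + L) := by
  have hn1 : (3 : ℝ) ≤ n := by exact_mod_cast hn
  have hL : 0 < L := hu.trans_le huL
  constructor
  · refine intervalIntegral.integral_nonneg huL fun s hs => div_nonneg
      (profile_nonneg hn (hu.le.trans hs.1)) ?_
    linarith [(profile_arg hn (hu.le.trans hs.1)).2.2]
  have hir : IntervalIntegrable (fun s : ℝ => s ^ (-(1 / 3) : ℝ)) volume u L :=
    intervalIntegral.intervalIntegrable_rpow' (by norm_num)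
  have h1 : ∫ s in u..L, profile n s / (1 - Real.exp (-(n * s))) ≤
      ∫ s in u..L, 4 * (1 + s ^ (-(1 / 3) : ℝ)) := by
    refine intervalIntegral.integral_mono_on huL
      ((continuousOn_profile_div hn hu).intervalIntegrable_of_Icc huL)
      ((intervalIntegrable_const.add hir).const_mul 4) fun s hs =>
        profile_div_le hn (hu.trans_le hs.1)
  refine h1.trans ?_
  rw [intervalIntegral.integral_const_mul, intervalIntegral.integral_add (by simp) hir,
    integral_rpow (Or.inl (by norm_num))]
  have h2 : L ^ (-(1 / 3) + 1 : ℝ) ≤ 1 + L := by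
    calc L ^ (-(1 / 3) + 1 : ℝ) ≤ (1 + L) ^ (-(1 / 3) + 1 : ℝ) :=
          Real.rpow_le_rpow hL.le (by linarith) (by norm_num)
      _ ≤ 1 + L := Real.rpow_le_self_of_one_le (by linarith) (by norm_num)
  have h3 : 0 ≤ u ^ (-(1 / 3) + 1 : ℝ) := Real.rpow_nonneg hu.le _
  have h4 : (L ^ (-(1 / 3) + 1 : ℝ) - u ^ (-(1 / 3) + 1 : ℝ)) / (-(1 / 3) + 1) ≤
      (1 + L) * (3 / 2) := by
    rw [div_le_iff₀ (by norm_num)]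
    linarith
  have h5 : ∫ _ in u..L, (1 : ℝ) = L - u := by simp
  rw [h5]
  linarith

end PerturbedCircle

/-! ### The total `C`, and the integral up to the critical height. -/

namespace PerturbedCircle

open MeasureTheory

/-- At real points `|y| ≤ 2`, so `P`, `R` and `Q` are `1 + O(ε)`; `density_error` applies with
reference values 1, and `48 = 16 · 3`. -/
theorem abs_density_sub_one_le {n : ℕ} {ε a c : ℝ} (h : RegularCurve n ε a c) (hε : ε ≤ 1)
    (hs : ε * (n ^ 2 * 4 ^ n) ≤ 1 / 6) (θ : ℝ) :
    |density n ε a c θ - 1| ≤ 48 * (ε * (n ^ 2 * 4 ^ n)) := by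
  have hn1 : (3 : ℝ) ≤ n := by exact_mod_cast h.three_le
  have hε0 := h.pos
  set N : ℝ := n ^ 2 * 4 ^ n with hN
  have hεN : 0 < ε * N := by positivity
  have hy := h.abs_height_le_two θ
  set y := height a c θ
  have hterm : ∀ (k : ℝ) (m : ℕ), |k| ≤ n ^ 2 → m ≤ 2 * n → |k * ε * y ^ m| ≤ ε * N := by
    intro k m hk hm
    rw [abs_mul, abs_mul, abs_of_pos hε0, abs_pow]
    have h1 : |y| ^ m ≤ 4 ^ n :=
      calc |y| ^ m ≤ 2 ^ m := by gcongr
        _ ≤ 2 ^ (2 * n) := by gcongr; norm_num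
        _ = 4 ^ n := by rw [pow_mul]; norm_num
    calc |k| * ε * |y| ^ m ≤ n ^ 2 * ε * 4 ^ n := by gcongr
      _ = ε * N := by rw [hN]; ring
  have hk1 : |(n : ℝ) * (n - 1) / 2| ≤ (n : ℝ) ^ 2 := by
    rw [abs_of_nonneg (by nlinarith)]; nlinarith
  have hk2 : |((n : ℝ) - 1) * (n - 2) / 2| ≤ (n : ℝ) ^ 2 := by
    rw [abs_of_nonneg (by nlinarith)]; nlinarith
  have hk3 : |(n : ℝ) * (n - 2) / 4 * ε| ≤ (n : ℝ) ^ 2 := by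
    rw [abs_of_nonneg (mul_nonneg (by nlinarith) hε0.le)]
    have : (n : ℝ) * (n - 2) / 4 * ε ≤ (n : ℝ) * (n - 2) / 4 * 1 := by
      apply mul_le_mul_of_nonneg_left hε (by nlinarith)
    nlinarith
  have hk4 : |((n : ℝ) - 1)| ≤ (n : ℝ) ^ 2 := by
    rw [abs_of_nonneg (by linarith)]; nlinarith
  have hk5 : |(n : ℝ) ^ 2 / 4 * ε| ≤ (n : ℝ) ^ 2 := by
    rw [abs_of_nonneg (by positivity)]; nlinarith [sq_nonneg (n : ℝ)]
  have hP : |curveP n ε y - 1| ≤ 3 * (ε * N) * 1 := by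
    have e1 := abs_le.1 (hterm _ (n - 2) hk1 (by omega))
    have e2 := abs_le.1 (hterm _ n hk2 (by omega))
    have e3 := abs_le.1 (hterm _ (2 * n - 2) hk3 (by omega))
    simp only [curveP]
    rw [abs_le]
    constructor <;> linarith [e1.1, e2.2, e3.2, e1.2, e2.1, e3.1]
  have hR : |curveR n ε y - 1| ≤ 3 * (ε * N) * 1 := by
    have e1 := abs_le.1 (hterm _ n hk4 (by omega))
    have e2 := abs_le.1 (hterm _ (2 * n - 2) hk5 (by omega))
    simp only [curveR]
    rw [abs_le]
    constructor <;> linarith [e1.1, e2.2, e1.2, e2.1]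
  have hQ : |curveQ n ε a c y - 1| ≤ 3 * (ε * N) := by
    have ha2 : |a| ≤ 2 := abs_le.2 ⟨by linarith [h.a_mem.1], by linarith [h.a_mem.2]⟩
    have hc2 : |c| ≤ 2 := abs_le.2 ⟨by linarith [h.c_mem.1], by linarith [h.c_mem.2]⟩
    have h1 := norm_curveQ_sub_one_le (n := n) (ε := ε) (a := a) (c := c) (y := y) (Y := 2) ha2 hc2 hy
    rw [Real.norm_eq_abs, Real.norm_of_nonneg hε0.le] at h1
    have h2 : ε * (n ^ 2 * 2 ^ (n - 2)) ≤ ε * N := by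
      rw [hN]
      have h3 : (2 : ℝ) ^ (n - 2) ≤ 4 ^ n :=
        (pow_le_pow_right₀ (by norm_num) (by omega : n - 2 ≤ n)).trans
          (pow_le_pow_left₀ (by norm_num) (by norm_num) n)
      gcongr
    linarith
  have main := density_error (d := 1) (d₀ := 1) (by positivity : 0 ≤ 3 * (ε * N)) (by linarith)
    one_pos one_pos one_pos hP hR hQ (by simpa using hεN.le)
  rw [density_eq h, abs_le]
  simp only [Real.one_rpow, one_mul, mul_one] at main
  constructor <;> linarith [main.1, main.2]

theorem abs_densityInt_sub_le {n : ℕ} {ε a c : ℝ} (h : RegularCurve n ε a c) (hε : ε ≤ 1)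
    (hs : ε * (n ^ 2 * 4 ^ n) ≤ 1 / 6) :
    |densityInt n ε a c (2 * Real.pi) - 2 * Real.pi| ≤ 400 * (ε * (n ^ 2 * 4 ^ n)) := by
  have e : densityInt n ε a c (2 * Real.pi) - 2 * Real.pi =
      ∫ t in (0 : ℝ)..2 * Real.pi, (density n ε a c t - 1) := by
    rw [intervalIntegral.integral_sub (h.continuous_density.intervalIntegrable _ _) (by simp),
      densityInt]
    simp
  have h1 := intervalIntegral.norm_integral_le_of_norm_le_const
    (a := 0) (b := 2 * Real.pi) (f := fun t => density n ε a c t - 1)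
    (fun t _ => abs_density_sub_one_le h hε hs t)
  rw [e, ← Real.norm_eq_abs]
  refine h1.trans ?_
  rw [sub_zero, abs_of_pos Real.two_pi_pos]
  have h2 : 0 ≤ ε * ((n : ℝ) ^ 2 * 4 ^ n) := mul_nonneg h.pos.le (by positivity)
  nlinarith [Real.pi_lt_d2, Real.pi_pos]

/-- The height of the first zero of the limit of the curvature, in the coordinate `φ`. -/
def critHeight (n : ℕ) (τ : ℝ) : ℝ := Real.log (2 / τ) - Real.log (((n : ℝ) - 1) ^ 2 / 2) / n

/-- `critHeight` is the solution of `(n-1) · radius = 1`, and the radius is proportional to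
`e^{nt}`. Measured downwards from it, all heights lead to the same function `profile`, whatever `τ`
is. -/
theorem radius_eq {n : ℕ} (hn : 3 ≤ n) {τ : ℝ} (hτ : 0 < τ) (t : ℝ) :
    ((n : ℝ) - 1) * radius n τ t = Real.exp (-(n * (critHeight n τ - t))) ∧
      radius n τ t = Real.exp (-(n * (critHeight n τ - t))) / (n - 1) := by
  have hn1 : (3 : ℝ) ≤ n := by exact_mod_cast hn
  have hn0 : (n : ℝ) - 1 ≠ 0 := by linarith
  have hpos : 0 < ((n : ℝ) - 1) ^ 2 / 2 := by positivity
  have e : -(n * (critHeight n τ - t)) =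
      n * Real.log (τ / 2) + Real.log (((n : ℝ) - 1) ^ 2 / 2) + n * t := by
    have : Real.log (2 / τ) = -Real.log (τ / 2) := by rw [← Real.log_inv, inv_div]
    rw [critHeight, this]
    field_simp
    ring
  have h1 : ((n : ℝ) - 1) * radius n τ t = Real.exp (-(n * (critHeight n τ - t))) := by
    rw [e, Real.exp_add, Real.exp_add, Real.exp_log hpos, Real.exp_nat_mul,
      Real.exp_log (by positivity), radius]
    ring
  refine ⟨h1, ?_⟩
  rw [← h1]
  field_simp

/-- The bounds for the width in terms of `profile`. -/
theorem integral_limitDensity_eq {n : ℕ} (hn : 3 ≤ n) {τ : ℝ} (hτ : 0 < τ) {u : ℝ} (hu : 0 < u)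
    (huL : u ≤ critHeight n τ) (κ : ℝ) :
    ∫ t in (0 : ℝ)..critHeight n τ - u, limitDensity n (radius n τ t) *
        (1 + κ / (1 - (n - 1) * radius n τ t)) =
      (∫ s in u..critHeight n τ, profile n s) +
        κ * ∫ s in u..critHeight n τ, profile n s / (1 - Real.exp (-(n * s))) := by
  set L := critHeight n τ with hL
  have e1 : ∀ t, limitDensity n (radius n τ t) * (1 + κ / (1 - (n - 1) * radius n τ t)) =
      (fun s => profile n s + κ * (profile n s / (1 - Real.exp (-(n * s))))) (L - t) := by
    intro t
    obtain ⟨h1, h2⟩ := radius_eq hn hτ t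
    rw [h1]
    conv_lhs => rw [h2]
    simp only [profile]
    ring
  simp only [e1]
  rw [intervalIntegral.integral_comp_sub_left
    (fun s => profile n s + κ * (profile n s / (1 - Real.exp (-(n * s))))), sub_sub_cancel, sub_zero,
    intervalIntegral.integral_add (intervalIntegrable_profile hn hu.le huL)
      (((continuousOn_profile_div hn hu).intervalIntegrable_of_Icc huL).const_mul κ),
    intervalIntegral.integral_const_mul]

/-- The errors are the tail of the regularized integral, the omitted piece `[0, u]` of the profile,
and the relative error. The sign of `κ` is free, so the statement serves for both bounds of the
width. -/
theorem abs_integral_limitDensity_sub_le {n : ℕ} (hn : 3 ≤ n) {c : ℝ}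
    (hc : ∀ L : ℝ, 0 ≤ L →
      |(∫ s in (0 : ℝ)..L, profile n s) - (L + c)| ≤ 8 * Real.exp (-n * L))
    {τ : ℝ} (hτ : 0 < τ) {u : ℝ} (hu : 0 < u) (huL : u ≤ critHeight n τ) (κ : ℝ) :
    |(∫ t in (0 : ℝ)..critHeight n τ - u, limitDensity n (radius n τ t) *
        (1 + κ / (1 - (n - 1) * radius n τ t))) - (critHeight n τ + c)| ≤
      8 * Real.exp (-n * critHeight n τ) + 4 * u + |κ| * (10 * (1 + critHeight n τ)) := by
  rw [integral_limitDensity_eq hn hτ hu huL]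
  set L := critHeight n τ
  obtain ⟨g0, g1⟩ := integral_profile_div_le hn hu huL
  have h1 := hc L (hu.le.trans huL)
  have h2 : |κ * ∫ s in u..L, profile n s / (1 - Real.exp (-(n * s)))| ≤
      |κ| * (10 * (1 + L)) := by
    rw [abs_mul, abs_of_nonneg g0]
    exact mul_le_mul_of_nonneg_left g1 (abs_nonneg κ)
  have h3 := intervalIntegral.integral_add_adjacent_intervals
    (intervalIntegrable_profile hn le_rfl hu.le) (intervalIntegrable_profile hn hu.le huL)
  have h4 : |∫ s in (0 : ℝ)..u, profile n s| ≤ 4 * u := by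
    have := intervalIntegral.norm_integral_le_of_norm_le_const (a := 0) (b := u)
      (f := profile n) (C := 4) (fun s hs => by
        rw [Set.uIoc_of_le hu.le] at hs
        rw [Real.norm_of_nonneg (profile_nonneg hn hs.1.le)]
        exact profile_le_four hn hs.1.le)
    rwa [sub_zero, abs_of_pos hu, Real.norm_eq_abs] at this
  have h5 : (∫ s in u..L, profile n s) + κ * (∫ s in u..L, profile n s / (1 - Real.exp (-(n * s)))) -
      (L + c) = ((∫ s in (0 : ℝ)..L, profile n s) - (L + c)) - (∫ s in (0 : ℝ)..u, profile n s) +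
        κ * ∫ s in u..L, profile n s / (1 - Real.exp (-(n * s))) := by
    rw [← h3]; ring
  rw [h5]
  refine (abs_add_le _ _).trans (add_le_add ((abs_sub _ _).trans (add_le_add h1 h4)) h2)

end PerturbedCircle

/-! ### Asymptotics of the width in `τ` and in `ε`. -/

namespace PerturbedCircle

theorem one_le_critHeight {n : ℕ} (hn : 3 ≤ n) {τ : ℝ} (hτ : 0 < τ)
    (h : τ ≤ Real.exp (-(n + 1))) : 1 ≤ critHeight n τ := by
  have hn1 : (3 : ℝ) ≤ n := by exact_mod_cast hn
  have h1 : (n : ℝ) + 1 ≤ Real.log (2 / τ) := by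
    rw [Real.le_log_iff_exp_le (by positivity), le_div_iff₀ hτ]
    calc Real.exp (n + 1) * τ ≤ Real.exp (n + 1) * Real.exp (-(n + 1)) := by gcongr
      _ = 1 := by rw [← Real.exp_add]; simp
      _ ≤ 2 := by norm_num
  have h2 : Real.log (((n : ℝ) - 1) ^ 2 / 2) / n ≤ n := by
    rw [div_le_iff₀ (by linarith)]
    have := Real.log_le_sub_one_of_pos (by
      have : 0 < (n : ℝ) - 1 := by linarith
      positivity : 0 < ((n : ℝ) - 1) ^ 2 / 2)
    nlinarith
  rw [critHeight]
  linarith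

theorem exp_neg_critHeight_le {n : ℕ} (hn : 3 ≤ n) {τ : ℝ} (hτ : 0 < τ) (hτ1 : τ ≤ 1) :
    Real.exp (-n * critHeight n τ) ≤ n ^ 2 * τ ^ 2 := by
  have hn1 : (3 : ℝ) ≤ n := by exact_mod_cast hn
  have h1 := (radius_eq hn hτ 0).1
  rw [sub_zero, ← neg_mul] at h1
  rw [← h1, radius, mul_zero, Real.exp_zero, mul_one]
  have h2 : (τ / 2) ^ n ≤ τ ^ 2 :=
    (pow_le_pow_left₀ (by positivity) (by linarith : τ / 2 ≤ τ) n).trans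
      (pow_le_pow_of_le_one hτ.le hτ1 (by omega))
  calc ((n : ℝ) - 1) * ((n - 1) / 2 * (τ / 2) ^ n) = ((n - 1) ^ 2 / 2) * (τ / 2) ^ n := by ring
    _ ≤ n ^ 2 * τ ^ 2 := by
      refine mul_le_mul (by nlinarith) h2 (by positivity) (by positivity)

/-- The asymptotics of the width in terms of `τ`. -/
theorem exists_width_asymptotics {n : ℕ} (hn : 3 ≤ n) :
    ∃ c K : ℝ, ∀ᶠ τ : ℝ in 𝓝[>] 0, ∃ a b : ℝ, RegularCurve n (τ ^ n) a b ∧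
      (extensionWidths (curvXi n (τ ^ n) a b)).Nonempty ∧
      BddAbove (extensionWidths (curvXi n (τ ^ n) a b)) ∧ 1 ≤ critHeight n τ ∧
      |2 * Real.pi * sSup (extensionWidths (curvXi n (τ ^ n) a b)) - (critHeight n τ + c)| ≤
        K * (τ ^ 2 * (1 + critHeight n τ)) := by
  have hn1 : (3 : ℝ) ≤ n := by exact_mod_cast hn
  obtain ⟨K, hK1, τ₀, hτ₀, hτ₀1, hest⟩ := exists_estimates hn
  obtain ⟨ε₀, hε₀, hreg⟩ := exists_regularCurve hn
  obtain ⟨c, hc⟩ := exists_integral_profile hn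
  set N : ℝ := n ^ 2 * 4 ^ n with hN
  have hN0 : 0 < N := by positivity
  -- The summands come from the tail `8 e^{-nL}`, from `4u` with `u = 4x` plus `10 x (1 + L)`, and
  -- from the crude piece `K · 5x` above the cut, where `x = K τ²`.
  set K₁ : ℝ := 8 * n ^ 2 + 26 * K + 5 * K ^ 2 with hK₁
  refine ⟨c, K₁ + 400 * N * (1 + |c| + K₁), ?_⟩
  filter_upwards [Ioo_mem_nhdsGT hτ₀, Ioo_mem_nhdsGT hε₀,
    Ioo_mem_nhdsGT (show (0 : ℝ) < 1 / (8 * n * K) by positivity),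
    Ioo_mem_nhdsGT (show (0 : ℝ) < 1 / (400 * N) by positivity),
    Ioo_mem_nhdsGT (Real.exp_pos (-((n : ℝ) + 1)))] with τ t1 t2 t3 t4 t5
  have hτ : 0 < τ := t1.1
  have hτ1 : τ ≤ 1 := t1.2.le.trans hτ₀1
  have hττ : τ ^ 2 ≤ τ := by nlinarith
  have hτn : τ ^ n ≤ τ ^ 2 := pow_le_pow_of_le_one hτ.le hτ1 (by omega)
  have t3' : τ * (8 * n * K) < 1 := (lt_div_iff₀ (by positivity)).1 t3.2
  have t4' : τ * (400 * N) < 1 := (lt_div_iff₀ (by positivity)).1 t4.2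
  obtain ⟨a, b, hab, ha, hb⟩ := hreg (τ ^ n) (by positivity) (by linarith [t2.2])
  set L := critHeight n τ with hL
  have hL1 : 1 ≤ L := one_le_critHeight hn hτ t5.2.le
  set x := K * τ ^ 2 with hx
  have hx0 : 0 < x := by positivity
  have hnx : n * x ≤ 1 / 8 := by
    have : n * x ≤ n * (K * τ) := by rw [hx]; gcongr
    linarith
  have hx24 : x ≤ 1 / 24 := by nlinarith
  -- the values of `radius` near the critical height
  have hD : ∀ k : ℝ, 2 ≤ k → x ≤ 1 - (n - 1) * radius n τ (L - k * x) := by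
    intro k hk
    rw [(radius_eq hn hτ _).1, sub_sub_cancel]
    have h1 : Real.exp (-(n * (k * x))) ≤ 1 / (1 + 2 * x) := by
      rw [Real.exp_neg, ← one_div]
      refine one_div_le_one_div_of_le (by linarith) ?_
      have h2 : 2 * x ≤ n * (k * x) := by
        have : 2 * x ≤ k * x := by gcongr
        nlinarith
      linarith [Real.add_one_le_exp (n * (k * x))]
    have h2 : 1 / (1 + 2 * x) ≤ 1 - x := by
      rw [div_le_iff₀ (by linarith)]; nlinarith
    linarith
  -- At distance `x` above the critical height `(n-1) · radius = e^{nx}`, at least `1 + x` and at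
  -- most `4/3`; so `P` has changed sign while `radius ≤ 2/3`.
  have hD3 : x ≤ (n - 1) * radius n τ (L + x) - 1 ∧ radius n τ (L + x) ≤ 2 / 3 := by
    have h1 := (radius_eq hn hτ (L + x)).1
    have h0 : -(n * (L - (L + x))) = n * x := by ring
    rw [← hL, h0] at h1
    have h2 := Real.add_one_le_exp (n * x)
    have h3 : Real.exp (n * x) ≤ 4 / 3 := by
      have h4 : 1 - n * x ≤ Real.exp (-(n * x)) := by linarith [Real.add_one_le_exp (-(n * x))]
      rw [Real.exp_neg] at h4
      have h5 := Real.exp_pos (n * x)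
      have h6 : (1 - n * x) * Real.exp (n * x) ≤ 1 := by
        calc _ ≤ (Real.exp (n * x))⁻¹ * Real.exp (n * x) := by gcongr
          _ = 1 := inv_mul_cancel₀ h5.ne'
      nlinarith
    refine ⟨by nlinarith, ?_⟩
    rw [← h1] at h3
    have := radius_pos hn hτ (L + x)
    nlinarith
  have hL0 : 0 < L - 4 * x := by linarith
  have hsmall : x ≤ 1 - (n - 1) * radius n τ 0 := by
    refine (hD 4 (by norm_num)).trans ?_
    have := mul_le_mul_of_nonneg_left ((radius_strictMono hn hτ).monotone hL0.le)
      (by linarith : (0 : ℝ) ≤ n - 1)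
    linarith
  have happ : ApproxCurve n τ K a b :=
    ⟨hab, hτ, by linarith, hsmall, fun φ hφ => hest τ hτ t1.2 a b ha hb φ hφ⟩
  set C := densityInt n (τ ^ n) a b (2 * Real.pi) with hC
  have hC0 : 0 < C := hab.densityInt_two_pi_pos
  have hτN : τ ^ n * N ≤ 1 / 400 := by
    have : τ ^ n * N ≤ τ * N := by gcongr; exact hτn.trans hττ
    linarith
  have hCpi : |C - 2 * Real.pi| ≤ 400 * (τ ^ n * N) :=
    abs_densityInt_sub_le hab (by linarith) (by linarith)
  have hC1 : 1 ≤ C := by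
    linarith [(abs_le.1 hCpi).1, Real.pi_gt_three]
  -- the two bounds
  have hlow := happ.integral_mem_extensionWidths (σ₁ := L - 2 * x) hL0 (by linarith)
    (hD 2 le_rfl)
  have hupp := fun {w : ℝ} hw => happ.width_le (w := w) (σ₃ := L + x) hL0.le (by linarith)
    (hD 4 (by norm_num)) hD3.2 hD3.1 hw
  rw [intervalIntegral.integral_div] at hlow
  rw [← hx] at hlow hupp
  rw [← hC] at hlow hupp
  have herr : ∀ κ : ℝ, |κ| = x → |(∫ t in (0 : ℝ)..L - 4 * x, limitDensity n (radius n τ t) *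
        (1 + κ / (1 - (n - 1) * radius n τ t))) - (L + c)| ≤
      (8 * n ^ 2 + 26 * K) * (τ ^ 2 * (1 + L)) := by
    intro κ hκ
    have h1 := abs_integral_limitDensity_sub_le hn hc hτ (by linarith : 0 < 4 * x)
      (by linarith : 4 * x ≤ L) κ
    rw [hκ] at h1
    refine h1.trans ?_
    have h2 := exp_neg_critHeight_le hn hτ hτ1
    have h3 : τ ^ 2 ≤ τ ^ 2 * (1 + L) := le_mul_of_one_le_right (by positivity) (by linarith)
    have h4 : (n : ℝ) ^ 2 * τ ^ 2 ≤ n ^ 2 * (τ ^ 2 * (1 + L)) := by gcongr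
    have h5 : x ≤ K * (τ ^ 2 * (1 + L)) := by rw [hx]; gcongr
    have h6 : x * (10 * (1 + L)) = 10 * (K * (τ ^ 2 * (1 + L))) := by rw [hx]; ring
    linarith
  have e1 := herr (-x) (by rw [abs_neg, abs_of_pos hx0])
  have e2 := herr x (abs_of_pos hx0)
  simp only [neg_div, ← sub_eq_add_neg] at e1
  set A₁ := ∫ t in (0 : ℝ)..L - 4 * x, limitDensity n (radius n τ t) *
        (1 - x / (1 - (n - 1) * radius n τ t)) with hA₁
  set A₂ := ∫ t in (0 : ℝ)..L - 4 * x, limitDensity n (radius n τ t) *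
        (1 + x / (1 - (n - 1) * radius n τ t)) with hA₂
  set E := extensionWidths (curvXi n (τ ^ n) a b) with hE
  have hne : E.Nonempty := ⟨_, hlow⟩
  have hbdd : BddAbove E := ⟨_, fun w hw => hupp hw⟩
  refine ⟨a, b, hab, hne, hbdd, hL1, ?_⟩
  set δ := sSup E with hδ
  have d1 : A₁ ≤ C * δ := by
    have := le_csSup hbdd hlow
    rw [div_le_iff₀ hC0] at this
    linarith
  have d2 : C * δ ≤ A₂ + K * (L + x - (L - 4 * x)) := by
    have := csSup_le hne fun w hw => hupp hw
    rw [le_div_iff₀ hC0] at this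
    linarith
  have hδ0 : 0 ≤ δ := hlow.1.le.trans (le_csSup hbdd hlow)
  set Y := τ ^ 2 * (1 + L) with hY
  have hY0 : 0 ≤ Y := by positivity
  have hY1 : Y ≤ 1 + L := mul_le_of_le_one_left (by linarith) (by linarith)
  have hKx : K * (L + x - (L - 4 * x)) ≤ 5 * K ^ 2 * Y := by
    have h3 : τ ^ 2 ≤ Y := le_mul_of_one_le_right (by positivity) (by linarith)
    have h4 : 5 * K ^ 2 * τ ^ 2 ≤ 5 * K ^ 2 * Y := by gcongr
    have h5 : K * (L + x - (L - 4 * x)) = 5 * K ^ 2 * τ ^ 2 := by rw [hx]; ring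
    linarith
  have hCδ : |C * δ - (L + c)| ≤ K₁ * Y := by
    have hK2 : 0 ≤ 5 * K ^ 2 * Y := by positivity
    rw [abs_le, hK₁]
    have := abs_le.1 e1
    have := abs_le.1 e2
    constructor <;> linarith
  have hK₁0 : 0 ≤ K₁ := by positivity
  -- A crude bound of order `L`, needed to replace `C` by `2π`: the change `(C - 2π) δ` is then
  -- `O(τⁿ L)`.
  have hδle : δ ≤ (1 + |c| + K₁) * (1 + L) := by
    have h1 : δ ≤ C * δ := le_mul_of_one_le_left hδ0 hC1
    have h2 := (abs_le.1 hCδ).2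
    have h3 : K₁ * Y ≤ K₁ * (1 + L) := by gcongr
    have h4 : |c| ≤ |c| * (1 + L) := le_mul_of_one_le_right (abs_nonneg c) (by linarith)
    linarith [le_abs_self c]
  have hfin : |(C - 2 * Real.pi) * δ| ≤ 400 * N * (1 + |c| + K₁) * Y := by
    rw [abs_mul, abs_of_nonneg hδ0]
    calc |C - 2 * Real.pi| * δ ≤ (400 * (τ ^ n * N)) * ((1 + |c| + K₁) * (1 + L)) := by gcongr
      _ ≤ (400 * (τ ^ 2 * N)) * ((1 + |c| + K₁) * (1 + L)) := by gcongr
      _ = _ := by rw [hY]; ring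
  have e : 2 * Real.pi * δ - (L + c) = (C * δ - (L + c)) - (C - 2 * Real.pi) * δ := by ring
  rw [e]
  refine (abs_sub _ _).trans ?_
  linarith

/-- The asymptotics of the width in terms of `ε`. -/
theorem exists_sSup_width_asymptotics {n : ℕ} (hn : 3 ≤ n) :
    ∃ η K : ℝ, ∀ᶠ ε : ℝ in 𝓝[>] 0, ∃ a b : ℝ, RegularCurve n ε a b ∧
      (extensionWidths (curvXi n ε a b)).Nonempty ∧
      BddAbove (extensionWidths (curvXi n ε a b)) ∧
      |2 * Real.pi * sSup (extensionWidths (curvXi n ε a b)) - (|Real.log ε| / n + η)| ≤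
        K * |ε ^ (2 / (n : ℝ)) * Real.log ε| := by
  have hn1 : (3 : ℝ) ≤ n := by exact_mod_cast hn
  have hn0 : n ≠ 0 := by omega
  obtain ⟨c, K, h⟩ := exists_width_asymptotics hn
  have ht : Tendsto (fun ε : ℝ => ε ^ (1 / (n : ℝ))) (𝓝[>] 0) (𝓝[>] 0) := by
    refine tendsto_nhdsWithin_of_tendsto_nhds_of_eventually_within _ ?_ ?_
    · have h1 : ContinuousAt (fun ε : ℝ => ε ^ (1 / (n : ℝ))) 0 :=
        Real.continuousAt_rpow_const _ _ (Or.inr (by positivity))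
      have h2 := h1.tendsto
      rw [Real.zero_rpow (by positivity)] at h2
      exact h2.mono_left nhdsWithin_le_nhds
    · filter_upwards [self_mem_nhdsWithin] with ε hε
      exact Real.rpow_pos_of_pos hε _
  -- The constant part of `critHeight` together with the regularized integral `c`.
  refine ⟨Real.log 2 - Real.log (((n : ℝ) - 1) ^ 2 / 2) / n + c, |K| * 3, ?_⟩
  filter_upwards [ht.eventually h, Ioo_mem_nhdsGT (Real.exp_pos (-1))] with ε hε hε1
  have hε0 : 0 < ε := hε1.1
  set τ := ε ^ (1 / (n : ℝ)) with hτdef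
  have hτ : 0 < τ := Real.rpow_pos_of_pos hε0 _
  have e1 : τ ^ n = ε := by
    rw [hτdef, one_div]; exact Real.rpow_inv_natCast_pow hε0.le hn0
  have e2 : τ ^ 2 = ε ^ (2 / (n : ℝ)) := by
    rw [hτdef, ← Real.rpow_mul_natCast hε0.le]
    congr 1
    push_cast
    ring
  have hlog : Real.log ε < -1 := by
    rw [Real.log_lt_iff_lt_exp hε0]; exact hε1.2
  have habs : |Real.log ε| = -Real.log ε := abs_of_neg (by linarith)
  have e3 : critHeight n τ = Real.log 2 + |Real.log ε| / n -
      Real.log (((n : ℝ) - 1) ^ 2 / 2) / n := by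
    rw [critHeight, Real.log_div two_ne_zero hτ.ne', hτdef, Real.log_rpow hε0, habs]
    ring
  rw [e1, e2] at hε
  obtain ⟨a, b, h1, h2, h3, h4, h5⟩ := hε
  refine ⟨a, b, h1, h2, h3, ?_⟩
  have e4 : |Real.log ε| / n + (Real.log 2 - Real.log (((n : ℝ) - 1) ^ 2 / 2) / n + c) =
      critHeight n τ + c := by rw [e3]; ring
  rw [e4]
  refine h5.trans ?_
  -- Since `ε < e⁻¹`, `|log ε| > 1` absorbs the constants.
  have hle : 1 + critHeight n τ ≤ 3 * |Real.log ε| := by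
    have l1 : 0 ≤ Real.log (((n : ℝ) - 1) ^ 2 / 2) / n :=
      div_nonneg (Real.log_nonneg (by nlinarith)) (by linarith)
    have l2 : |Real.log ε| / n ≤ |Real.log ε| :=
      div_le_self (abs_nonneg _) (by linarith)
    have l3 := Real.log_two_lt_d9
    rw [e3, habs] at *
    linarith
  have hp : 0 ≤ ε ^ (2 / (n : ℝ)) := Real.rpow_nonneg hε0.le _
  rw [abs_mul, abs_of_nonneg hp]
  calc K * (ε ^ (2 / (n : ℝ)) * (1 + critHeight n τ)) ≤
      |K| * (ε ^ (2 / (n : ℝ)) * (3 * |Real.log ε|)) := by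
        refine mul_le_mul (le_abs_self K) (by gcongr) ?_ (abs_nonneg K)
        exact mul_nonneg hp (by linarith)
    _ = _ := by ring

end PerturbedCircle

end

/-! ### The theorem. -/

theorem proposition3 (n : ℕ) (hn : 3 ≤ n) :
    ∃ (η : ℝ) (δ : ℝ → ℝ),
      (∀ᶠ ε : ℝ in 𝓝[>] (0 : ℝ),
        (∃ (γ : ℝ → PerturbedCircle.Plane) (l : ℝ),
          PerturbedCircle.IsArcLengthParam (PerturbedCircle.perturbedCircle n ε) γ l) ∧
        ∀ (γ : ℝ → PerturbedCircle.Plane) (l : ℝ),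
          PerturbedCircle.IsArcLengthParam (PerturbedCircle.perturbedCircle n ε) γ l →
            (∀ s : ℝ, 0 < PerturbedCircle.curvature γ s) ∧
            PerturbedCircle.IsSingularityDistance
              (PerturbedCircle.curvatureXi γ l) (δ ε)) ∧
      (fun ε : ℝ => 2 * Real.pi * δ ε - (|Real.log ε| / (n : ℝ) + η))
        =O[𝓝[>] (0 : ℝ)] (fun ε : ℝ => ε ^ (2 / (n : ℝ)) * Real.log ε) := by
  obtain ⟨η, K, h⟩ := PerturbedCircle.exists_sSup_width_asymptotics hn
  -- The implication lets one function `δ` be chosen for all `ε`: the supremum of the widths where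
  -- the asymptotics hold, and the default value 0 elsewhere.
  have hch : ∀ ε : ℝ, ∃ d : ℝ, (∃ a b : ℝ, PerturbedCircle.RegularCurve n ε a b ∧
      (PerturbedCircle.extensionWidths (PerturbedCircle.curvXi n ε a b)).Nonempty ∧
      BddAbove (PerturbedCircle.extensionWidths (PerturbedCircle.curvXi n ε a b)) ∧
      |2 * Real.pi * sSup (PerturbedCircle.extensionWidths (PerturbedCircle.curvXi n ε a b)) -
        (|Real.log ε| / n + η)| ≤ K * |ε ^ (2 / (n : ℝ)) * Real.log ε|) →
      ∃ a b : ℝ, PerturbedCircle.RegularCurve n ε a b ∧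
      (PerturbedCircle.extensionWidths (PerturbedCircle.curvXi n ε a b)).Nonempty ∧
      BddAbove (PerturbedCircle.extensionWidths (PerturbedCircle.curvXi n ε a b)) ∧
      d = sSup (PerturbedCircle.extensionWidths (PerturbedCircle.curvXi n ε a b)) ∧
      |2 * Real.pi * d - (|Real.log ε| / n + η)| ≤ K * |ε ^ (2 / (n : ℝ)) * Real.log ε| := by
    intro ε
    by_cases hex : ∃ a b : ℝ, PerturbedCircle.RegularCurve n ε a b ∧
      (PerturbedCircle.extensionWidths (PerturbedCircle.curvXi n ε a b)).Nonempty ∧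
      BddAbove (PerturbedCircle.extensionWidths (PerturbedCircle.curvXi n ε a b)) ∧
      |2 * Real.pi * sSup (PerturbedCircle.extensionWidths (PerturbedCircle.curvXi n ε a b)) -
        (|Real.log ε| / n + η)| ≤ K * |ε ^ (2 / (n : ℝ)) * Real.log ε|
    · obtain ⟨a, b, h1, h2, h3, h4⟩ := hex
      exact ⟨_, fun _ => ⟨a, b, h1, h2, h3, rfl, h4⟩⟩
    · exact ⟨0, fun h' => absurd h' hex⟩
  choose δ hδ using hch
  refine ⟨η, δ, ?_, ?_⟩
  · filter_upwards [h] with ε hε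
    obtain ⟨a, b, h1, h2, h3, h4, -⟩ := hδ ε hε
    refine ⟨h1.exists_arcLengthParam, fun γ l hγ => ?_⟩
    obtain ⟨hκ, e, c', he, hc'⟩ := h1.curvatureXi_eq hγ
    refine ⟨hκ, ?_⟩
    have hfun : PerturbedCircle.curvatureXi γ l =
        fun ξ => PerturbedCircle.curvXi n ε a b (e * ξ + c') := funext hc'
    -- The widths are invariant under translations and reflections, so a single `δ ε` serves for all
    -- arc-length parametrizations.
    have hw : PerturbedCircle.extensionWidths (PerturbedCircle.curvatureXi γ l) =
        PerturbedCircle.extensionWidths (PerturbedCircle.curvXi n ε a b) := by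
      rw [hfun]; exact PerturbedCircle.extensionWidths_comp _ he c'
    rw [h4, ← hw]
    refine PerturbedCircle.isSingularityDistance_sSup (fun x => ?_) (by rwa [hw]) (by rwa [hw])
    rw [hc', hc']
    rcases he with rfl | rfl
    · have := h1.curvXi_periodic (1 * x + c')
      rw [← this]; congr 1; ring
    · have := h1.curvXi_periodic (-1 * (x + 1) + c')
      rw [← this]; congr 1; ring
  · refine IsBigO.of_bound K ?_
    filter_upwards [h] with ε hε
    obtain ⟨a, b, h1, h2, h3, -, h5⟩ := hδ ε hε
    simpa only [Real.norm_eq_abs] using h5
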